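/- **Setting.** Let $G=(V,E,s,t,\delta)$ be a finite connected graph with at least one edge, simple (no loops, at most one edge between two vertices), oriented, with source and target maps $s,t:E\to V$ and weights $\delta_e>0$; write $e^-=s(e)$, $e^+=t(e)$. Let $n\ge 2$ be even. For each $v\in V$ let: - $X_v$ be an $n$-dimensional real vector space with a symmetric bilinear form $g_v$ of signature $(1,n-1)$ (one plus sign), $\mathbb{C}l(X_v)$ its complexified Clifford algebra with $x^2=g_v(x,x)$, $\mathbb{C}l(X_v)^0$ its even part, and $c_v$ its canonical real structure; - $S_v$ be an irreducible complex representation space of $\mathbb{C}l(X_v)$ with a Krein product $(\cdot,\cdot)_v$ (a nondegenerate hermitian form) for which all $x\in X_v$ are self-adjoint; - $\chi_v=i^{n/2+1}e_1\cdots e_n$ be the chirality operator, where $(e_i)$ is a pseudo-orthonormal basis of $X_v$ (so $\chi_v$ is fixed by an orientation of $X_v$); - $J_v$ be an antilinear operator on $S_v$ with $J_v^2=\epsilon$ ($\epsilon=\pm1$ independent of $v$), $J_vJ_v^\times=-1$, and $J_vaJ_v^{-1}=-c_v(a)$ for all odd $a\in\mathbb{C}l(X_v)$. Here $\times$ denotes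 the adjoint for the Krein product, which for an antilinear $J$ means $(J\psi,\varphi)=\overline{(\psi,J^\times\varphi)}$. For each edge $e$ let $h_e^+:S_{e^-}\to S_{e^+}$ be a linear isomorphism (the discrete connection), $h_e^-=(h_e^+)^{-1}$, and $\gamma_e^\pm\in\mathrm{End}(S_{e^\pm})$. The *split Dirac structure* over $G$ is $(\mathcal A^0,K,(\cdot,\cdot),\pi,D,J,\chi)$, where $\mathcal A^0=\prod_v\mathbb{C}l(X_v)^0$, $K$ is the space of maps $(e,\pm)\mapsto F(e,\pm)\in S_{e^\pm}$ on $E\times\{-,+\}$, and $$(F,F')=\sum_{e}\big((F(e,+),h_e^+F'(e,-))+(F(e,-),h_e^-F'(e,+))\big),\qquad (\pi(a)F)(e,\pm)=a(e^\pm)F(e,\pm),$$ $$(DF)(e,\pm)=\mp\tfrac1{\delta_e}\gamma_e^\pm h_e^\pm F(e,\mp),\qquad (\chi F)(e,\pm)=\chi_{e^\pm}F(e,\pm),\qquad (JF)(e,\pm)=h_e^\pm J_{e^\mp}F(e,\mp).$$ **Definitions.** A *positive time-orientation form* of such a multiplet is an invertible operator $\beta$ of the form $\sum_i\pi(a_i)[D,\pi(b_i)]$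 with $\beta^\times=\beta$, $J\beta J^{-1}=-\beta$, and $\langle\cdot,\cdot\rangle_\beta:=(\cdot,\beta^{-1}\cdot)$ positive definite. The multiplet is an *antilorentzian spectral spacetime* if $(\cdot,\cdot)$ is a Krein product, $D^\times=D$, $\chi^2=1$, $\chi$ commutes with $\pi(\mathcal A^0)$, $\chi D=-D\chi$, $\chi^\times=-\chi$, $J^2=\tilde\epsilon$, $JD=DJ$, $J\chi=\tilde\epsilon''\chi J$, $J^\times J=-1$ for some signs $\tilde\epsilon,\tilde\epsilon''\in\{\pm1\}$ (the pairs $(\tilde\epsilon,\tilde\epsilon'')=(1,1),(-1,-1),(-1,1),(1,-1)$ being those of KO dimension $0,2,4,6$ mod $8$), and a positive time-orientation form exists. It is *reconstructible* if moreover $\pi$ is faithful and $\pi(\mathcal A^0)^{*_\beta}=\pi(\mathcal A^0)$ for some positive time-orientation form $\beta$, where $*_\beta$ is the adjunction of $\langle\cdot,\cdot\rangle_\beta$. The connection is *Clifford* if for each edge $e$ there is a linear $\Lambda:X_{e^-}\to X_{e^+}$ with $h_e^+x=\Lambda(x)h_e^+$ for all $x\in X_{e^-}$. A vector $x\in X_v$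 is *timelike* if $g_v(x,x)>0$, and *future-directed* timelike if moreover $(\cdot,x\,\cdot)_v$ is positive definite. For a path $P$ in $G$ from $v$ to $w$ (edges may be traversed in both directions) let $h_P:S_v\to S_w$ be the composite of the corresponding $h_e^\pm$, and $H_P(a)=h_Pah_P^{-1}$. The *holonomy group* at $v$ is the group of all $H_P$ for closed paths $P$ at $v$. A vector field $v\mapsto u_v\in X_v$ is *parallel* if $u_w=H_P(u_v)$ for all $v,w$ and all paths $P$ from $v$ to $w$. **Theorem.** Assume that: 1. the $\gamma_e^\pm$ are Krein self-adjoint and odd ($\chi_{e^\pm}\gamma_e^\pm=-\gamma_e^\pm\chi_{e^\pm}$), satisfy $J_{e^+}\gamma_e^+J_{e^+}^{-1}=-h_e^+\gamma_e^-h_e^-$, and do not vanish identically on either of the two eigenspaces of $\chi_{e^\pm}$; 2. the connection is metric ($h_e^+$ is Krein-unitary), spin preserving ($h_e^+J_{e^-}=J_{e^+}h_e^+$) and orientation preserving ($\chi_{e^+}h_e^+=h_e^+\chi_{e^-}$). If $n=2$, the split Dirac structure over $G$ is reconstructible. If $n>2$ and the connection is Clifford, the split Dirac structure is reconstructible if and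 only if there is a parallel vector field on $G$ that is future-directed timelike at every vertex; equivalently, for any vertex $v$, if and only if the holonomy group at $v$ fixes a timelike vector of $X_v$. -/

import Mathlib

open scoped TensorProduct ComplexConjugate

noncomputable section

/-! ## Spectral data and antilorentzian spectral spacetimes (finite-dimensional) -/

/-- A multiplet `(A, K, (.,.), π, D, J, χ)`. The product `(.,.)` is antilinear in its
first and linear in its second argument. -/
structure SpectralData (A K : Type*) [Ring A] [Algebra ℂ A] [AddCommGroup K] [Module ℂ K]
    [FiniteDimensional ℂ K] where
  krein : K →ₗ⋆[ℂ] K →ₗ[ℂ] ℂ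
  π : A →ₐ[ℂ] Module.End ℂ K
  D : Module.End ℂ K
  J : K →ₗ⋆[ℂ] K
  χ : Module.End ℂ K

/-- In finite dimension, a Krein product is a nondegenerate hermitian form. -/
structure IsKreinProduct {K : Type*} [AddCommGroup K] [Module ℂ K]
    (B : K →ₗ⋆[ℂ] K →ₗ[ℂ] ℂ) : Prop where
  hermitian : ∀ ψ φ, B φ ψ = conj (B ψ φ)
  nondegenerate : ∀ φ, (∀ ψ, B ψ φ = 0) → φ = 0

/-- `T'` is the adjoint of the linear operator `T` for the form `B`. -/
def IsAdjointFor {K : Type*} [AddCommGroup K] [Module ℂ K]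
    (B : K → K → ℂ) (T T' : Module.End ℂ K) : Prop :=
  ∀ ψ φ, B (T ψ) φ = B ψ (T' φ)

/-- The form `(., T .)` is positive definite. -/
def IsPosDefWith {K : Type*} [AddCommGroup K] [Module ℂ K]
    (B : K →ₗ⋆[ℂ] K →ₗ[ℂ] ℂ) (T : Module.End ℂ K) : Prop :=
  ∀ ψ, ψ ≠ 0 → 0 < (B ψ (T ψ)).re ∧ (B ψ (T ψ)).im = 0

/-- The antilorentzian table of KO signs `(ε, ε'', κ)`. -/
def IsAntilorentzianKOSigns (k : ZMod 8) (ε ε'' κ : ℂ) : Prop :=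
  (k = 2 ∧ ε = -1 ∧ ε'' = -1 ∧ κ = -1) ∨
  (k = 0 ∧ ε = 1 ∧ ε'' = 1 ∧ κ = -1) ∨
  (k = 6 ∧ ε = 1 ∧ ε'' = -1 ∧ κ = -1) ∨
  (k = 4 ∧ ε = -1 ∧ ε'' = 1 ∧ κ = -1)

namespace SpectralData

variable {A K : Type*} [Ring A] [Algebra ℂ A] [AddCommGroup K] [Module ℂ K]
  [FiniteDimensional ℂ K]

/-- The noncommutative 1-forms: finite sums of the operators `π(a) [D, π(b)]`. -/
def oneForms (M : SpectralData A K) : Submodule ℂ (Module.End ℂ K) :=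
  Submodule.span ℂ {T | ∃ a b : A, T = M.π a * (M.D * M.π b - M.π b * M.D)}

/-- The form `⟨F, G⟩_β = (F, β⁻¹ G)`. -/
def innerWith (M : SpectralData A K) (β : (Module.End ℂ K)ˣ) (F G : K) : ℂ :=
  M.krein F ((↑β⁻¹ : Module.End ℂ K) G)

/-- Positive time-orientation 1-forms. -/
structure IsPositiveTimeOrientation (M : SpectralData A K) (β : (Module.End ℂ K)ˣ) : Prop where
  oneForm : (β : Module.End ℂ K) ∈ M.oneForms
  selfAdjoint : IsAdjointFor (fun F G => M.krein F G) (β : Module.End ℂ K) β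
  imaginary : ∀ F, M.J ((β : Module.End ℂ K) F) = -((β : Module.End ℂ K) (M.J F))
  posDef : IsPosDefWith M.krein (↑β⁻¹ : Module.End ℂ K)

/-- Even antilorentzian spectral spacetimes of KO dimension `k`. The adjoint `J^×` of the
antilinear operator `J` is given by `(Jψ, φ) = conj (ψ, J^× φ)`. -/
structure IsAntilorentzianSpacetime (M : SpectralData A K) (k : ZMod 8) : Prop where
  krein : IsKreinProduct M.krein
  D_selfAdjoint : IsAdjointFor (fun F G => M.krein F G) M.D M.D
  χ_sq : M.χ * M.χ = 1
  χ_comm : ∀ a, M.π a * M.χ = M.χ * M.π a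
  χ_D : M.χ * M.D = -(M.D * M.χ)
  χ_adjoint : IsAdjointFor (fun F G => M.krein F G) M.χ (-M.χ)
  J_spec : ∃ ε ε'' κ : ℂ, IsAntilorentzianKOSigns k ε ε'' κ ∧
    (∀ F, M.J (M.J F) = ε • F) ∧
    (∀ F, M.J (M.D F) = M.D (M.J F)) ∧
    (∀ F, M.J (M.χ F) = ε'' • M.χ (M.J F)) ∧
    (∃ J' : K →ₗ⋆[ℂ] K, (∀ F G, M.krein (M.J F) G = conj (M.krein F (J' G))) ∧
      ∀ F, J' (M.J F) = κ • F)
  exists_orientation : ∃ β, M.IsPositiveTimeOrientation β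

/-- A spectral spacetime is reconstructible if `π` is faithful and `π(A)^{*_β} = π(A)` for
some positive time-orientation form `β`, with `*_β` the adjunction of `⟨., .⟩_β`. -/
def IsReconstructible (M : SpectralData A K) : Prop :=
  (∃ k, M.IsAntilorentzianSpacetime k) ∧ Function.Injective M.π ∧
  ∃ β, M.IsPositiveTimeOrientation β ∧
    {T : Module.End ℂ K | ∃ a, IsAdjointFor (M.innerWith β) (M.π a) T} = Set.range M.π

end SpectralData

/-! ## Weighted oriented graphs -/

/-- Positively weighted oriented simple graphs. -/
structure WeightedOrientedGraph (V E : Type*) where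
  src : E → V
  tgt : E → V
  weight : E → ℝ
  weight_pos : ∀ e, 0 < weight e
  loopless : ∀ e, src e ≠ tgt e
  simple : Function.Injective fun e => s(src e, tgt e)

namespace WeightedOrientedGraph

variable {V E : Type*}

/-- The extremities of an edge: `e⁺ = t(e)` for `true`, `e⁻ = s(e)` for `false`. -/
def endpt (G : WeightedOrientedGraph V E) (e : E) : Bool → V
  | true => G.tgt e
  | false => G.src e

/-- Paths from `x`, whose steps run along edges or against them. -/
inductive Walk (G : WeightedOrientedGraph V E) (x : V) : V → Type _
  | nil : Walk G x x
  | fwd (e : E) (p : Walk G x (G.src e)) : Walk G x (G.tgt e)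
  | bwd (e : E) (p : Walk G x (G.tgt e)) : Walk G x (G.src e)

def Connected (G : WeightedOrientedGraph V E) : Prop := ∀ x y, Nonempty (G.Walk x y)

namespace Walk

variable {G : WeightedOrientedGraph V E}

def append {x y : V} (p : G.Walk x y) : {z : V} → G.Walk y z → G.Walk x z
  | _, nil => p
  | _, fwd e q => fwd e (p.append q)
  | _, bwd e q => bwd e (p.append q)

def reverse {x : V} : {y : V} → G.Walk x y → G.Walk y x
  | _, nil => nil
  | _, fwd e p => (bwd e nil).append p.reverse
  | _, bwd e p => (fwd e nil).append p.reverse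

end Walk

end WeightedOrientedGraph

/-! ## Complexified Clifford algebras -/

section Clifford

variable {X : Type*} [AddCommGroup X] [Module ℝ X]

/-- `ℂl(X, g)`, for `Q x = g(x, x)`; the Clifford relation is `x² = g(x, x)`. -/
abbrev CCl (Q : QuadraticForm ℝ X) : Type _ := ℂ ⊗[ℝ] CliffordAlgebra Q

/-- The real vector `x` as an element of `ℂl(X, g)`. -/
def CCl.vec (Q : QuadraticForm ℝ X) (x : X) : CCl Q := 1 ⊗ₜ[ℝ] CliffordAlgebra.ι Q x

/-- The canonical real structure `c` of `ℂl(X, g)`. -/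
def CCl.c (Q : QuadraticForm ℝ X) : CCl Q →ₐ[ℝ] CCl Q :=
  Algebra.TensorProduct.map (Complex.conjAe : ℂ →ₐ[ℝ] ℂ) (AlgHom.id ℝ (CliffordAlgebra Q))

/-- The even part of `ℂl(X, g)`. -/
abbrev CCl.even (Q : QuadraticForm ℝ X) : Subalgebra ℂ (CCl Q) :=
  (CliffordAlgebra.even Q).baseChange ℂ

/-- The odd part of `ℂl(X, g)`. -/
def CCl.odd (Q : QuadraticForm ℝ X) : Submodule ℂ (CCl Q) :=
  (CliffordAlgebra.evenOdd Q 1).baseChange ℂ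

/-- Pseudo-orthonormal bases for signature `(+, -, …, -)`. -/
def IsPseudoOrthonormal {n : ℕ} (Q : QuadraticForm ℝ X) (b : Module.Basis (Fin n) ℝ X) : Prop :=
  (∃ i₀, Q (b i₀) = 1 ∧ ∀ i, i ≠ i₀ → Q (b i) = -1) ∧
  ∀ i j, i ≠ j → QuadraticMap.polar Q (b i) (b j) = 0

end Clifford

/-! ## The split Dirac structure -/

/-- The ingredients of the split Dirac structure over `G`: a discrete Clifford bundle with
fibres `ℂl(X v, g v)`, a discrete spinor bundle with fibres `S v`, a discrete connection `h`
and the operators `γ`. -/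
structure DiscreteSpinorBundle {V E : Type*} (G : WeightedOrientedGraph V E) (n : ℕ)
    (X S : V → Type*)
    [∀ v, AddCommGroup (X v)] [∀ v, Module ℝ (X v)]
    [∀ v, AddCommGroup (S v)] [∀ v, Module ℂ (S v)] [∀ v, FiniteDimensional ℂ (S v)] where
  /-- the antilorentzian metric `Q v x = g_v(x, x)` on the `n`-dimensional space `X v` -/
  Q : ∀ v, QuadraticForm ℝ (X v)
  antilorentzian : ∀ v, ∃ b : Module.Basis (Fin n) ℝ (X v), IsPseudoOrthonormal (Q v) b
  /-- the irreducible representation of `ℂl(X v, g v)` on `S v` -/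
  ρ : ∀ v, CCl (Q v) →ₐ[ℂ] Module.End ℂ (S v)
  nontrivial : ∀ v, Nontrivial (S v)
  irreducible : ∀ v (W : Submodule ℂ (S v)), (∀ a, ∀ ψ ∈ W, ρ v a ψ ∈ W) → W = ⊥ ∨ W = ⊤
  /-- the Krein product on `S v`, for which real vectors are self-adjoint -/
  krein : ∀ v, S v →ₗ⋆[ℂ] S v →ₗ[ℂ] ℂ
  isKrein : ∀ v, IsKreinProduct (krein v)
  krein_compatible : ∀ v x,
    IsAdjointFor (fun ψ φ => krein v ψ φ) (ρ v (CCl.vec (Q v) x)) (ρ v (CCl.vec (Q v) x))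
  /-- the chirality operator of `ℂl(X v, g v)`, for one of the two orientations of `X v` -/
  χ : ∀ v, Module.End ℂ (S v)
  χ_eq : ∀ v, ∃ b : Module.Basis (Fin n) ℝ (X v), IsPseudoOrthonormal (Q v) b ∧
    χ v = ρ v (Complex.I ^ (n / 2 + 1) • (List.ofFn fun i => CCl.vec (Q v) (b i)).prod)
  /-- the charge conjugation on `S v`: `J² = ε`, `J J^× = -1`, `c(a) = -J a J⁻¹` for odd `a` -/
  J : ∀ v, S v →ₗ⋆[ℂ] S v
  ε : ℂ
  ε_sign : ε = 1 ∨ ε = -1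
  J_sq : ∀ v ψ, J v (J v ψ) = ε • ψ
  J_adjoint : ∀ v, ∃ J' : S v →ₗ⋆[ℂ] S v,
    (∀ ψ φ, krein v (J v ψ) φ = conj (krein v ψ (J' φ))) ∧ ∀ ψ, J v (J' ψ) = -ψ
  J_real : ∀ v, ∀ a ∈ CCl.odd (Q v), ∀ ψ, ρ v (CCl.c (Q v) a) (J v ψ) = -J v (ρ v a ψ)
  /-- the parallel transport `h_e⁺ : S_{e⁻} → S_{e⁺}` -/
  h : ∀ e, S (G.src e) ≃ₗ[ℂ] S (G.tgt e)
  /-- the operators `γ_e^±` -/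
  γ : ∀ e (b : Bool), Module.End ℂ (S (G.endpt e b))

namespace DiscreteSpinorBundle

variable {V E : Type*} {G : WeightedOrientedGraph V E} {n : ℕ} {X S : V → Type*}
  [∀ v, AddCommGroup (X v)] [∀ v, Module ℝ (X v)]
  [∀ v, AddCommGroup (S v)] [∀ v, Module ℂ (S v)] [∀ v, FiniteDimensional ℂ (S v)]

/-- Clifford multiplication by a real vector. -/
def cliff (B : DiscreteSpinorBundle G n X S) (v : V) (x : X v) : Module.End ℂ (S v) :=
  B.ρ v (CCl.vec (B.Q v) x)

/-- `h_e^± : S_{e^∓} → S_{e^±}`, with `h_e⁻` the inverse of `h_e⁺`. -/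
def hpm (B : DiscreteSpinorBundle G n X S) (e : E) :
    (b : Bool) → S (G.endpt e (!b)) ≃ₗ[ℂ] S (G.endpt e b)
  | true => B.h e
  | false => (B.h e).symm

/-- The algebra `A⁰` of even sections of the discrete Clifford bundle. -/
abbrev EvenSections (B : DiscreteSpinorBundle G n X S) : Type _ := ∀ v, CCl.even (B.Q v)

/-- The sections of the discrete spinor bundle over the split graph `E × {-, +}`. -/
abbrev Sections (_B : DiscreteSpinorBundle G n X S) : Type _ :=
  ∀ p : E × Bool, S (G.endpt p.1 p.2)

/-- `(F, F') = ∑_e (F(e,+), h_e⁺ F'(e,-)) + (F(e,-), h_e⁻ F'(e,+))`. -/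
def splitKrein [Fintype E] (B : DiscreteSpinorBundle G n X S) :
    B.Sections →ₗ⋆[ℂ] B.Sections →ₗ[ℂ] ℂ :=
  LinearMap.mk₂'ₛₗ (starRingEnd ℂ) (RingHom.id ℂ)
    (fun F F' => ∑ e : E,
      (B.krein (G.endpt e true) (F (e, true)) (B.hpm e true (F' (e, false))) +
        B.krein (G.endpt e false) (F (e, false)) (B.hpm e false (F' (e, true)))))
    (by
      intro F₁ F₂ F'
      simp only [Pi.add_apply, map_add, LinearMap.add_apply, ← Finset.sum_add_distrib]
      exact Finset.sum_congr rfl fun _ _ => by ring)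
    (by
      intro c F F'
      simp only [Pi.smul_apply, LinearMap.map_smulₛₗ, LinearMap.smul_apply, Finset.smul_sum,
        smul_add])
    (by
      intro F F₁ F₂
      rw [← Finset.sum_add_distrib]
      refine Finset.sum_congr rfl fun e _ => ?_
      have h₁ := (B.hpm e true).map_add (F₁ (e, false)) (F₂ (e, false))
      have h₂ := (B.hpm e false).map_add (F₁ (e, true)) (F₂ (e, true))
      simp only [Pi.add_apply]
      erw [h₁, h₂, map_add, map_add]
      ring)
    (by
      intro c F F'
      simp only [RingHom.id_apply, Finset.smul_sum]
      refine Finset.sum_congr rfl fun e _ => ?_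
      have h₁ := (B.hpm e true).map_smul c (F' (e, false))
      have h₂ := (B.hpm e false).map_smul c (F' (e, true))
      simp only [Pi.smul_apply]
      erw [h₁, h₂, map_smul, map_smul]
      rw [smul_add])

/-- `(π(a) F)(e,±) = a(e^±) · F(e,±)`. -/
def splitRep (B : DiscreteSpinorBundle G n X S) :
    B.EvenSections →ₐ[ℂ] Module.End ℂ B.Sections :=
  AlgHom.ofLinearMap
    { toFun := fun a =>
        { toFun := fun F p => B.ρ _ (a (G.endpt p.1 p.2) : CCl (B.Q _)) (F p)
          map_add' := fun F F' => by ext p; simp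
          map_smul' := fun c F => by ext p; simp }
      map_add' := fun a a' => by ext F p; simp
      map_smul' := fun c a => by ext F p; simp }
    (by ext F p; simp)
    (fun a a' => by ext F p; simp)

/-- `(D F)(e,±) = ∓ (1/δ_e) γ_e^± h_e^± F(e,∓)`. -/
def splitDirac (B : DiscreteSpinorBundle G n X S) : Module.End ℂ B.Sections where
  toFun F p := ((if p.2 then -1 else 1) / (G.weight p.1 : ℂ)) •
    B.γ p.1 p.2 (B.hpm p.1 p.2 (F (p.1, !p.2)))
  map_add' F F' := by ext p; simp
  map_smul' c F := by ext p; simp [smul_comm c]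

/-- `(χ F)(e,±) = χ_{e^±} F(e,±)`. -/
def splitChirality (B : DiscreteSpinorBundle G n X S) : Module.End ℂ B.Sections where
  toFun F p := B.χ (G.endpt p.1 p.2) (F p)
  map_add' F F' := by ext p; simp
  map_smul' c F := by ext p; simp

/-- `(J F)(e,±) = h_e^± J_{e^∓} F(e,∓)`. -/
def splitJ (B : DiscreteSpinorBundle G n X S) : B.Sections →ₗ⋆[ℂ] B.Sections where
  toFun F p := B.hpm p.1 p.2 (B.J (G.endpt p.1 (!p.2)) (F (p.1, !p.2)))
  map_add' F F' := by ext p; simp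
  map_smul' c F := by ext p; simp

/-- The split Dirac structure over `G`. -/
def splitDiracStructure [Fintype E] (B : DiscreteSpinorBundle G n X S) :
    SpectralData B.EvenSections B.Sections where
  krein := B.splitKrein
  π := B.splitRep
  D := B.splitDirac
  J := B.splitJ
  χ := B.splitChirality

/-! ### The discrete connection -/

/-- The connection is metric: parallel transport is Krein-unitary. -/
def IsMetric (B : DiscreteSpinorBundle G n X S) : Prop :=
  ∀ e ψ φ, B.krein (G.tgt e) (B.h e ψ) (B.h e φ) = B.krein (G.src e) ψ φ

def IsSpinPreserving (B : DiscreteSpinorBundle G n X S) : Prop :=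
  ∀ e ψ, B.h e (B.J (G.src e) ψ) = B.J (G.tgt e) (B.h e ψ)

def PreservesOrientation (B : DiscreteSpinorBundle G n X S) : Prop :=
  ∀ e ψ, B.χ (G.tgt e) (B.h e ψ) = B.h e (B.χ (G.src e) ψ)

def IsCliffordConnection (B : DiscreteSpinorBundle G n X S) : Prop :=
  ∀ e, ∃ Λ : X (G.src e) →ₗ[ℝ] X (G.tgt e), ∀ x ψ,
    B.h e (B.cliff (G.src e) x ψ) = B.cliff (G.tgt e) (Λ x) (B.h e ψ)

/-- The necessary and sufficient conditions for the split Dirac structure to be an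
antilorentzian spectral spacetime. -/
structure IsSpectral (B : DiscreteSpinorBundle G n X S) : Prop where
  γ_selfAdjoint : ∀ e b,
    IsAdjointFor (fun ψ φ => B.krein (G.endpt e b) ψ φ) (B.γ e b) (B.γ e b)
  γ_odd : ∀ e b, B.χ (G.endpt e b) * B.γ e b = -(B.γ e b * B.χ (G.endpt e b))
  /-- `J_{e⁺} γ_e⁺ J_{e⁺}⁻¹ = - h_e⁺ γ_e⁻ h_e⁻` -/
  γ_real : ∀ e (ψ : S (G.tgt e)),
    B.J (G.tgt e) (B.γ e true ψ) = -(B.h e (B.γ e false ((B.h e).symm (B.J (G.tgt e) ψ))))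
  γ_left : ∀ e b, ∃ ψ, B.χ (G.endpt e b) ψ = -ψ ∧ B.γ e b ψ ≠ 0
  γ_right : ∀ e b, ∃ ψ, B.χ (G.endpt e b) ψ = ψ ∧ B.γ e b ψ ≠ 0
  metric : B.IsMetric
  spinPreserving : B.IsSpinPreserving
  preservesOrientation : B.PreservesOrientation

/-! ### Holonomy and parallel vector fields -/

/-- Parallel transport `h_P : S_x → S_y` along a path. -/
def transport (B : DiscreteSpinorBundle G n X S) {x : V} : {y : V} → G.Walk x y → S x ≃ₗ[ℂ] S y
  | _, .nil => LinearEquiv.refl ℂ _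
  | _, .fwd e p => (B.transport p).trans (B.h e)
  | _, .bwd e p => (B.transport p).trans (B.h e).symm

/-- `H_P(a) = h_P a h_P⁻¹`, on operators on spinors. -/
def adTransport (B : DiscreteSpinorBundle G n X S) {x y : V} (p : G.Walk x y) :
    Module.End ℂ (S x) ≃ₐ[ℂ] Module.End ℂ (S y) :=
  (B.transport p).conjAlgEquiv ℂ

theorem transport_append (B : DiscreteSpinorBundle G n X S) {x y z : V} (p : G.Walk x y)
    (q : G.Walk y z) : B.transport (p.append q) = (B.transport p).trans (B.transport q) := by
  induction q with
  | nil => rfl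
  | fwd e q ih => simp only [WeightedOrientedGraph.Walk.append, transport, ih]; rfl
  | bwd e q ih => simp only [WeightedOrientedGraph.Walk.append, transport, ih]; rfl

theorem transport_reverse (B : DiscreteSpinorBundle G n X S) {x y : V} (p : G.Walk x y) :
    B.transport p.reverse = (B.transport p).symm := by
  induction p with
  | nil => rfl
  | fwd e p ih => simp only [WeightedOrientedGraph.Walk.reverse, transport_append, ih]; rfl
  | bwd e p ih => simp only [WeightedOrientedGraph.Walk.reverse, transport_append, ih]; rfl

/-- The holonomy group at `x`: all holonomy operators `Ad(h_P)` for closed paths `P` at `x`. -/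
def holonomyGroup (B : DiscreteSpinorBundle G n X S) (x : V) :
    Subgroup (Module.End ℂ (S x) ≃ₐ[ℂ] Module.End ℂ (S x)) where
  carrier := Set.range fun p : G.Walk x x => B.adTransport p
  one_mem' := ⟨.nil, by ext; rfl⟩
  mul_mem' := by
    rintro _ _ ⟨p, rfl⟩ ⟨q, rfl⟩
    exact ⟨q.append p, by simp only [adTransport, transport_append]; rfl⟩
  inv_mem' := by
    rintro _ ⟨p, rfl⟩
    exact ⟨p.reverse, by simp only [adTransport, transport_reverse]; rfl⟩

def IsTimelike (B : DiscreteSpinorBundle G n X S) {v : V} (x : X v) : Prop := 0 < B.Q v x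

/-- Future-directed timelike vectors: those `x` for which `(., x .)` is positive definite. -/
def IsFutureTimelike (B : DiscreteSpinorBundle G n X S) {v : V} (x : X v) : Prop :=
  B.IsTimelike x ∧ IsPosDefWith (B.krein v) (B.cliff v x)

/-- Parallel (covariantly constant) vector fields. -/
def IsParallel (B : DiscreteSpinorBundle G n X S) (u : ∀ v, X v) : Prop :=
  ∀ (v w : V) (p : G.Walk v w), B.cliff w (u w) = B.adTransport p (B.cliff v (u v))

/-- The vector `x` is fixed by the holonomy group at `v`. -/
def IsHolonomyFixed (B : DiscreteSpinorBundle G n X S) {v : V} (x : X v) : Prop :=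
  ∀ g ∈ B.holonomyGroup v, g (B.cliff v x) = B.cliff v x

end DiscreteSpinorBundle

end

/-! The split product pairs the value of F at a half-edge p = (e,±) with the value of F' carried
over from the other end. Call this carrying over `swap`; it is an involution. Every one-form is then
an operator `offDiag T`, F ↦ T_p (swap F)_p, with each T_p an odd operator on the spinor fibre over
p. Conversely, every odd family is a one-form. Even elements are represented onto the commutant of
χ, so a γ that is nonzero on both chiralities generates all odd operators under two-sided
multiplication. In a simple graph, two sections supported at adjacent vertices single out one
half-edge (`offDiag_mem_oneForms`).

Positive time-orientation forms are therefore the families of odd, Krein self-adjoint T_p with (·,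
T_p ·) positive definite and T_e⁺ J = -J h T_e⁻ h⁻¹ (`exists_orientation_of_family`,
`exists_family_of_orientation`). The β-adjoint of π(a) is β swap π(a^×) swap β⁻¹, so stability of
π(A⁰) means that T_p a(v) T_p⁻¹ depends on the vertex v under p but not on p itself
(`splitRep_mul_offDiag_iff`).

For n = 2 even operators commute, so the last condition is empty: two invertible odd operators at v
differ by an even factor. Unit future vectors at the sources, transported to the targets, give a
suitable family.

For n > 2 a parallel future-directed field u gives the family T_p = u. Conversely, a vector is
extracted from T. With P_σ the chiral projections, y ↦ Re Tr(P_σ T y) is positive on future timelike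
vectors and, since n > 2, on future null vectors, so its metric dual is future timelike
(`dualVec_future`). If T and T' induce the same conjugation on even operators, T⁻¹T' is a positive
scalar on each chirality. The functionals then change only by positive factors, and the sum of the
two normalized duals, `timeVec`, is unchanged (`timeVec_eq`). It is also compatible with J, which
keeps or exchanges the chiralities (`timeVec_of_J`), and with Clifford transport
(`timeVec_transport`). So `timeVec` of T_p is a field on vertices, and it is parallel.

The holonomy version is the usual one: a fixed timelike vector, future-directed up to sign
(`future_or_past`), spreads along paths independently of their choice. -/

noncomputable section

/-! ## Products of anticommuting elements -/

section AnticommutingFamilies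

variable {R : Type*} [Ring R] [Algebra ℂ R] {ι : Type*}

/-- The product of the `e i` with `i ∈ I`, in the order of the list `l`. -/
def orderedMonomial [DecidableEq ι] (e : ι → R) (l : List ι) (I : Finset ι) : R :=
  (l.map fun i => if i ∈ I then e i else 1).prod

/-- A family of pairwise anticommuting elements squaring to nonzero scalars. -/
structure IsAnticommutingFamily (e : ι → R) (s : ι → ℂ) : Prop where
  anticomm : ∀ i j, i ≠ j → e i * e j = -(e j * e i)
  sq : ∀ i, e i * e i = s i • (1 : R)
  ne_zero : ∀ i, s i ≠ 0

variable {e : ι → R} {s : ι → ℂ}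

/-- Each factor other than `e i` contributes one sign; a factor `e i` contributes none. -/
theorem mul_orderedMonomial_comm [DecidableEq ι] (he : IsAnticommutingFamily e s) (i : ι)
    (l : List ι)
    (I : Finset ι) :
    e i * orderedMonomial e l I =
      (-1 : ℂ) ^ (l.filter fun j => j ∈ I ∧ j ≠ i).length • (orderedMonomial e l I * e i) := by
  induction l with
  | nil => simp [orderedMonomial]
  | cons k l ih =>
    have hk : orderedMonomial e (k :: l) I =
        (if k ∈ I then e k else 1) * orderedMonomial e l I := by simp [orderedMonomial]
    rw [hk, ← mul_assoc]
    by_cases hkI : k ∈ I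
    · by_cases hki : k = i
      · subst hki
        conv_lhs => rw [if_pos hkI, mul_assoc, ih, mul_smul_comm, ← mul_assoc]
        simp [hkI]
      · simp only [hkI, if_true, he.anticomm i k (Ne.symm hki), neg_mul, mul_assoc, ih]
        simp [hkI, hki, pow_succ]
    · simp only [hkI, if_false, mul_one, ih, one_mul]
      simp [hkI]

theorem mul_orderedMonomial [DecidableEq ι] (he : IsAnticommutingFamily e s) (i : ι)
    (l : List ι) (hl : l.Nodup)
    (hi : i ∈ l) (I : Finset ι) :
    ∃ c : ℂ, e i * orderedMonomial e l I = c • orderedMonomial e l (symmDiff {i} I) := by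
  induction l with
  | nil => simp at hi
  | cons k l ih =>
    have hk : ∀ I, orderedMonomial e (k :: l) I =
        (if k ∈ I then e k else 1) * orderedMonomial e l I := by simp [orderedMonomial]
    obtain ⟨hkl, hl⟩ := List.nodup_cons.1 hl
    rw [hk, hk, ← mul_assoc]
    by_cases hki : k = i
    · subst hki
      have hrest : orderedMonomial e l (symmDiff {k} I) = orderedMonomial e l I := by
        unfold orderedMonomial
        congr 1
        refine List.map_congr_left fun j hj => ?_
        have : j ≠ k := fun h => hkl (h ▸ hj)
        simp [Finset.mem_symmDiff, this]
      rw [hrest]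
      by_cases hkI : k ∈ I
      · exact ⟨s k, by simp [hkI, Finset.mem_symmDiff, he.sq]⟩
      · exact ⟨1, by simp [hkI, Finset.mem_symmDiff]⟩
    · obtain ⟨c, hc⟩ := ih hl (by simpa [Ne.symm hki] using hi)
      by_cases hkI : k ∈ I
      · refine ⟨-c, ?_⟩
        simp [hkI, Finset.mem_symmDiff, hki, he.anticomm i k (Ne.symm hki), mul_assoc, hc]
      · exact ⟨c, by simp [hkI, Finset.mem_symmDiff, hki, hc]⟩

/-- The left factors are absorbed one at a time, each toggling the membership of its index because
squares are scalars. Two lists are needed since the induction shortens only the left one. -/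
theorem orderedMonomial_mul [DecidableEq ι] (he : IsAnticommutingFamily e s)
    (l l' : List ι) (hl : l.Nodup)
    (hl' : l'.Nodup) (hll' : ∀ i ∈ l, i ∈ l') (I J : Finset ι) :
    ∃ c : ℂ, orderedMonomial e l I * orderedMonomial e l' J =
      c • orderedMonomial e l' (symmDiff (I.filter (· ∈ l)) J) := by
  induction l with
  | nil => exact ⟨1, by simp [orderedMonomial, ← Finset.bot_eq_empty]⟩
  | cons k l ih =>
    have hk : orderedMonomial e (k :: l) I =
        (if k ∈ I then e k else 1) * orderedMonomial e l I := by simp [orderedMonomial]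
    obtain ⟨hkl, hl⟩ := List.nodup_cons.1 hl
    obtain ⟨c, hc⟩ := ih hl fun i hi => hll' i (by simp [hi])
    rw [hk, mul_assoc, hc]
    by_cases hkI : k ∈ I
    · obtain ⟨d, hd⟩ := mul_orderedMonomial he k l' hl' (hll' k (by simp))
        (symmDiff (I.filter (· ∈ l)) J)
      refine ⟨c * d, ?_⟩
      rw [if_pos hkI, mul_smul_comm, hd, smul_smul, ← symmDiff_assoc]
      congr 3
      ext j
      simp only [Finset.mem_symmDiff, Finset.mem_singleton, Finset.mem_filter, List.mem_cons]
      by_cases hj : j = k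
      · subst hj; simp [hkl, hkI]
      · simp [hj]
    · refine ⟨c, ?_⟩
      rw [if_neg hkI, one_mul]
      congr 3
      ext j
      simp only [Finset.mem_filter, List.mem_cons]
      by_cases hj : j = k
      · subst hj; simp [hkI]
      · simp [hj]

theorem isUnit_orderedMonomial [DecidableEq ι] (he : IsAnticommutingFamily e s)
    (l : List ι) (I : Finset ι) :
    IsUnit (orderedMonomial e l I) := by
  have hu : ∀ i, IsUnit (e i) := fun i => by
    have h1 : e i * ((s i)⁻¹ • e i) = 1 := by
      rw [mul_smul_comm, he.sq, smul_smul, inv_mul_cancel₀ (he.ne_zero i), one_smul]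
    have h2 : ((s i)⁻¹ • e i) * e i = 1 := by
      rw [smul_mul_assoc, he.sq, smul_smul, inv_mul_cancel₀ (he.ne_zero i), one_smul]
    exact ⟨⟨_, _, h1, h2⟩, rfl⟩
  induction l with
  | nil => simp [orderedMonomial]
  | cons k l ih =>
    have hk : orderedMonomial e (k :: l) I =
        (if k ∈ I then e k else 1) * orderedMonomial e l I := by simp [orderedMonomial]
    rw [hk]
    refine IsUnit.mul ?_ ih
    split_ifs
    exacts [hu k, isUnit_one]

/-- Reversal exchanges every pair of distinct factors exactly once. -/
theorem prod_reverse_eq (he : IsAnticommutingFamily e s) (l : List ι) (hl : l.Nodup) :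
    (l.reverse.map e).prod = (-1 : ℂ) ^ (l.length.choose 2) • (l.map e).prod := by
  have hcomm : ∀ (i : ι) (l : List ι), i ∉ l →
      (l.map e).prod * e i = (-1 : ℂ) ^ l.length • (e i * (l.map e).prod) := by
    intro i l hi
    induction l with
    | nil => simp
    | cons k l ih =>
      simp only [List.mem_cons, not_or] at hi
      simp only [List.map_cons, List.prod_cons, mul_assoc, ih hi.2]
      rw [← mul_assoc (e i), he.anticomm i k hi.1]
      simp [pow_succ, mul_assoc]
  induction l with
  | nil => simp
  | cons k l ih =>
    obtain ⟨hkl, hl⟩ := List.nodup_cons.1 hl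
    simp only [List.reverse_cons, List.map_append, List.prod_append, ih hl, List.map_cons,
      List.map_nil, List.prod_cons, List.prod_nil, mul_one, smul_mul_assoc, hcomm k l hkl,
      smul_smul, List.length_cons]
    rw [← pow_add, Nat.choose_succ_succ' l.length 1, Nat.choose_one_right, add_comm]

theorem prod_reverse_mul (he : IsAnticommutingFamily e s) (l : List ι) :
    (l.reverse.map e).prod * (l.map e).prod = (l.map s).prod • (1 : R) := by
  induction l with
  | nil => simp
  | cons k l ih =>
    simp only [List.reverse_cons, List.map_append, List.prod_append, List.map_cons,
      List.map_nil, List.prod_cons, List.prod_nil, mul_one, mul_assoc]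
    rw [← mul_assoc (e k), he.sq, smul_one_mul, mul_smul_comm, ih, smul_smul]

end AnticommutingFamilies

/-! ### Traces and independence of Clifford monomials. -/

section Trace

variable {S : Type*} [AddCommGroup S] [Module ℂ S]
  {n : ℕ} {e : Fin n → Module.End ℂ S} {s : Fin n → ℂ}

/-- An index i works as soon as I without i has odd cardinality. If |I| is even, any member of I
will do; if |I| is odd, evenness of n leaves an index outside I. -/
theorem exists_anticomm_orderedMonomial (he : IsAnticommutingFamily e s) (hn : Even n)
    {I : Finset (Fin n)} (hI : I.Nonempty) :
    ∃ i, e i * orderedMonomial e (List.finRange n) I =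
      -(orderedMonomial e (List.finRange n) I * e i) := by
  have hlen : ∀ i, ((List.finRange n).filter fun j => j ∈ I ∧ j ≠ i).length = (I.erase i).card := by
    intro i
    rw [← List.toFinset_card_of_nodup ((List.nodup_finRange n).filter _)]
    congr 1
    ext j
    simp [and_comm]
  suffices ∃ i, Odd (I.erase i).card by
    obtain ⟨i, hi⟩ := this
    exact ⟨i, by rw [mul_orderedMonomial_comm he, hlen, hi.neg_one_pow, neg_one_smul]⟩
  rcases Nat.even_or_odd I.card with h | h
  · obtain ⟨i, hi⟩ := hI
    refine ⟨i, ?_⟩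
    rw [Finset.card_erase_of_mem hi]
    exact Nat.Even.sub_odd (Finset.card_pos.2 ⟨i, hi⟩) h odd_one
  · obtain ⟨i, hi⟩ : ∃ i, i ∉ I := by
      by_contra! hall
      have : I = Finset.univ := Finset.eq_univ_of_forall hall
      rw [this, Finset.card_univ, Fintype.card_fin] at h
      exact (Nat.not_odd_iff_even.2 hn) h
    exact ⟨i, by rwa [Finset.erase_eq_of_notMem hi]⟩

theorem trace_eq_zero_of_anticomm {T U : Module.End ℂ S} {c : ℂ} (hc : c ≠ 0)
    (hU : U * U = c • (1 : Module.End ℂ S)) (h : U * T = -(T * U)) : LinearMap.trace ℂ S T = 0 := by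
  have h1 : LinearMap.trace ℂ S (U * T * U) = c * LinearMap.trace ℂ S T := by
    rw [mul_assoc, LinearMap.trace_mul_comm, mul_assoc, hU]; simp
  have h2 : LinearMap.trace ℂ S (U * T * U) = -(c * LinearMap.trace ℂ S T) := by
    rw [h, neg_mul, mul_assoc, hU]; simp
  have : c * LinearMap.trace ℂ S T = 0 := self_eq_neg.1 (h1.symm.trans h2)
  exact (mul_eq_zero.1 this).resolve_left hc

/-- In even rank the monomials in an anticommuting family of operators are independent. -/
theorem coeff_eq_zero_of_sum_orderedMonomial [FiniteDimensional ℂ S] [Nontrivial S]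
    (he : IsAnticommutingFamily e s)
    (hn : Even n) (a : Finset (Fin n) → ℂ)
    (ha : ∑ I, a I • orderedMonomial e (List.finRange n) I = 0) (J : Finset (Fin n)) :
    a J = 0 := by
  set m := orderedMonomial e (List.finRange n) with hm
  have htr : ∀ I : Finset (Fin n), I.Nonempty → LinearMap.trace ℂ S (m I) = 0 := fun I hI => by
    obtain ⟨i, hi⟩ := exists_anticomm_orderedMonomial he hn hI
    exact trace_eq_zero_of_anticomm (he.ne_zero i) (he.sq i) hi
  have hmul : ∀ I, ∃ c : ℂ, m J * m I = c • m (symmDiff J I) := fun I => by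
    obtain ⟨c, hc⟩ := orderedMonomial_mul he (List.finRange n) (List.finRange n)
      (List.nodup_finRange n) (List.nodup_finRange n) (fun _ h => h) J I
    exact ⟨c, by simpa using hc⟩
  choose c hc using hmul
  have hm0 : m ∅ = 1 := by simp [hm, orderedMonomial]
  have hcJ : c J ≠ 0 := by
    intro h0
    have h := hc J
    rw [h0, zero_smul] at h
    have hu := (isUnit_orderedMonomial he (List.finRange n) J)
    exact (hu.mul hu).ne_zero h
  -- Multiplication by `m J` moves the J-th term to the identity monomial, the only one with nonzero
  -- trace.
  have h := congrArg (fun T => LinearMap.trace ℂ S (m J * T)) ha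
  simp only [Finset.mul_sum, mul_smul_comm, hc, map_sum, map_smul, mul_zero, map_zero] at h
  rw [Finset.sum_eq_single J] at h
  · rw [symmDiff_self, Finset.bot_eq_empty, hm0, LinearMap.trace_one] at h
    simp only [smul_eq_mul, mul_eq_zero, hcJ, false_or, Nat.cast_eq_zero] at h
    exact h.resolve_right (Module.finrank_pos (R := ℂ) (M := S)).ne'
  · intro I _ hIJ
    rw [htr _ (by
      rw [Finset.nonempty_iff_ne_empty, ← Finset.bot_eq_empty]
      exact fun h => hIJ (symmDiff_eq_bot.1 h).symm)]
    simp
  · simp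

end Trace

/-! ## Hermitian forms on finite-dimensional spaces -/

section HermitianForms

variable {K : Type*} [AddCommGroup K] [Module ℂ K]

theorem IsKreinProduct.eq_of_forall {B : K →ₗ⋆[ℂ] K →ₗ[ℂ] ℂ} (hB : IsKreinProduct B) {φ φ' : K}
    (h : ∀ ψ, B ψ φ = B ψ φ') : φ = φ' :=
  sub_eq_zero.1 (hB.nondegenerate _ fun ψ => by rw [map_sub, h, sub_self])

/-- Every sesquilinear form is represented by an operator with respect to a Krein product. -/
theorem IsKreinProduct.exists_operator [FiniteDimensional ℂ K] {B : K →ₗ⋆[ℂ] K →ₗ[ℂ] ℂ}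
    (hB : IsKreinProduct B) (C : K →ₗ⋆[ℂ] K →ₗ[ℂ] ℂ) :
    ∃ T : Module.End ℂ K, ∀ ψ φ, C ψ φ = B ψ (T φ) := by
  -- The map φ ↦ B φ is antilinear, so it is read over ℝ, where injectivity and equality of
  -- dimensions give surjectivity.
  let f : K →ₗ[ℝ] Module.Dual ℂ K :=
    { toFun := fun φ => B φ
      map_add' := fun φ φ' => map_add B φ φ'
      map_smul' := fun r φ => by
        have : (r • φ : K) = (r : ℂ) • φ := rfl
        rw [this, LinearMap.map_smulₛₗ, Complex.conj_ofReal]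
        rfl }
  have hf : Function.Injective f := by
    rw [injective_iff_map_eq_zero]
    intro φ hφ
    refine hB.nondegenerate φ fun ψ => ?_
    rw [hB.hermitian φ ψ]
    have : B φ ψ = 0 := LinearMap.congr_fun hφ ψ
    rw [this, map_zero]
  have hdim : Module.finrank ℝ K = Module.finrank ℝ (Module.Dual ℂ K) := by
    rw [finrank_real_of_complex, finrank_real_of_complex, Subspace.dual_finrank_eq]
  have : FiniteDimensional ℝ K := FiniteDimensional.complexToReal K
  have : FiniteDimensional ℝ (Module.Dual ℂ K) := FiniteDimensional.complexToReal _
  have hsurj := (LinearMap.injective_iff_surjective_of_finrank_eq_finrank hdim).1 hf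
  have hex : ∀ φ, ∃ φ', ∀ ψ, C ψ φ = B ψ φ' := fun φ => by
    let g : Module.Dual ℂ K :=
      { toFun := fun ψ => conj (C ψ φ)
        map_add' := fun ψ ψ' => by simp
        map_smul' := fun c ψ => by simp }
    obtain ⟨φ', hφ'⟩ := hsurj g
    refine ⟨φ', fun ψ => ?_⟩
    have : B φ' ψ = conj (C ψ φ) := LinearMap.congr_fun hφ' ψ
    rw [hB.hermitian φ' ψ, this, Complex.conj_conj]
  choose T hT using hex
  refine ⟨{ toFun := T, map_add' := fun φ φ' => ?_, map_smul' := fun c φ => ?_ }, fun ψ φ => hT φ ψ⟩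
  · exact hB.eq_of_forall fun ψ => by rw [← hT, map_add, map_add, hT, hT]
  · exact hB.eq_of_forall fun ψ => by
      rw [← hT, map_smul, RingHom.id_apply, map_smul, hT]

theorem IsKreinProduct.exists_adjoint [FiniteDimensional ℂ K] {B : K →ₗ⋆[ℂ] K →ₗ[ℂ] ℂ}
    (hB : IsKreinProduct B) (T : Module.End ℂ K) :
    ∃ T', IsAdjointFor (fun ψ φ => B ψ φ) T T' :=
  hB.exists_operator (B.comp T)

theorem IsAdjointFor.symm {B : K →ₗ⋆[ℂ] K →ₗ[ℂ] ℂ} (hB : IsKreinProduct B) {T T' : Module.End ℂ K}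
    (h : IsAdjointFor (fun ψ φ => B ψ φ) T T') : IsAdjointFor (fun ψ φ => B ψ φ) T' T :=
  fun ψ φ => by
    change B (T' ψ) φ = B ψ (T φ)
    rw [hB.hermitian φ, hB.hermitian (T φ)]
    exact congrArg conj (h φ ψ).symm

theorem IsAdjointFor.mul {B : K → K → ℂ} {T T' U U' : Module.End ℂ K}
    (hT : IsAdjointFor B T T') (hU : IsAdjointFor B U U') :
    IsAdjointFor B (T * U) (U' * T') :=
  fun ψ φ => (hT (U ψ) φ).trans (hU ψ (T' φ))

theorem IsAdjointFor.unique {B : K →ₗ⋆[ℂ] K →ₗ[ℂ] ℂ} (hB : IsKreinProduct B)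
    {T T' T₂ : Module.End ℂ K} (h : IsAdjointFor (fun ψ φ => B ψ φ) T T')
    (h' : IsAdjointFor (fun ψ φ => B ψ φ) T T₂) : T' = T₂ :=
  LinearMap.ext fun φ => hB.eq_of_forall fun ψ => (h ψ φ).symm.trans (h' ψ φ)

theorem IsPosDefWith.injective {B : K →ₗ⋆[ℂ] K →ₗ[ℂ] ℂ} {T : Module.End ℂ K}
    (hT : IsPosDefWith B T) : Function.Injective T := by
  rw [injective_iff_map_eq_zero]
  intro ψ hψ
  by_contra h
  have := (hT ψ h).1
  simp [hψ] at this

theorem IsPosDefWith.isUnit [FiniteDimensional ℂ K] {B : K →ₗ⋆[ℂ] K →ₗ[ℂ] ℂ} {T : Module.End ℂ K}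
    (hT : IsPosDefWith B T) : IsUnit T :=
  (LinearMap.isUnit_iff_ker_eq_bot T).2 (LinearMap.ker_eq_bot.2 hT.injective)

theorem IsPosDefWith.add {B : K →ₗ⋆[ℂ] K →ₗ[ℂ] ℂ} {T U : Module.End ℂ K}
    (hT : IsPosDefWith B T) (hU : IsPosDefWith B U) : IsPosDefWith B (T + U) := fun ψ hψ => by
  obtain ⟨h1, h2⟩ := hT ψ hψ
  obtain ⟨h3, h4⟩ := hU ψ hψ
  simp only [LinearMap.add_apply, map_add, Complex.add_re, Complex.add_im]
  exact ⟨by linarith, by linarith⟩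

theorem IsPosDefWith.smul {B : K →ₗ⋆[ℂ] K →ₗ[ℂ] ℂ} {T : Module.End ℂ K}
    (hT : IsPosDefWith B T) {r : ℝ} (hr : 0 < r) : IsPosDefWith B ((r : ℂ) • T) := fun ψ hψ => by
  obtain ⟨h1, h2⟩ := hT ψ hψ
  simp only [LinearMap.smul_apply, map_smul, smul_eq_mul, Complex.re_ofReal_mul,
    Complex.im_ofReal_mul, h2, mul_zero, and_true]
  positivity

/-- A positive definite form has an orthonormal basis. -/
theorem exists_orthonormal_basis [FiniteDimensional ℂ K] {B : K →ₗ⋆[ℂ] K →ₗ[ℂ] ℂ}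
    (hB : ∀ ψ φ, B φ ψ = conj (B ψ φ)) (hpos : IsPosDefWith B 1) :
    ∃ b : Module.Basis (Fin (Module.finrank ℂ K)) ℂ K, ∀ i φ, b.repr φ i = B (b i) φ := by
  let core : InnerProductSpace.Core ℂ K :=
    { inner := fun ψ φ => B ψ φ
      conj_inner_symm := fun ψ φ => (hB φ ψ).symm
      re_inner_nonneg := fun ψ => by
        by_cases h : ψ = 0
        · simp [h]
        · exact (hpos ψ h).1.le
      add_left := fun ψ φ χ => by simp
      smul_left := fun ψ φ c => by simp
      definite := fun ψ h => by
        by_contra h0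
        have := (hpos ψ h0).1
        change B ψ ψ = 0 at h
        simp [h] at this }
  let i1 : NormedAddCommGroup K := core.toNormedAddCommGroup
  let i2 : InnerProductSpace ℂ K := InnerProductSpace.ofCore core.toCore
  exact ⟨(stdOrthonormalBasis ℂ K).toBasis, fun i φ => by
    rw [OrthonormalBasis.coe_toBasis_repr_apply, OrthonormalBasis.repr_apply_apply,
      OrthonormalBasis.coe_toBasis]; rfl⟩

/-- The trace of `T W^× U W` is positive if `T` and `U` are positive definite and `W ≠ 0`. -/
theorem trace_pos_of_posDef [FiniteDimensional ℂ K] {B : K →ₗ⋆[ℂ] K →ₗ[ℂ] ℂ}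
    (hB : IsKreinProduct B) {T U W W' : Module.End ℂ K} (hT : IsPosDefWith B T)
    (hTT : IsAdjointFor (fun ψ φ => B ψ φ) T T) (hU : IsPosDefWith B U)
    (hW : IsAdjointFor (fun ψ φ => B ψ φ) W W') (hW0 : W ≠ 0) :
    0 < (LinearMap.trace ℂ K (T * (W' * (U * W)))).re ∧
      (LinearMap.trace ℂ K (T * (W' * (U * W)))).im = 0 := by
  have hTT' : ∀ ψ φ, B (T ψ) φ = B ψ (T φ) := hTT
  have hW' : ∀ ψ φ, B (W ψ) φ = B ψ (W' φ) := hW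
  -- In an orthonormal basis for (T·,·) the trace becomes the sum of (φ_i, U φ_i) with φ_i = W T
  -- b_i.
  obtain ⟨b, hb⟩ := exists_orthonormal_basis (B := B.comp T)
    (fun ψ φ => by
      change B (T φ) ψ = conj (B (T ψ) φ)
      rw [hTT', hB.hermitian])
    (fun ψ hψ => by simpa [hTT'] using hT ψ hψ)
  have htr : LinearMap.trace ℂ K (T * (W' * (U * W))) =
      ∑ i, B (W (T (b i))) (U (W (T (b i)))) := by
    rw [LinearMap.trace_mul_comm, LinearMap.trace_eq_matrix_trace ℂ b, Matrix.trace]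
    refine Finset.sum_congr rfl fun i _ => ?_
    rw [Matrix.diag_apply, LinearMap.toMatrix_apply, hb, hW']
    rfl
  have hnn : ∀ φ, 0 ≤ (B φ (U φ)).re ∧ (B φ (U φ)).im = 0 := fun φ => by
    by_cases h : φ = 0
    · simp [h]
    · exact ⟨(hU φ h).1.le, (hU φ h).2⟩
  rw [htr, Complex.re_sum, Complex.im_sum]
  refine ⟨?_, Finset.sum_eq_zero fun i _ => (hnn _).2⟩
  by_contra hle
  have h0 : ∀ i, W (T (b i)) = 0 := fun i => by
    by_contra hne
    refine hle (Finset.sum_pos' (fun i _ => (hnn _).1) ⟨i, Finset.mem_univ i, (hU _ hne).1⟩)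
  have hWT : W * T = 0 := b.ext h0
  have : W = 0 := hT.isUnit.mul_left_eq_zero.1 hWT
  exact hW0 this

theorem exists_posDef_form [FiniteDimensional ℂ K] :
    ∃ p : K →ₗ⋆[ℂ] K →ₗ[ℂ] ℂ, (∀ ψ φ, p φ ψ = conj (p ψ φ)) ∧ IsPosDefWith p 1 := by
  let b := Module.finBasis ℂ K
  refine ⟨LinearMap.mk₂'ₛₗ (starRingEnd ℂ) (RingHom.id ℂ)
    (fun ψ φ => ∑ i, conj (b.repr ψ i) * b.repr φ i) ?_ ?_ ?_ ?_, ?_, ?_⟩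
  · intro ψ ψ' φ; simp [add_mul, Finset.sum_add_distrib]
  · intro c ψ φ; simp [Finset.mul_sum, mul_assoc]
  · intro ψ φ φ'; simp [mul_add, Finset.sum_add_distrib]
  · intro c ψ φ; simp [Finset.mul_sum, mul_left_comm]
  · intro ψ φ; simp [mul_comm]
  · intro ψ hψ
    have hsq : ∀ i, conj (b.repr ψ i) * b.repr ψ i = ((Complex.normSq (b.repr ψ i) : ℝ) : ℂ) :=
      fun i => (Complex.normSq_eq_conj_mul_self).symm
    simp only [LinearMap.mk₂'ₛₗ_apply, Module.End.one_apply, hsq, ← Complex.ofReal_sum,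
      Complex.ofReal_re, Complex.ofReal_im, and_true]
    obtain ⟨i, hi⟩ : ∃ i, b.repr ψ i ≠ 0 := by
      by_contra! h
      exact hψ (b.repr.map_eq_zero_iff.1 (Finsupp.ext h))
    exact Finset.sum_pos' (fun i _ => Complex.normSq_nonneg _)
      ⟨i, Finset.mem_univ i, Complex.normSq_pos.2 hi⟩

/-- A finite family of involutions that commute up to sign preserves a positive definite form. -/
theorem exists_invariant_posDef_form [FiniteDimensional ℂ K] (l : List (Module.End ℂ K))
    (hsq : ∀ f ∈ l, f * f = 1) (hcomm : ∀ f ∈ l, ∀ g ∈ l, f * g = g * f ∨ f * g = -(g * f)) :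
    ∃ p : K →ₗ⋆[ℂ] K →ₗ[ℂ] ℂ, (∀ ψ φ, p φ ψ = conj (p ψ φ)) ∧ IsPosDefWith p 1 ∧
      ∀ f ∈ l, ∀ ψ φ, p (f ψ) (f φ) = p ψ φ := by
  induction l with
  | nil =>
    obtain ⟨p, h1, h2⟩ := exists_posDef_form (K := K)
    exact ⟨p, h1, h2, by simp⟩
  | cons f l ih =>
    obtain ⟨p, h1, h2, h3⟩ := ih (fun g hg => hsq g (by simp [hg]))
      (fun g hg g' hg' => hcomm g (by simp [hg]) g' (by simp [hg']))
    have hff : ∀ ψ, f (f ψ) = ψ := fun ψ => LinearMap.congr_fun (hsq f (by simp)) ψ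
    -- Average the form over the group {1, f}.
    refine ⟨p + (p.comp f).compl₂ f, ?_, ?_, ?_⟩
    · intro ψ φ
      simp [h1 ψ φ, h1 (f ψ) (f φ)]
    · intro ψ hψ
      have hfψ : f ψ ≠ 0 := fun h => hψ (by rw [← hff ψ, h, map_zero])
      have a1 := h2 ψ hψ
      have a2 := h2 (f ψ) hfψ
      simp only [Module.End.one_apply] at a1 a2
      simp only [LinearMap.add_apply, LinearMap.compl₂_apply, LinearMap.comp_apply,
        Module.End.one_apply, Complex.add_re, Complex.add_im, a1.2, a2.2, add_zero, and_true]
      exact add_pos a1.1 a2.1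
    · intro g hg ψ φ
      simp only [LinearMap.add_apply, LinearMap.compl₂_apply, LinearMap.comp_apply]
      rcases List.mem_cons.1 hg with rfl | hgl
      · rw [hff, hff, add_comm]
      · rw [h3 g hgl]
        -- An anticommutation sign appears in both arguments and cancels.
        have hc : p (f (g ψ)) (f (g φ)) = p (g (f ψ)) (g (f φ)) := by
          rcases hcomm f (by simp) g hg with h | h
          · have h' : ∀ ψ, f (g ψ) = g (f ψ) := fun ψ => LinearMap.congr_fun h ψ
            rw [h', h']
          · have h' : ∀ ψ, f (g ψ) = -g (f ψ) := fun ψ => LinearMap.congr_fun h ψ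
            rw [h', h']; simp
        rw [hc, h3 g hgl]

/-- The trace of an operator intertwined with another by an antilinear bijection. -/
theorem trace_eq_conj_of_antilinear [FiniteDimensional ℂ K] (J : K →ₗ⋆[ℂ] K)
    (hJ : Function.Bijective J) {A C : Module.End ℂ K} (h : ∀ ψ, A (J ψ) = J (C ψ)) :
    LinearMap.trace ℂ K A = conj (LinearMap.trace ℂ K C) := by
  let Je := LinearEquiv.ofBijective J hJ
  have hJe : ∀ φ, J (Je.symm φ) = φ := fun φ => Je.apply_symm_apply φ
  let b := Module.finBasis ℂ K
  -- The conjugated coordinates of J⁻¹φ are linear in φ. They are the coordinates in the basis J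
  -- b_i, where the matrix of A is the conjugate of that of C in b.
  let f : K ≃ₗ[ℂ] (Fin (Module.finrank ℂ K) → ℂ) :=
    { toFun := fun φ i => conj (b.repr (Je.symm φ) i)
      map_add' := fun φ φ' => by ext i; simp
      map_smul' := fun c φ => by ext i; rw [LinearEquiv.map_smulₛₗ]; simp
      invFun := fun x => J (b.equivFun.symm fun i => conj (x i))
      left_inv := fun φ => by
        have : (b.equivFun.symm fun i => conj (conj (b.repr (Je.symm φ) i))) = Je.symm φ := by
          simp only [Complex.conj_conj]
          exact b.equivFun.symm_apply_apply (Je.symm φ)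
        exact (congrArg J this).trans (hJe φ)
      right_inv := fun x => by
        ext i
        have : Je.symm (J (b.equivFun.symm fun i => conj (x i))) =
          b.equivFun.symm fun i => conj (x i) := Je.symm_apply_apply _
        change conj (b.repr (Je.symm (J (b.equivFun.symm fun i => conj (x i)))) i) = x i
        rw [this, ← Module.Basis.equivFun_apply, LinearEquiv.apply_symm_apply, Complex.conj_conj] }
  let b' := Module.Basis.ofEquivFun f
  have hb' : ∀ i, b' i = J (b i) := fun i => by
    rw [Module.Basis.coe_ofEquivFun]
    change J (b.equivFun.symm fun j => conj ((Pi.single i (1 : ℂ) : Fin _ → ℂ) j)) = _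
    congr 1
    rw [LinearEquiv.symm_apply_eq]
    ext j
    simp [Pi.single_apply, eq_comm, apply_ite]
  rw [LinearMap.trace_eq_matrix_trace ℂ b', LinearMap.trace_eq_matrix_trace ℂ b, Matrix.trace,
    Matrix.trace, map_sum]
  refine Finset.sum_congr rfl fun i _ => ?_
  rw [Matrix.diag_apply, Matrix.diag_apply, LinearMap.toMatrix_apply, LinearMap.toMatrix_apply,
    hb', h]
  have : Je.symm (J (C (b i))) = C (b i) := Je.symm_apply_apply _
  change conj (b.repr (Je.symm (J (C (b i)))) i) = _
  rw [this]

end HermitianForms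

/-! ## Complexified Clifford algebras and their irreducible representations -/

namespace CCl

variable {X : Type*} [AddCommGroup X] [Module ℝ X] {Q : QuadraticForm ℝ X}

theorem vec_add (x y : X) : vec Q (x + y) = vec Q x + vec Q y := by
  simp [vec, TensorProduct.tmul_add]

theorem vec_smul (r : ℝ) (x : X) : vec Q (r • x) = (r : ℂ) • vec Q x := by
  rw [vec, map_smul, TensorProduct.tmul_smul]
  exact (Complex.coe_smul r (vec Q x)).symm

theorem vec_mul_self (x : X) : vec Q x * vec Q x = (Q x : ℂ) • (1 : CCl Q) := by
  rw [vec, Algebra.TensorProduct.tmul_mul_tmul, one_mul, CliffordAlgebra.ι_sq_scalar,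
    Algebra.algebraMap_eq_smul_one, TensorProduct.tmul_smul]
  exact (Complex.coe_smul (Q x) (1 : CCl Q)).symm

theorem vec_mul_add_swap (x y : X) :
    vec Q x * vec Q y + vec Q y * vec Q x = ((QuadraticMap.polar Q x y : ℝ) : ℂ) • (1 : CCl Q) := by
  rw [vec, vec, Algebra.TensorProduct.tmul_mul_tmul, Algebra.TensorProduct.tmul_mul_tmul, one_mul,
    ← TensorProduct.tmul_add, CliffordAlgebra.ι_mul_ι_add_swap,
    Algebra.algebraMap_eq_smul_one, TensorProduct.tmul_smul]
  exact (Complex.coe_smul _ (1 : CCl Q)).symm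

theorem vec_mem_odd (x : X) : vec Q x ∈ odd Q :=
  Submodule.tmul_mem_baseChange_of_mem 1 (CliffordAlgebra.ι_mem_evenOdd_one Q x)

theorem c_vec (x : X) : c Q (vec Q x) = vec Q x := by
  simp [c, vec]

theorem vec_mul_vec_mem_even (x y : X) : vec Q x * vec Q y ∈ even Q := by
  rw [vec, vec, Algebra.TensorProduct.tmul_mul_tmul]
  exact Subalgebra.tmul_mem_baseChange (CliffordAlgebra.ι_mul_ι_mem_evenOdd_zero Q x y) _

theorem induction {P : CCl Q → Prop} (one : P 1) (smul : ∀ (z : ℂ) a, P a → P (z • a))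
    (add : ∀ a a', P a → P a' → P (a + a')) (mul : ∀ x a, P a → P (vec Q x * a)) (a : CCl Q) :
    P a := by
  induction a using TensorProduct.induction_on with
  | zero => simpa using smul 0 1 one
  | add a a' h h' => exact add a a' h h'
  | tmul z w =>
    have hz : z ⊗ₜ[ℝ] w = z • ((1 : ℂ) ⊗ₜ[ℝ] w) := by rw [TensorProduct.smul_tmul']; simp
    rw [hz]
    refine smul z _ ?_
    induction w using CliffordAlgebra.left_induction with
    | algebraMap r =>
      rw [Algebra.algebraMap_eq_smul_one, TensorProduct.tmul_smul]
      exact Complex.coe_smul r ((1 : ℂ) ⊗ₜ[ℝ] (1 : CliffordAlgebra Q)) ▸ smul r _ one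
    | add x y hx hy =>
      rw [TensorProduct.tmul_add]
      exact add _ _ (hx (by rw [TensorProduct.smul_tmul']; simp))
        (hy (by rw [TensorProduct.smul_tmul']; simp))
    | ι_mul x m hx =>
      have := mul m _ (hx (by rw [TensorProduct.smul_tmul']; simp))
      rwa [vec, Algebra.TensorProduct.tmul_mul_tmul, one_mul] at this

theorem even_induction {P : CCl Q → Prop} (one : P 1) (smul : ∀ (z : ℂ) a, P a → P (z • a))
    (add : ∀ a a', P a → P a' → P (a + a'))
    (mul : ∀ x y a, P a → P (vec Q x * vec Q y * a)) {a : CCl Q} (ha : a ∈ even Q) : P a := by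
  obtain ⟨t, rfl⟩ := ha
  induction t using TensorProduct.induction_on with
  | zero => simpa using smul 0 1 one
  | add a a' h h' => rw [map_add]; exact add _ _ h h'
  | tmul z w =>
    obtain ⟨w, hw⟩ := w
    change P (z ⊗ₜ[ℝ] w)
    have hz : ∀ w : CliffordAlgebra Q, z ⊗ₜ[ℝ] w = z • ((1 : ℂ) ⊗ₜ[ℝ] w) := fun w => by
      rw [TensorProduct.smul_tmul']; simp
    rw [hz]
    refine smul z _ ?_
    induction w, hw using CliffordAlgebra.even_induction with
    | algebraMap r =>
      rw [Algebra.algebraMap_eq_smul_one, TensorProduct.tmul_smul]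
      exact Complex.coe_smul r ((1 : ℂ) ⊗ₜ[ℝ] (1 : CliffordAlgebra Q)) ▸ smul r _ one
    | add x y _ _ hx hy =>
      rw [TensorProduct.tmul_add]
      exact add _ _ hx hy
    | ι_mul_ι_mul x y w _ hw =>
      have := mul x y _ hw
      rwa [vec, vec, Algebra.TensorProduct.tmul_mul_tmul, Algebra.TensorProduct.tmul_mul_tmul,
        one_mul, one_mul] at this

end CCl

/-! ### Schur's lemma and Burnside's theorem. -/

section IrreducibleRepresentations

variable {A S : Type*} [Ring A] [Algebra ℂ A] [AddCommGroup S] [Module ℂ S]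
  [FiniteDimensional ℂ S] [Nontrivial S] (ρ : A →ₐ[ℂ] Module.End ℂ S)

/-- Schur lemma for an irreducible representation given by an algebra morphism. -/
theorem exists_eq_smul_one_of_irreducible
    (hirr : ∀ W : Submodule ℂ S, (∀ a, ∀ ψ ∈ W, ρ a ψ ∈ W) → W = ⊥ ∨ W = ⊤)
    (T : Module.End ℂ S) (hT : ∀ a, T * ρ a = ρ a * T) :
    ∃ c : ℂ, T = c • (1 : Module.End ℂ S) := by
  obtain ⟨c, hc⟩ := Module.End.exists_eigenvalue T
  refine ⟨c, LinearMap.ext fun ψ => ?_⟩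
  have htop : Module.End.eigenspace T c = ⊤ := by
    refine (hirr (Module.End.eigenspace T c) fun a ψ hψ => ?_).resolve_left hc
    rw [Module.End.mem_eigenspace_iff] at hψ ⊢
    have : T (ρ a ψ) = ρ a (T ψ) := LinearMap.congr_fun (hT a) ψ
    rw [this, hψ, map_smul]
  have : ψ ∈ Module.End.eigenspace T c := htop ▸ Submodule.mem_top
  exact Module.End.mem_eigenspace_iff.1 this

/-- Burnside theorem: an irreducible complex representation is onto. -/
theorem surjective_of_irreducible
    (hirr : ∀ W : Submodule ℂ S, (∀ a, ∀ ψ ∈ W, ρ a ψ ∈ W) → W = ⊥ ∨ W = ⊤) :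
    Function.Surjective ρ := by
  let _ : Module A S := Module.compHom S ρ.toRingHom
  have hsmul : ∀ (a : A) (ψ : S), a • ψ = ρ a ψ := fun _ _ => rfl
  have hz : ∀ (z : ℂ) (ψ : S), z • ψ = algebraMap ℂ A z • ψ := fun z ψ => by
    rw [hsmul, AlgHom.commutes, Module.algebraMap_end_apply]
  have : IsSimpleModule A S :=
    { eq_bot_or_eq_top := fun W => by
        let W' : Submodule ℂ S :=
          { W.toAddSubmonoid with smul_mem' := fun z ψ h => hz z ψ ▸ W.smul_mem _ h }
        rcases hirr W' (fun a ψ h => W.smul_mem a h) with h | h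
        · left
          ext ψ
          exact (SetLike.ext_iff.1 h ψ : ψ ∈ W' ↔ _)
        · right
          ext ψ
          exact (SetLike.ext_iff.1 h ψ : ψ ∈ W' ↔ _) }
  intro T
  -- By Schur the A-endomorphisms of S are scalars, so T is linear over them and the density theorem
  -- applies to a finite generating set.
  let f : Module.End (Module.End A S) S :=
    { toFun := T
      map_add' := map_add T
      map_smul' := fun g ψ => by
        let g' : Module.End ℂ S :=
          { toFun := g, map_add' := map_add g, map_smul' := fun z ψ => by
              rw [hz, map_smul, ← hz]; rfl }
        obtain ⟨c, hc⟩ := exists_eq_smul_one_of_irreducible ρ hirr g' fun a =>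
          LinearMap.ext fun ψ => map_smul g a ψ
        have hg : ∀ ψ, g ψ = c • ψ := fun ψ => LinearMap.congr_fun hc ψ
        change T (g ψ) = g (T ψ)
        rw [hg, hg, map_smul] }
  obtain ⟨s, hs⟩ := Module.Finite.fg_top (R := ℂ) (M := S)
  obtain ⟨a, ha⟩ := jacobson_density (R := A) f s
  refine ⟨a, LinearMap.ext_on_range (v := fun x : s => (x : S)) (by simpa using hs) fun x => ?_⟩
  exact (ha x x.2).symm

end IrreducibleRepresentations

/-! ## The fibres of a discrete spinor bundle -/

namespace DiscreteSpinorBundle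

variable {V E : Type*} {G : WeightedOrientedGraph V E} {n : ℕ} {X S : V → Type*}
  [∀ v, AddCommGroup (X v)] [∀ v, Module ℝ (X v)]
  [∀ v, AddCommGroup (S v)] [∀ v, Module ℂ (S v)] [∀ v, FiniteDimensional ℂ (S v)]
  (B : DiscreteSpinorBundle G n X S) (v : V)

theorem cliff_add (x y : X v) : B.cliff v (x + y) = B.cliff v x + B.cliff v y := by
  simp [cliff, CCl.vec_add]

theorem cliff_smul (r : ℝ) (x : X v) : B.cliff v (r • x) = (r : ℂ) • B.cliff v x := by
  simp only [cliff, CCl.vec_smul, map_smul]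

theorem cliff_neg (x : X v) : B.cliff v (-x) = -B.cliff v x := by
  simpa using B.cliff_smul v (-1) x

theorem cliff_mul_self (x : X v) :
    B.cliff v x * B.cliff v x = (B.Q v x : ℂ) • (1 : Module.End ℂ (S v)) := by
  rw [cliff, ← map_mul, CCl.vec_mul_self, map_smul, map_one]

theorem cliff_mul_add_swap (x y : X v) :
    B.cliff v x * B.cliff v y + B.cliff v y * B.cliff v x =
      ((QuadraticMap.polar (B.Q v) x y : ℝ) : ℂ) • (1 : Module.End ℂ (S v)) := by
  rw [cliff, cliff, ← map_mul, ← map_mul, ← map_add, CCl.vec_mul_add_swap, map_smul, map_one]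

theorem cliff_anticomm {x y : X v} (h : QuadraticMap.polar (B.Q v) x y = 0) :
    B.cliff v x * B.cliff v y = -(B.cliff v y * B.cliff v x) := by
  have := B.cliff_mul_add_swap v x y
  rw [h, Complex.ofReal_zero, zero_smul] at this
  exact eq_neg_of_add_eq_zero_left this

theorem J_cliff (x : X v) (ψ : S v) : B.J v (B.cliff v x ψ) = -B.cliff v x (B.J v ψ) := by
  have := B.J_real v _ (CCl.vec_mem_odd x) ψ
  rw [CCl.c_vec] at this
  rw [cliff, this, neg_neg]

theorem isAnticommutingFamily {b : Module.Basis (Fin n) ℝ (X v)}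
    (hb : IsPseudoOrthonormal (B.Q v) b) :
    IsAnticommutingFamily (fun i => B.cliff v (b i)) (fun i => (B.Q v (b i) : ℂ)) where
  anticomm i j hij := B.cliff_anticomm v (hb.2 i j hij)
  sq i := B.cliff_mul_self v (b i)
  ne_zero i := by
    obtain ⟨⟨i₀, h1, h2⟩, -⟩ := hb
    by_cases h : i = i₀
    · simp [h, h1]
    · simp [h2 i h]

theorem exists_frame : ∃ b : Module.Basis (Fin n) ℝ (X v), IsPseudoOrthonormal (B.Q v) b ∧
    B.χ v = Complex.I ^ (n / 2 + 1) • ((List.finRange n).map fun i => B.cliff v (b i)).prod := by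
  obtain ⟨b, hb, h⟩ := B.χ_eq v
  refine ⟨b, hb, ?_⟩
  rw [h, map_smul, map_list_prod, List.ofFn_eq_map, List.map_map]
  rfl

theorem prod_cliff_eq_orderedMonomial (b : Fin n → X v) :
    ((List.finRange n).map fun i => B.cliff v (b i)).prod =
      orderedMonomial (fun i => B.cliff v (b i)) (List.finRange n) Finset.univ := by
  simp [orderedMonomial]

/-- A basis vector commutes with itself and anticommutes with the n - 1 other factors of χ, an odd
number. -/
theorem χ_cliff (hn : Even n) (x : X v) : B.χ v * B.cliff v x = -(B.cliff v x * B.χ v) := by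
  obtain ⟨b, hb, hχ⟩ := B.exists_frame v
  have he := B.isAnticommutingFamily v hb
  have hbasis : ∀ i, B.χ v * B.cliff v (b i) = -(B.cliff v (b i) * B.χ v) := fun i => by
    have hlen : ((List.finRange n).filter fun j => j ∈ (Finset.univ : Finset (Fin n)) ∧ j ≠ i).length
        = n - 1 := by
      rw [← List.toFinset_card_of_nodup ((List.nodup_finRange n).filter _)]
      have : ((List.finRange n).filter fun j => j ∈ (Finset.univ : Finset (Fin n)) ∧ j ≠ i).toFinset
          = Finset.univ.erase i := by ext j; simp
      rw [this, Finset.card_erase_of_mem (Finset.mem_univ i), Finset.card_univ, Fintype.card_fin]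
    have h := mul_orderedMonomial_comm he i (List.finRange n) Finset.univ
    have hodd : Odd (n - 1) := Nat.Even.sub_odd (Fin.pos i) hn odd_one
    rw [hlen, hodd.neg_one_pow, neg_one_smul] at h
    rw [hχ, prod_cliff_eq_orderedMonomial, mul_smul_comm, h, smul_mul_assoc, smul_neg, neg_neg]
  induction b.mem_span x using Submodule.span_induction with
  | mem _ h => obtain ⟨i, rfl⟩ := h; exact hbasis i
  | zero => have : B.cliff v 0 = 0 := by simpa using B.cliff_smul v 0 0
            simp [this]
  | add x y _ _ hx hy => rw [cliff_add, mul_add, hx, hy, add_mul, neg_add]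
  | smul r x _ hx => rw [cliff_smul, mul_smul_comm, hx, smul_mul_assoc, smul_neg]

theorem adjoint_prod {ι : Type*} (b : ι → X v) (l : List ι) :
    IsAdjointFor (fun ψ φ => B.krein v ψ φ) (l.map fun i => B.cliff v (b i)).prod
      (l.reverse.map fun i => B.cliff v (b i)).prod := by
  induction l with
  | nil => exact fun _ _ => rfl
  | cons i l ih =>
    simpa [cliff] using IsAdjointFor.mul (B.krein_compatible v (b i)) ih

theorem neg_one_pow_choose_two_of_even (hn : Even n) :
    (-1 : ℂ) ^ (n.choose 2) = (-1) ^ (n / 2) := by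
  obtain ⟨m, rfl⟩ := hn
  rcases Nat.eq_zero_or_pos m with rfl | hm
  · simp
  have h1 : (m + m).choose 2 = m * (2 * (m - 1) + 1) := by
    rw [Nat.choose_two_right, show m + m - 1 = 2 * (m - 1) + 1 by omega,
      show (m + m) * (2 * (m - 1) + 1) = 2 * (m * (2 * (m - 1) + 1)) by ring]
    omega
  rw [h1, pow_mul', pow_succ, pow_mul, neg_one_sq, one_pow, one_mul,
    show (m + m) / 2 = m by omega]

/-- Reversing the product gives (-1)^(n/2) and conjugating the factor I^(n/2+1) gives (-1)^(n/2+1).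
-/
theorem χ_adjoint (hn : Even n) :
    IsAdjointFor (fun ψ φ => B.krein v ψ φ) (B.χ v) (-B.χ v) := by
  obtain ⟨b, hb, hχ⟩ := B.exists_frame v
  have he := B.isAnticommutingFamily v hb
  intro ψ φ
  have h : B.krein v (((List.finRange n).map fun i => B.cliff v (b i)).prod ψ) φ = _ :=
    B.adjoint_prod v b (List.finRange n) ψ φ
  rw [prod_reverse_eq he _ (List.nodup_finRange n), List.length_finRange,
    neg_one_pow_choose_two_of_even hn] at h
  simp only [hχ, LinearMap.smul_apply, LinearMap.map_smulₛₗ, LinearMap.neg_apply, h, map_smul,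
    smul_eq_mul, map_neg, map_pow, Complex.conj_I]
  rw [neg_pow, pow_succ (-1 : ℂ), ← mul_assoc]
  have : ((-1 : ℂ) ^ (n / 2)) * (-1) ^ (n / 2) = 1 := by rw [← mul_pow]; simp
  linear_combination (-(Complex.I ^ (n / 2 + 1)) *
    B.krein v ψ (((List.finRange n).map fun i => B.cliff v (b i)).prod φ)) * this

/-- The reversed product times the product is (-1)^(n-1) = -1 by the signature. The reversal sign
(-1)^(n/2) and I^(n+2) = (-1)^(n/2+1) turn this into 1. -/
theorem χ_sq (hn : Even n) : B.χ v * B.χ v = 1 := by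
  obtain ⟨b, hb, hχ⟩ := B.exists_frame v
  have he := B.isAnticommutingFamily v hb
  have h := prod_reverse_mul he (List.finRange n)
  rw [prod_reverse_eq he _ (List.nodup_finRange n), List.length_finRange,
    neg_one_pow_choose_two_of_even hn, smul_mul_assoc] at h
  have hs : ((List.finRange n).map fun i => (B.Q v (b i) : ℂ)).prod = -1 := by
    obtain ⟨⟨i₀, h1, h2⟩, -⟩ := hb
    rw [← List.ofFn_eq_map, List.prod_ofFn, ← Finset.mul_prod_erase _ _ (Finset.mem_univ i₀), h1,
      Finset.prod_congr rfl (g := fun _ => (-1 : ℂ))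
        (fun i hi => by rw [h2 i (Finset.ne_of_mem_erase hi)]; simp)]
    rw [Finset.prod_const, Finset.card_erase_of_mem (Finset.mem_univ i₀), Finset.card_univ,
      Fintype.card_fin, (Nat.Even.sub_odd (Fin.pos i₀) hn odd_one).neg_one_pow]
    simp
  rw [hs] at h
  have hsq : ((-1 : ℂ) ^ (n / 2)) * (-1) ^ (n / 2) = 1 := by rw [← mul_pow]; simp
  have h' := congrArg (fun T => ((-1 : ℂ) ^ (n / 2)) • T) h
  simp only [smul_smul, hsq, one_smul] at h'
  rw [hχ, smul_mul_smul_comm, h', smul_smul, ← mul_pow, Complex.I_mul_I, pow_succ]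
  have : (-1 : ℂ) ^ (n / 2) * -1 * ((-1) ^ (n / 2) * -1) = 1 := by linear_combination hsq
  rw [this, one_smul]

/-- The n anticommutations of J with vectors cancel; the sign comes from antilinearity on I^(n/2+1).
-/
theorem J_χ (hn : Even n) (ψ : S v) :
    B.J v (B.χ v ψ) = (-1 : ℂ) ^ (n / 2 + 1) • B.χ v (B.J v ψ) := by
  obtain ⟨b, hb, hχ⟩ := B.exists_frame v
  have hl : ∀ l : List (Fin n), B.J v ((l.map fun i => B.cliff v (b i)).prod ψ) =
      (-1 : ℂ) ^ l.length • (l.map fun i => B.cliff v (b i)).prod (B.J v ψ) := by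
    intro l
    induction l with
    | nil => simp
    | cons i l ih =>
      simp only [List.map_cons, List.prod_cons, Module.End.mul_apply, J_cliff, ih, map_smul,
        List.length_cons, pow_succ]
      simp
  rw [hχ, LinearMap.smul_apply, LinearMap.map_smulₛₗ, hl, List.length_finRange, hn.neg_one_pow,
    one_smul, LinearMap.smul_apply, smul_smul, map_pow, Complex.conj_I, neg_pow]

/-- An operator commuting with all vectors is scalar. -/
theorem exists_eq_smul_one (T : Module.End ℂ (S v))
    (hT : ∀ x, T * B.cliff v x = B.cliff v x * T) : ∃ c : ℂ, T = c • (1 : Module.End ℂ (S v)) := by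
  have := B.nontrivial v
  refine exists_eq_smul_one_of_irreducible (B.ρ v) (B.irreducible v) T fun a => ?_
  induction a using CCl.induction with
  | one => simp
  | smul z a h => rw [map_smul, mul_smul_comm, smul_mul_assoc, h]
  | add a a' h h' => rw [map_add, mul_add, add_mul, h, h']
  | mul x a h =>
    have hx : T * B.ρ v (CCl.vec (B.Q v) x) = B.ρ v (CCl.vec (B.Q v) x) * T := hT x
    rw [map_mul, ← mul_assoc, hx, mul_assoc, h, mul_assoc]

theorem χ_ρ_of_mem_even (hn : Even n) {a : CCl (B.Q v)} (ha : a ∈ CCl.even (B.Q v)) :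
    B.χ v * B.ρ v a = B.ρ v a * B.χ v := by
  refine CCl.even_induction (P := fun a => B.χ v * B.ρ v a = B.ρ v a * B.χ v) (by simp)
    (fun z a h => ?_) (fun a a' h h' => ?_) (fun x y a h => ?_) ha
  · rw [map_smul, mul_smul_comm, smul_mul_assoc, h]
  · rw [map_add, mul_add, add_mul, h, h']
  · have hx : ∀ x, B.χ v * B.ρ v (CCl.vec (B.Q v) x) = -(B.ρ v (CCl.vec (B.Q v) x) * B.χ v) :=
      B.χ_cliff v hn
    rw [map_mul, map_mul, ← mul_assoc, ← mul_assoc, hx, neg_mul, mul_assoc _ (B.χ v), hx]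
    simp only [mul_neg, neg_neg, mul_assoc, h]

/-- The even part of the Clifford algebra is represented onto the commutant of the chirality. -/
theorem exists_even_of_commute_χ (hn : Even n) {T : Module.End ℂ (S v)}
    (hT : B.χ v * T = T * B.χ v) : ∃ a : CCl.even (B.Q v), B.ρ v a = T := by
  have := B.nontrivial v
  obtain ⟨a, rfl⟩ := surjective_of_irreducible (B.ρ v) (B.irreducible v) T
  obtain ⟨b, ⟨⟨i₀, h1, -⟩, -⟩, -⟩ := B.exists_frame v
  set e := CCl.vec (B.Q v) (b i₀) with he
  have hee : e * e = 1 := by rw [he, CCl.vec_mul_self, h1]; simp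
  -- Since e² = 1, left multiplication by a vector x exchanges the two parts: x e a₁ is even and x
  -- a₀ = e (e x a₀).
  have hdec : ∃ a₀ ∈ CCl.even (B.Q v), ∃ a₁ ∈ CCl.even (B.Q v), a = a₀ + e * a₁ := by
    clear hT
    induction a using CCl.induction with
    | one => exact ⟨1, one_mem _, 0, zero_mem _, by simp⟩
    | smul z a h =>
      obtain ⟨a₀, h₀, a₁, h₁, rfl⟩ := h
      exact ⟨z • a₀, Subalgebra.smul_mem _ h₀ z, z • a₁, Subalgebra.smul_mem _ h₁ z, by
        rw [smul_add, mul_smul_comm]⟩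
    | add a a' h h' =>
      obtain ⟨a₀, h₀, a₁, h₁, rfl⟩ := h
      obtain ⟨a₀', h₀', a₁', h₁', rfl⟩ := h'
      exact ⟨a₀ + a₀', add_mem h₀ h₀', a₁ + a₁', add_mem h₁ h₁', by rw [mul_add]; abel⟩
    | mul x a h =>
      obtain ⟨a₀, h₀, a₁, h₁, rfl⟩ := h
      refine ⟨CCl.vec _ x * e * a₁, mul_mem (CCl.vec_mul_vec_mem_even _ _) h₁,
        e * CCl.vec _ x * a₀, mul_mem (CCl.vec_mul_vec_mem_even _ _) h₀, ?_⟩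
      rw [mul_add, ← mul_assoc e, ← mul_assoc e, hee, one_mul, mul_assoc, add_comm]
  obtain ⟨a₀, h₀, a₁, h₁, rfl⟩ := hdec
  refine ⟨⟨a₀, h₀⟩, ?_⟩
  have hχe : B.χ v * B.ρ v e = -(B.ρ v e * B.χ v) := B.χ_cliff v hn (b i₀)
  rw [map_add, map_mul, mul_add, add_mul, B.χ_ρ_of_mem_even v hn h₀, ← mul_assoc, hχe, neg_mul,
    mul_assoc, B.χ_ρ_of_mem_even v hn h₁, ← mul_assoc, add_right_inj] at hT
  -- The odd part e a₁ both commutes and anticommutes with χ.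
  have hT0 : B.ρ v e * B.ρ v a₁ * B.χ v = 0 := by
    have : (2 : ℂ) • (B.ρ v e * B.ρ v a₁ * B.χ v) = 0 := by
      rw [two_smul]; nth_rewrite 1 [← hT]; rw [neg_add_cancel]
    exact (smul_eq_zero.1 this).resolve_left two_ne_zero
  have h0 : B.ρ v e * B.ρ v a₁ = 0 := by
    have := congrArg (· * B.χ v) hT0
    simpa [mul_assoc, B.χ_sq v hn] using this
  rw [map_add, map_mul, h0, add_zero]

/-- The ordered monomials in a pseudo-orthonormal basis span the algebra, and their images are
independent by the trace argument. -/
theorem ρ_injective (hn : Even n) : Function.Injective (B.ρ v) := by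
  have := B.nontrivial v
  obtain ⟨b, hb, -⟩ := B.exists_frame v
  have he := B.isAnticommutingFamily v hb
  have he' : IsAnticommutingFamily (fun i => CCl.vec (B.Q v) (b i))
      (fun i => (B.Q v (b i) : ℂ)) :=
    { anticomm := fun i j hij => by
        have := CCl.vec_mul_add_swap (Q := B.Q v) (b i) (b j)
        rw [hb.2 i j hij, Complex.ofReal_zero, zero_smul] at this
        exact eq_neg_of_add_eq_zero_left this
      sq := fun i => CCl.vec_mul_self (b i)
      ne_zero := he.ne_zero }
  have hspan : ∀ a : CCl (B.Q v), ∃ c : Finset (Fin n) → ℂ, a = ∑ I, c I •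
      orderedMonomial (fun i => CCl.vec (B.Q v) (b i)) (List.finRange n) I := by
    suffices ∀ a : CCl (B.Q v), a ∈ Submodule.span ℂ (Set.range
        (orderedMonomial (fun i => CCl.vec (B.Q v) (b i)) (List.finRange n))) by
      intro a
      obtain ⟨c, hc⟩ := (Submodule.mem_span_range_iff_exists_fun ℂ).1 (this a)
      exact ⟨c, hc.symm⟩
    intro a
    induction a using CCl.induction with
    | one => exact Submodule.subset_span ⟨∅, by simp [orderedMonomial]⟩
    | smul z a h => exact Submodule.smul_mem _ z h
    | add a a' h h' => exact add_mem h h'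
    | mul x a h =>
      induction b.mem_span x using Submodule.span_induction with
      | mem _ hx =>
        obtain ⟨i, rfl⟩ := hx
        induction h using Submodule.span_induction with
        | mem m hm =>
          obtain ⟨I, rfl⟩ := hm
          obtain ⟨c, hc⟩ := mul_orderedMonomial he' i (List.finRange n) (List.nodup_finRange n)
            (List.mem_finRange i) I
          rw [hc]
          exact Submodule.smul_mem _ _ (Submodule.subset_span ⟨_, rfl⟩)
        | zero => simp
        | add a a' _ _ h h' => rw [mul_add]; exact add_mem h h'
        | smul z a _ h => rw [mul_smul_comm]; exact Submodule.smul_mem _ z h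
      | zero => have : CCl.vec (B.Q v) 0 = 0 := by simp [CCl.vec]
                simp [this]
      | add x y _ _ hx hy => rw [CCl.vec_add, add_mul]; exact add_mem hx hy
      | smul r x _ hx => rw [CCl.vec_smul, smul_mul_assoc]; exact Submodule.smul_mem _ _ hx
  rw [injective_iff_map_eq_zero]
  intro a ha
  obtain ⟨c, rfl⟩ := hspan a
  have hmon : ∀ I, B.ρ v (orderedMonomial (fun i => CCl.vec (B.Q v) (b i)) (List.finRange n) I) =
      orderedMonomial (fun i => B.cliff v (b i)) (List.finRange n) I := fun I => by
    rw [orderedMonomial, orderedMonomial, map_list_prod, List.map_map]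
    congr 1
    refine List.map_congr_left fun i _ => ?_
    by_cases h : i ∈ I <;> simp [h, cliff]
  simp only [map_sum, map_smul, hmon] at ha
  have h0 := coeff_eq_zero_of_sum_orderedMonomial he hn c ha
  simp [h0]

end DiscreteSpinorBundle

/-! ## Future-directed timelike vectors -/

section Lorentzian

variable {n : ℕ} {X : Type*} [AddCommGroup X] [Module ℝ X] {Q : QuadraticForm ℝ X}
  {b : Module.Basis (Fin n) ℝ X}

theorem IsPseudoOrthonormal.neg_of_polar_eq_zero (hb : IsPseudoOrthonormal Q b) {i₀ : Fin n}
    (h₀ : Q (b i₀) = 1) {z : X} (hz : QuadraticMap.polar Q (b i₀) z = 0) (hz0 : z ≠ 0) :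
    Q z < 0 := by
  obtain ⟨⟨i₁, h1, h2⟩, h3⟩ := hb
  obtain rfl : i₀ = i₁ := by
    by_contra h
    have := h2 i₀ h
    linarith
  have hortho : (QuadraticMap.associated (R := ℝ) Q).IsOrthoᵢ b := by
    rw [LinearMap.isOrthoᵢ_def]
    intro i j hij
    have : Q (b i + b j) - Q (b i) - Q (b j) = 0 := h3 i j hij
    rw [QuadraticMap.associated_apply, this, smul_zero]
  have hQ : Q z = ∑ i, Q (b i) * (b.repr z i * b.repr z i) := by
    have h := DFunLike.congr_fun (QuadraticMap.basisRepr_eq_of_iIsOrtho Q b hortho) (b.equivFun z)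
    rw [QuadraticMap.basisRepr_apply, b.sum_equivFun, QuadraticMap.weightedSumSquares_apply] at h
    simpa using h
  have hz₀ : b.repr z i₀ = 0 := by
    have h : QuadraticMap.polarBilin Q (b i₀) z = 0 := hz
    rw [← b.sum_repr z, map_sum, Finset.sum_eq_single i₀] at h
    · rw [map_smul, QuadraticMap.polarBilin_apply_apply, QuadraticMap.polar_self, h1] at h
      simpa using h
    · intro j _ hj
      rw [map_smul, QuadraticMap.polarBilin_apply_apply, h3 i₀ j (Ne.symm hj), smul_zero]
    · simp
  obtain ⟨j, hj⟩ : ∃ j, b.repr z j ≠ 0 := by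
    by_contra! h
    exact hz0 (b.repr.map_eq_zero_iff.1 (Finsupp.ext h))
  have hj0 : j ≠ i₀ := fun h => hj (h ▸ hz₀)
  rw [hQ]
  refine Finset.sum_neg' (fun i _ => ?_) ⟨j, Finset.mem_univ j, ?_⟩
  · by_cases hi : i = i₀
    · simp [hi, hz₀]
    · rw [h2 i hi]; nlinarith [mul_self_nonneg (b.repr z i)]
  · rw [h2 j hj0]; nlinarith [mul_self_pos.2 hj]

end Lorentzian

/-! ### Time orientation of vectors through the Krein product. -/

namespace DiscreteSpinorBundle

variable {V E : Type*} {G : WeightedOrientedGraph V E} {n : ℕ} {X S : V → Type*}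
  [∀ v, AddCommGroup (X v)] [∀ v, Module ℝ (X v)]
  [∀ v, AddCommGroup (S v)] [∀ v, Module ℂ (S v)] [∀ v, FiniteDimensional ℂ (S v)]
  (B : DiscreteSpinorBundle G n X S) (v : V)

/-- The form `(., e₀ .)` is definite for a timelike vector `e₀` of a pseudo-orthonormal basis. -/
theorem definite_of_isPseudoOrthonormal {b : Module.Basis (Fin n) ℝ (X v)}
    (hb : IsPseudoOrthonormal (B.Q v) b) {i₀ : Fin n} (h₀ : B.Q v (b i₀) = 1) :
    IsPosDefWith (B.krein v) (B.cliff v (b i₀)) ∨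
      IsPosDefWith (B.krein v) (B.cliff v (-b i₀)) := by
  have hnt := B.nontrivial v
  have hK := B.isKrein v
  have h2 : ∀ i, i ≠ i₀ → B.Q v (b i) = -1 := by
    obtain ⟨⟨i₁, h1, h2⟩, -⟩ := hb
    obtain rfl : i₀ = i₁ := by
      by_contra h
      have := h2 i₀ h
      linarith
    exact h2
  -- The factor I on the negative vectors makes every f i an involution, so some inner product p is
  -- invariant under all f i, which are then p-self-adjoint.
  let z : Fin n → ℂ := fun i => if i = i₀ then 1 else Complex.I
  have hz0 : ∀ i, z i ≠ 0 := fun i => by by_cases h : i = i₀ <;> simp [z, h]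
  let f : Fin n → Module.End ℂ (S v) := fun i => z i • B.cliff v (b i)
  have hfsq : ∀ i, f i * f i = 1 := fun i => by
    by_cases h : i = i₀
    · simp [f, z, h, B.cliff_mul_self, h₀]
    · simp [f, z, h, B.cliff_mul_self, h2 i h, smul_smul]
  have hfcomm : ∀ i j, f i * f j = f j * f i ∨ f i * f j = -(f j * f i) := fun i j => by
    by_cases h : i = j
    · left; rw [h]
    · right
      simp only [f, smul_mul_smul_comm, B.cliff_anticomm v (hb.2 i j h), smul_neg, mul_comm]
  obtain ⟨p, hp1, hp2, hp3⟩ := exists_invariant_posDef_form (List.ofFn f)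
    (by simpa [List.forall_mem_ofFn_iff] using hfsq)
    (by simpa [List.forall_mem_ofFn_iff] using hfcomm)
  have hpf : ∀ i ψ φ, p (f i ψ) φ = p ψ (f i φ) := fun i ψ φ => by
    have h := hp3 (f i) ((List.mem_ofFn' f (f i)).2 ⟨i, rfl⟩) ψ (f i φ)
    rwa [← Module.End.mul_apply, hfsq i, Module.End.one_apply] at h
  have hpK : IsKreinProduct p := ⟨hp1, fun φ h => by
    by_contra h0
    have := (hp2 φ h0).1
    simp [h] at this⟩
  have hsa : ∀ x ψ φ, B.krein v (B.cliff v x ψ) φ = B.krein v ψ (B.cliff v x φ) :=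
    fun x => B.krein_compatible v x
  -- Each f i is symmetric for (·, e₀ ·) too: for i ≠ i₀ the sign of conj I cancels that of the
  -- anticommutation with e₀. Hence the operator comparing g with p commutes with all vectors, and
  -- Schur gives g = c p.
  let g := (B.krein v).compl₂ (B.cliff v (b i₀))
  have hgf : ∀ i ψ φ, g (f i ψ) φ = g ψ (f i φ) := fun i ψ φ => by
    change B.krein v (f i ψ) (B.cliff v (b i₀) φ) = B.krein v ψ (B.cliff v (b i₀) (f i φ))
    by_cases h : i = i₀
    · simp [f, z, h, hsa]
    · have ha : ∀ φ, B.cliff v (b i₀) (B.cliff v (b i) φ) =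
          -B.cliff v (b i) (B.cliff v (b i₀) φ) := fun φ =>
        LinearMap.congr_fun (B.cliff_anticomm v (hb.2 i₀ i (Ne.symm h))) φ
      simp [f, z, h, hsa, ha]
  obtain ⟨T, hT⟩ := hpK.exists_operator g
  have hTf : ∀ i, T * f i = f i * T := fun i => LinearMap.ext fun φ =>
    hpK.eq_of_forall fun ψ => by
      rw [Module.End.mul_apply, Module.End.mul_apply, ← hT, ← hgf, hT, hpf]
  obtain ⟨c, rfl⟩ := B.exists_eq_smul_one v T fun x => by
    induction b.mem_span x using Submodule.span_induction with
    | mem _ h =>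
      obtain ⟨i, rfl⟩ := h
      have := hTf i
      simp only [f, mul_smul_comm, smul_mul_assoc] at this
      exact smul_right_injective _ (hz0 i) this
    | zero => have : B.cliff v 0 = 0 := by simpa using B.cliff_smul v 0 0
              simp [this]
    | add x y _ _ hx hy => rw [cliff_add, mul_add, hx, hy, add_mul]
    | smul r x _ hx => rw [cliff_smul, mul_smul_comm, hx, smul_mul_assoc]
  have hgc : ∀ ψ, B.krein v ψ (B.cliff v (b i₀) ψ) = c * p ψ ψ := fun ψ => by
    have := hT ψ ψ
    simpa [g] using this
  have hreal : ∀ ψ, (B.krein v ψ (B.cliff v (b i₀) ψ)).im = 0 := fun ψ => by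
    have h := hK.hermitian ψ (B.cliff v (b i₀) ψ)
    rw [hsa] at h
    exact Complex.conj_eq_iff_im.1 h.symm
  obtain ⟨ψ₀, hψ₀⟩ := exists_ne (0 : S v)
  have hpp : ∀ ψ, ψ ≠ 0 → 0 < (p ψ ψ).re ∧ (p ψ ψ).im = 0 := hp2
  have hc_im : c.im = 0 := by
    have h := hreal ψ₀
    rw [hgc, Complex.mul_im, (hpp ψ₀ hψ₀).2, mul_zero, zero_add] at h
    exact (mul_eq_zero.1 h).resolve_right (hpp ψ₀ hψ₀).1.ne'
  have hc_re : c.re ≠ 0 := by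
    intro h
    have hc : c = 0 := Complex.ext h hc_im
    have : B.cliff v (b i₀) ψ₀ = 0 := hK.nondegenerate _ fun ψ => by
      have := hT ψ ψ₀
      simpa [g, hc] using this
    have h1 : B.cliff v (b i₀) (B.cliff v (b i₀) ψ₀) = ψ₀ := by
      have := LinearMap.congr_fun (B.cliff_mul_self v (b i₀)) ψ₀
      simpa [h₀] using this
    rw [this, map_zero] at h1
    exact hψ₀ h1.symm
  have hval : ∀ ψ, ψ ≠ 0 → (B.krein v ψ (B.cliff v (b i₀) ψ)).re = c.re * (p ψ ψ).re :=
    fun ψ hψ => by rw [hgc, Complex.mul_re, hc_im, zero_mul, sub_zero]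
  rcases lt_or_gt_of_ne hc_re with hneg | hpos
  · right
    intro ψ hψ
    rw [cliff_neg, LinearMap.neg_apply, map_neg, Complex.neg_re, Complex.neg_im, hreal, hval ψ hψ]
    exact ⟨by nlinarith [(hpp ψ hψ).1], neg_zero⟩
  · left
    intro ψ hψ
    rw [hreal, hval ψ hψ]
    exact ⟨mul_pos hpos (hpp ψ hψ).1, rfl⟩

/-- There is a future-directed unit vector, whose orthogonal complement is negative definite. -/
theorem exists_unit_future : ∃ e : X v, B.Q v e = 1 ∧ IsPosDefWith (B.krein v) (B.cliff v e) ∧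
    ∀ z, QuadraticMap.polar (B.Q v) e z = 0 → z ≠ 0 → B.Q v z < 0 := by
  obtain ⟨b, hb⟩ := B.antilorentzian v
  obtain ⟨i₀, h₀, -⟩ := hb.1
  rcases B.definite_of_isPseudoOrthonormal v hb h₀ with h | h
  · exact ⟨b i₀, h₀, h, fun z hz hz0 => hb.neg_of_polar_eq_zero h₀ hz hz0⟩
  · refine ⟨-b i₀, by rw [QuadraticMap.map_neg, h₀], h, fun z hz hz0 =>
      hb.neg_of_polar_eq_zero h₀ ?_ hz0⟩
    rwa [QuadraticMap.polar_neg_left, neg_eq_zero] at hz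

theorem finrank_eq (B : DiscreteSpinorBundle G n X S) (v : V) : Module.finrank ℝ (X v) = n := by
  obtain ⟨b, -⟩ := B.antilorentzian v
  rw [Module.finrank_eq_card_basis b, Fintype.card_fin]

theorem finiteDimensional_vectors (B : DiscreteSpinorBundle G n X S) (v : V) :
    FiniteDimensional ℝ (X v) := by
  obtain ⟨b, -⟩ := B.antilorentzian v
  exact Module.Finite.of_basis b

/-- The orthogonal decomposition of a vector along a unit vector. -/
theorem exists_decomposition {e : X v} (he : B.Q v e = 1) (x : X v) :
    ∃ (t : ℝ) (w : X v), x = t • e + w ∧ QuadraticMap.polar (B.Q v) e w = 0 ∧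
      2 * t = QuadraticMap.polar (B.Q v) e x ∧ B.Q v x = t ^ 2 + B.Q v w := by
  set t := QuadraticMap.polar (B.Q v) e x / 2 with ht
  have hw : QuadraticMap.polar (B.Q v) e (x - t • e) = 0 := by
    rw [QuadraticMap.polar_sub_right, QuadraticMap.polar_smul_right,
      QuadraticMap.polar_self, he, ht]
    simp
  refine ⟨t, x - t • e, by abel, hw, by rw [ht]; ring, ?_⟩
  have h : B.Q v (t • e + (x - t • e)) = _ := QuadraticMap.map_add (B.Q v) (t • e) (x - t • e)
  rw [QuadraticMap.polar_smul_left, hw, QuadraticMap.map_smul, he, add_sub_cancel] at h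
  rw [h]; simp [sq]

theorem eq_zero_of_forall_polar_eq_zero {x : X v}
    (h : ∀ y, QuadraticMap.polar (B.Q v) x y = 0) : x = 0 := by
  obtain ⟨e, -, -, hneg⟩ := B.exists_unit_future v
  by_contra hx
  have h1 := hneg x (by rw [QuadraticMap.polar_comm]; exact h e) hx
  have h2 := h x
  rw [QuadraticMap.polar_self] at h2
  simp at h2
  linarith

theorem cliff_injective : Function.Injective (B.cliff v) := by
  have hnt := B.nontrivial v
  intro x y hxy
  have h0 : B.cliff v (x - y) = 0 := by
    rw [sub_eq_add_neg, cliff_add, cliff_neg, hxy, add_neg_cancel]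
  refine sub_eq_zero.1 (B.eq_zero_of_forall_polar_eq_zero v fun z => ?_)
  have := B.cliff_mul_add_swap v (x - y) z
  rw [h0, zero_mul, mul_zero, add_zero] at this
  exact_mod_cast (smul_eq_zero.1 this.symm).resolve_right one_ne_zero

/-- Every timelike vector is future-directed or past-directed. -/
theorem future_or_past {x : X v} (hx : B.IsTimelike x) :
    B.IsFutureTimelike x ∨ B.IsFutureTimelike (-x) := by
  obtain ⟨e, he, hpos, hneg⟩ := B.exists_unit_future v
  obtain ⟨t, w, hxw, hew, -, hQ⟩ := B.exists_decomposition v he x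
  have hK := B.isKrein v
  have hsa : ∀ x ψ φ, B.krein v (B.cliff v x ψ) φ = B.krein v ψ (B.cliff v x φ) :=
    fun x => B.krein_compatible v x
  have hreal : ∀ x ψ, (B.krein v ψ (B.cliff v x ψ)).im = 0 := fun x ψ => by
    have h := hK.hermitian ψ (B.cliff v x ψ)
    rw [hsa] at h
    exact Complex.conj_eq_iff_im.1 h.symm
  have hw : B.Q v w ≤ 0 := by
    by_cases h : w = 0
    · simp [h]
    · exact (hneg w hew h).le
  have hx' : 0 < t ^ 2 + B.Q v w := hQ ▸ hx
  have hee : ∀ ψ, B.cliff v e (B.cliff v e ψ) = ψ := fun ψ => by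
    have := LinearMap.congr_fun (B.cliff_mul_self v e) ψ
    simpa [he] using this
  have hww : ∀ ψ, B.cliff v w (B.cliff v w ψ) = (B.Q v w : ℂ) • ψ := fun ψ =>
    LinearMap.congr_fun (B.cliff_mul_self v w) ψ
  have hewc : ∀ ψ, B.cliff v e (B.cliff v w ψ) = -B.cliff v w (B.cliff v e ψ) := fun ψ =>
    LinearMap.congr_fun (B.cliff_anticomm v hew) ψ
  have hkey : ∀ ψ, ψ ≠ 0 → 0 < t * (B.krein v ψ (B.cliff v x ψ)).re := by
    intro ψ hψ
    have hg := (hpos ψ hψ).1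
    -- For this φ, (φ, eφ) ≥ 0 reads (t² - Q w)(ψ, eψ) + 2t (ψ, wψ) ≥ 0, whence t (ψ, xψ) ≥ ½ Q(x)
    -- (ψ, eψ) > 0.
    set φ := B.cliff v e (B.cliff v w ψ) + (t : ℂ) • ψ with hφ
    have hnn : 0 ≤ (B.krein v φ (B.cliff v e φ)).re := by
      by_cases h : φ = 0
      · simp [h]
      · exact (hpos φ h).1.le
    have hcalc : B.krein v φ (B.cliff v e φ) =
        ((t ^ 2 - B.Q v w : ℝ) : ℂ) * B.krein v ψ (B.cliff v e ψ) +
          ((2 * t : ℝ) : ℂ) * B.krein v ψ (B.cliff v w ψ) := by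
      simp only [hφ, map_add, LinearMap.add_apply, map_smul, LinearMap.map_smulₛₗ,
        LinearMap.smul_apply, hsa, hee, Complex.conj_ofReal, smul_eq_mul]
      rw [hewc ψ, map_neg, hww, map_neg, map_smul, smul_eq_mul]
      push_cast
      ring
    have hxe : (B.krein v ψ (B.cliff v x ψ)).re =
        t * (B.krein v ψ (B.cliff v e ψ)).re + (B.krein v ψ (B.cliff v w ψ)).re := by
      rw [hxw, cliff_add, cliff_smul]
      simp
    rw [hcalc, Complex.add_re, Complex.re_ofReal_mul, Complex.re_ofReal_mul] at hnn
    rw [hxe]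
    nlinarith
  have ht : t ≠ 0 := by
    rintro rfl
    linarith [hx', hw]
  rcases lt_or_gt_of_ne ht with h | h
  · refine Or.inr ⟨by rw [IsTimelike, QuadraticMap.map_neg]; exact hx, fun ψ hψ => ⟨?_, hreal _ ψ⟩⟩
    rw [cliff_neg, LinearMap.neg_apply, map_neg, Complex.neg_re]
    nlinarith [hkey ψ hψ]
  · exact Or.inl ⟨hx, fun ψ hψ => ⟨(pos_iff_pos_of_mul_pos (hkey ψ hψ)).1 h, hreal _ ψ⟩⟩

end DiscreteSpinorBundle

/-! ## The timelike vector attached to a positive odd operator -/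

namespace DiscreteSpinorBundle

variable {V E : Type*} {G : WeightedOrientedGraph V E} {n : ℕ} {X S : V → Type*}
  [∀ v, AddCommGroup (X v)] [∀ v, Module ℝ (X v)]
  [∀ v, AddCommGroup (S v)] [∀ v, Module ℂ (S v)] [∀ v, FiniteDimensional ℂ (S v)]
  (B : DiscreteSpinorBundle G n X S) (v : V)

/-- Odd Krein-self-adjoint operators `T` with `(., T .)` positive definite. -/
structure IsPositiveOdd (T : Module.End ℂ (S v)) : Prop where
  odd : B.χ v * T = -(T * B.χ v)
  selfAdjoint : IsAdjointFor (fun ψ φ => B.krein v ψ φ) T T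
  posDef : IsPosDefWith (B.krein v) T

theorem IsFutureTimelike.isPositiveOdd {B : DiscreteSpinorBundle G n X S} {v : V} (hn : Even n)
    {x : X v} (hx : B.IsFutureTimelike x) : B.IsPositiveOdd v (B.cliff v x) :=
  ⟨B.χ_cliff v hn x, B.krein_compatible v x, hx.2⟩

/-- The projection onto the eigenspace of the chirality for the eigenvalue `σ = ±1`. -/
def chiralProj (σ : ℝ) : Module.End ℂ (S v) := (2⁻¹ : ℂ) • (1 + (σ : ℂ) • B.χ v)

/-! ### Chiral projections. -/

section chiralProj

variable {B v} {σ : ℝ}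

theorem chiralProj_mul_self (hn : Even n) (hσ : σ * σ = 1) :
    B.chiralProj v σ * B.chiralProj v σ = B.chiralProj v σ := by
  have h : (σ : ℂ) * σ = 1 := by exact_mod_cast hσ
  have hsq : ((σ : ℂ) • B.χ v) * ((σ : ℂ) • B.χ v) = 1 := by
    rw [smul_mul_smul_comm, h, B.χ_sq v hn, one_smul]
  rw [chiralProj, smul_mul_smul_comm, mul_add, add_mul, add_mul, hsq]
  simp only [mul_one, one_mul]
  module

theorem chiralProj_mul_neg (hn : Even n) (hσ : σ * σ = 1) :
    B.chiralProj v σ * B.chiralProj v (-σ) = 0 := by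
  have h : (σ : ℂ) * σ = 1 := by exact_mod_cast hσ
  have hsq : ((σ : ℂ) • B.χ v) * ((σ : ℂ) • B.χ v) = 1 := by
    rw [smul_mul_smul_comm, h, B.χ_sq v hn, one_smul]
  rw [chiralProj, chiralProj, Complex.ofReal_neg, neg_smul, smul_mul_smul_comm, mul_add, add_mul,
    add_mul, mul_neg, mul_neg, hsq]
  simp only [mul_one, one_mul]
  module

theorem chiralProj_add_neg : B.chiralProj v σ + B.chiralProj v (-σ) = 1 := by
  simp only [chiralProj, Complex.ofReal_neg]
  module

theorem chiralProj_mul_odd {T : Module.End ℂ (S v)} (hT : B.χ v * T = -(T * B.χ v)) :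
    B.chiralProj v σ * T = T * B.chiralProj v (-σ) := by
  simp only [chiralProj, smul_mul_assoc, mul_smul_comm, mul_add, add_mul, one_mul, mul_one, hT,
    Complex.ofReal_neg]
  module

theorem chiralProj_mul_even {T : Module.End ℂ (S v)} (hT : B.χ v * T = T * B.χ v) :
    B.chiralProj v σ * T = T * B.chiralProj v σ := by
  simp only [chiralProj, smul_mul_assoc, mul_smul_comm, mul_add, add_mul, one_mul, mul_one, hT]

theorem χ_chiralProj : B.χ v * B.chiralProj v σ = B.chiralProj v σ * B.χ v :=
  (chiralProj_mul_even rfl).symm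

/-- Since χ^× = -χ, Krein adjunction exchanges the two chiralities. -/
theorem chiralProj_adjoint (hn : Even n) :
    IsAdjointFor (fun ψ φ => B.krein v ψ φ) (B.chiralProj v σ) (B.chiralProj v (-σ)) := by
  intro ψ φ
  have h : B.krein v (B.χ v ψ) φ = B.krein v ψ (-B.χ v φ) := B.χ_adjoint v hn ψ φ
  have h2 : conj (2⁻¹ : ℂ) = 2⁻¹ := by rw [map_inv₀, Complex.conj_ofNat]
  simp only [chiralProj, LinearMap.smul_apply, LinearMap.add_apply, Module.End.one_apply,
    LinearMap.map_smulₛₗ, map_add, h, h2, Complex.conj_ofReal, map_smul, map_neg, smul_eq_mul,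
    Complex.ofReal_neg]
  ring

theorem J_chiralProj (hn : Even n) (ψ : S v) :
    B.J v (B.chiralProj v ((-1) ^ (n / 2 + 1) * σ) ψ) = B.chiralProj v σ (B.J v ψ) := by
  have hs : ((-1 : ℂ) ^ (n / 2 + 1)) * (-1) ^ (n / 2 + 1) = 1 := by rw [← mul_pow]; simp
  simp only [chiralProj, LinearMap.smul_apply, LinearMap.add_apply, Module.End.one_apply,
    LinearMap.map_smulₛₗ, map_add, B.J_χ v hn, Complex.conj_ofReal, smul_smul]
  push_cast
  rw [show (-1 : ℂ) ^ (n / 2 + 1) * σ * (-1) ^ (n / 2 + 1) = σ by linear_combination (σ : ℂ) * hs]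
  rw [map_inv₀, Complex.conj_ofNat]

/-- An invertible odd vector exchanges the two projections, so both would vanish although their sum
is 1. -/
theorem chiralProj_ne_zero (hn : Even n) : B.chiralProj v σ ≠ 0 := by
  have hnt := B.nontrivial v
  obtain ⟨e, -, hpos, -⟩ := B.exists_unit_future v
  intro h
  have h1 := chiralProj_mul_odd (σ := σ) (B.χ_cliff v hn e)
  rw [h, zero_mul] at h1
  have h2 := hpos.isUnit.mul_right_eq_zero.1 h1.symm
  have h3 := chiralProj_add_neg (B := B) (v := v) (σ := σ)
  rw [h, h2, add_zero] at h3
  exact zero_ne_one h3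

end chiralProj

/-! ### Positivity of chiral traces. -/

section trace

variable {B v} {σ : ℝ} {T : Module.End ℂ (S v)}

/-- This is `trace_pos_of_posDef` for W = Z P_σ, with adjoint P_{-σ} Z. Oddness of T turns T P_{-σ}
into P_σ T, and cyclicity merges the two projections. -/
theorem trace_chiralProj_pos (hn : Even n) (hσ : σ * σ = 1) (hT : B.IsPositiveOdd v T)
    {U Z : Module.End ℂ (S v)} (hU : IsPosDefWith (B.krein v) U)
    (hZ : IsAdjointFor (fun ψ φ => B.krein v ψ φ) Z Z) (hZ0 : Z * B.chiralProj v σ ≠ 0) :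
    0 < (LinearMap.trace ℂ (S v) (B.chiralProj v σ * T * (Z * (U * Z)))).re ∧
      (LinearMap.trace ℂ (S v) (B.chiralProj v σ * T * (Z * (U * Z)))).im = 0 := by
  have h := trace_pos_of_posDef (B.isKrein v) hT.posDef hT.selfAdjoint hU
    (IsAdjointFor.mul hZ (chiralProj_adjoint (B := B) (v := v) (σ := σ) hn)) hZ0
  have heq : T * (B.chiralProj v (-σ) * Z * (U * (Z * B.chiralProj v σ))) =
      (B.chiralProj v σ * T * (Z * (U * Z))) * B.chiralProj v σ := by
    rw [chiralProj_mul_odd hT.odd]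
    simp only [mul_assoc]
  rwa [heq, LinearMap.trace_mul_comm, mul_assoc (B.chiralProj v σ) T, ← mul_assoc,
    chiralProj_mul_self hn hσ, ← mul_assoc] at h

/-- Take Z = U = y and use y³ = Q(y) y with Q(y) > 0. -/
theorem trace_chiralProj_cliff_pos (hn : Even n) (hσ : σ * σ = 1) (hT : B.IsPositiveOdd v T)
    {y : X v} (hy : B.IsFutureTimelike y) :
    0 < (LinearMap.trace ℂ (S v) (B.chiralProj v σ * T * B.cliff v y)).re ∧
      (LinearMap.trace ℂ (S v) (B.chiralProj v σ * T * B.cliff v y)).im = 0 := by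
  have h := trace_chiralProj_pos hn hσ hT hy.2 (B.krein_compatible v y)
    (fun h0 => chiralProj_ne_zero hn (hy.2.isUnit.mul_right_eq_zero.1 h0))
  have hyy : B.ρ v (CCl.vec (B.Q v) y) * (B.cliff v y * B.ρ v (CCl.vec (B.Q v) y)) =
      (B.Q v y : ℂ) • B.cliff v y := by
    change B.cliff v y * (B.cliff v y * B.cliff v y) = _
    rw [cliff_mul_self, mul_smul_comm, mul_one]
  rw [hyy, mul_smul_comm, map_smul, smul_eq_mul, Complex.re_ofReal_mul, Complex.im_ofReal_mul] at h
  have hy1 : 0 < B.Q v y := hy.1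
  exact ⟨(pos_iff_pos_of_mul_pos h.1).1 hy1, (mul_eq_zero.1 h.2).resolve_left hy1.ne'⟩

variable (B v σ T) in
/-- The real functional `y ↦ Re Tr(P_σ T y)` on vectors. -/
def chiralTrace : X v →ₗ[ℝ] ℝ where
  toFun y := (LinearMap.trace ℂ (S v) (B.chiralProj v σ * T * B.cliff v y)).re
  map_add' x y := by rw [cliff_add, mul_add, map_add, Complex.add_re]
  map_smul' r x := by
    rw [cliff_smul, mul_smul_comm, map_smul, smul_eq_mul, Complex.re_ofReal_mul]; rfl

theorem chiralTrace_apply (y : X v) : B.chiralTrace v σ T y =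
    (LinearMap.trace ℂ (S v) (B.chiralProj v σ * T * B.cliff v y)).re := rfl

/-- In dimension `n > 2` the functional `chiralTrace` is positive on null vectors `r e + w`. -/
theorem chiralTrace_null_pos (hn : Even n) (hn2 : 2 < n) (hσ : σ * σ = 1)
    (hT : B.IsPositiveOdd v T) {e w : X v} (he : B.Q v e = 1)
    (hpos : IsPosDefWith (B.krein v) (B.cliff v e))
    (hneg : ∀ z, QuadraticMap.polar (B.Q v) e z = 0 → z ≠ 0 → B.Q v z < 0)
    (hew : QuadraticMap.polar (B.Q v) e w = 0) {r : ℝ} (hr : 0 < r) (hrw : B.Q v w = -r ^ 2) :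
    0 < B.chiralTrace v σ T (r • e + w) := by
  have hnt := B.nontrivial v
  set y := r • e + w with hy
  have hQy : B.Q v y = 0 := by
    rw [hy, QuadraticMap.map_add (B.Q v), QuadraticMap.map_smul,
      QuadraticMap.polar_smul_left, hew, he, hrw]
    simp [sq]
  have hye : QuadraticMap.polar (B.Q v) y e = 2 * r := by
    rw [hy, QuadraticMap.polar_add_left, QuadraticMap.polar_smul_left, QuadraticMap.polar_self,
      QuadraticMap.polar_comm _ w e, hew, he]
    simp [mul_comm]
  have hsq : B.cliff v y * B.cliff v y = 0 := by
    rw [cliff_mul_self, hQy]; simp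
  have hswap := B.cliff_mul_add_swap v y e
  rw [hye] at hswap
  have hr0 : ((2 * r : ℝ) : ℂ) ≠ 0 := by
    exact_mod_cast (by positivity : (2 * r : ℝ) ≠ 0)
  -- As y is null, y e y is a positive multiple of y, so the general positivity can be used with Z =
  -- y and U = e.
  have hYUY : B.cliff v y * (B.cliff v e * B.cliff v y) = ((2 * r : ℝ) : ℂ) • B.cliff v y := by
    rw [← mul_assoc, eq_sub_of_add_eq hswap, sub_mul, mul_assoc, hsq, mul_zero, sub_zero,
      smul_mul_assoc, one_mul]
  have hY0 : B.cliff v y ≠ 0 := by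
    intro h
    rw [h, zero_mul, mul_zero, add_zero] at hswap
    exact (smul_ne_zero hr0 one_ne_zero) hswap.symm
  -- This is where n > 2 enters: two linear conditions leave a nonzero z.
  obtain ⟨z, hz0, hez, hwz⟩ : ∃ z : X v, z ≠ 0 ∧ QuadraticMap.polar (B.Q v) e z = 0 ∧
      QuadraticMap.polar (B.Q v) w z = 0 := by
    have := B.finiteDimensional_vectors v
    let f : X v →ₗ[ℝ] (Fin 2 → ℝ) := LinearMap.pi ![(B.Q v).polarBilin e, (B.Q v).polarBilin w]
    have hker : LinearMap.ker f ≠ ⊥ :=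
      LinearMap.ker_ne_bot_of_finrank_lt (by rw [B.finrank_eq v]; simpa using hn2)
    obtain ⟨z, hz, hz0⟩ := Submodule.exists_mem_ne_zero_of_ne_bot hker
    have hz' : ∀ i, f z i = 0 := fun i => congrFun (LinearMap.mem_ker.1 hz) i
    exact ⟨z, hz0, hz' 0, hz' 1⟩
  have hyz : QuadraticMap.polar (B.Q v) y z = 0 := by
    rw [hy, QuadraticMap.polar_add_left, QuadraticMap.polar_smul_left, hez, hwz]; simp
  have hQz : (B.Q v z : ℂ) ≠ 0 := by exact_mod_cast (hneg z hez hz0).ne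
  -- The invertible odd z anticommutes with y, so if y killed one chirality it would kill the other,
  -- and y would act as 0.
  have hne : B.cliff v y * B.chiralProj v σ ≠ 0 := by
    intro h
    have h1 : B.cliff v y * B.chiralProj v (-σ) * B.cliff v z = 0 := by
      have hodd := chiralProj_mul_odd (σ := -σ) (B.χ_cliff v hn z)
      rw [neg_neg] at hodd
      rw [mul_assoc, hodd, ← mul_assoc, B.cliff_anticomm v hyz, neg_mul, mul_assoc, h, mul_zero,
        neg_zero]
    have h2 : B.cliff v y * B.chiralProj v (-σ) = 0 := by
      have := congrArg (· * B.cliff v z) h1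
      simp only [mul_assoc, cliff_mul_self, zero_mul, mul_smul_comm, mul_one] at this
      exact (smul_eq_zero.1 this).resolve_left hQz
    apply hY0
    rw [← mul_one (B.cliff v y), ← chiralProj_add_neg (B := B) (v := v) (σ := σ),
      mul_add, h, h2, add_zero]
  have h := (trace_chiralProj_pos hn hσ hT hpos (B.krein_compatible v y) hne).1
  have hYUY' : B.ρ v (CCl.vec (B.Q v) y) * (B.cliff v e * B.ρ v (CCl.vec (B.Q v) y)) =
      ((2 * r : ℝ) : ℂ) • B.cliff v y := hYUY
  rw [hYUY', mul_smul_comm, map_smul, smul_eq_mul, Complex.re_ofReal_mul] at h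
  exact (pos_iff_pos_of_mul_pos h).1 (by positivity)

end trace

/-! ### Metric duals of the chiral traces. -/

theorem exists_dual (f : X v →ₗ[ℝ] ℝ) : ∃ x : X v, ∀ y, QuadraticMap.polar (B.Q v) x y = f y := by
  have := B.finiteDimensional_vectors v
  have hinj : Function.Injective (B.Q v).polarBilin := by
    rw [injective_iff_map_eq_zero]
    exact fun x hx => B.eq_zero_of_forall_polar_eq_zero v fun y => LinearMap.congr_fun hx y
  have hsurj := (LinearMap.injective_iff_surjective_of_finrank_eq_finrank
    (Subspace.dual_finrank_eq (K := ℝ) (V := X v)).symm).1 hinj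
  obtain ⟨x, hx⟩ := hsurj f
  exact ⟨x, fun y => LinearMap.congr_fun hx y⟩

/-- The vector representing a functional with respect to the metric. -/
def dualVec (f : X v →ₗ[ℝ] ℝ) : X v := (B.exists_dual v f).choose

theorem polar_dualVec (f : X v →ₗ[ℝ] ℝ) (y : X v) :
    QuadraticMap.polar (B.Q v) (B.dualVec v f) y = f y := (B.exists_dual v f).choose_spec y

theorem eq_dualVec {f : X v →ₗ[ℝ] ℝ} {x : X v}
    (h : ∀ y, QuadraticMap.polar (B.Q v) x y = f y) : x = B.dualVec v f :=
  sub_eq_zero.1 <| B.eq_zero_of_forall_polar_eq_zero v fun y => by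
    rw [QuadraticMap.polar_sub_left, h, polar_dualVec, sub_self]

/-- The normalized vector representing a functional. -/
def unitVec (f : X v →ₗ[ℝ] ℝ) : X v := (√(B.Q v (B.dualVec v f)))⁻¹ • B.dualVec v f

/-- Makes the normalized dual insensitive to a positive rescaling of T on one chirality. -/
theorem unitVec_smul {r : ℝ} (hr : 0 < r) (f : X v →ₗ[ℝ] ℝ) :
    B.unitVec v (r • f) = B.unitVec v f := by
  have h : B.dualVec v (r • f) = r • B.dualVec v f := (B.eq_dualVec v fun y => by
    rw [QuadraticMap.polar_smul_left, polar_dualVec]; rfl).symm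
  rw [unitVec, h, QuadraticMap.map_smul, smul_eq_mul, Real.sqrt_mul (by positivity),
    Real.sqrt_mul_self hr.le, smul_smul, unitVec, mul_inv, mul_right_comm,
    inv_mul_cancel₀ hr.ne', one_mul]

variable {B v}

/-- Write the dual vector as t e + w, so that t > 0 by positivity on e. If w ≠ 0, put r² = -Q(w):
positivity on the null vector r e + w says 2r(t - r) > 0, so t > r and the norm t² - r² is positive.
-/
theorem dualVec_timelike (hn : Even n) (hn2 : 2 < n) {σ : ℝ} (hσ : σ * σ = 1)
    {T : Module.End ℂ (S v)} (hT : B.IsPositiveOdd v T) :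
    B.IsTimelike (B.dualVec v (B.chiralTrace v σ T)) := by
  set f := B.chiralTrace v σ T with hf
  set x := B.dualVec v f with hx
  obtain ⟨e, he, hpos, hneg⟩ := B.exists_unit_future v
  obtain ⟨t, w, hxw, hew, ht, hQ⟩ := B.exists_decomposition v he x
  have ht0 : 0 < t := by
    rw [QuadraticMap.polar_comm, hx, polar_dualVec] at ht
    have := (trace_chiralProj_cliff_pos hn hσ hT ⟨by rw [IsTimelike, he]; exact one_pos, hpos⟩).1
    rw [← chiralTrace_apply, ← hf] at this
    linarith
  rw [IsTimelike, hQ]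
  by_cases hw : w = 0
  · simp only [hw, QuadraticMap.map_zero, add_zero]; positivity
  have hQw := hneg w hew hw
  set r := √(-B.Q v w) with hr
  have hr0 : 0 < r := Real.sqrt_pos.2 (by linarith)
  have hrsq : r ^ 2 = -B.Q v w := Real.sq_sqrt (by linarith)
  have hp := chiralTrace_null_pos hn hn2 hσ hT he hpos hneg hew hr0 (by linarith)
  rw [← hf, ← B.polar_dualVec v f, ← hx, hxw, QuadraticMap.polar_add_left,
    QuadraticMap.polar_smul_left, QuadraticMap.polar_add_right, QuadraticMap.polar_add_right,
    QuadraticMap.polar_smul_right, QuadraticMap.polar_smul_right, hew,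
    QuadraticMap.polar_comm _ w e, hew, QuadraticMap.polar_self, QuadraticMap.polar_self, he] at hp
  simp only [smul_eq_mul, mul_zero, add_zero, zero_add, nsmul_eq_mul, mul_one] at hp
  push_cast at hp
  nlinarith

/-- Were -x future-directed for the dual vector x, the functional would be positive on it, while its
value there is -2 Q(x) < 0. -/
theorem dualVec_future (hn : Even n) (hn2 : 2 < n) {σ : ℝ} (hσ : σ * σ = 1)
    {T : Module.End ℂ (S v)} (hT : B.IsPositiveOdd v T) :
    B.IsFutureTimelike (B.dualVec v (B.chiralTrace v σ T)) := by
  have h := dualVec_timelike hn hn2 hσ hT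
  refine (B.future_or_past v h).resolve_right fun hpast => ?_
  have h1 := (trace_chiralProj_cliff_pos hn hσ hT hpast).1
  rw [← chiralTrace_apply, map_neg, ← B.polar_dualVec v, QuadraticMap.polar_self] at h1
  rw [IsTimelike] at h
  simp at h1
  linarith

theorem IsFutureTimelike.smul {x : X v} (hx : B.IsFutureTimelike x) {r : ℝ} (hr : 0 < r) :
    B.IsFutureTimelike (r • x) := by
  refine ⟨?_, by rw [cliff_smul]; exact hx.2.smul hr⟩
  have : 0 < B.Q v x := hx.1
  rw [IsTimelike, QuadraticMap.map_smul, smul_eq_mul]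
  positivity

theorem IsFutureTimelike.inv_sqrt_smul {x : X v} (hx : B.IsFutureTimelike x) :
    B.IsFutureTimelike ((√(B.Q v x))⁻¹ • x) :=
  hx.smul (inv_pos.2 (Real.sqrt_pos.2 hx.1))

/-- The sum of the unit vectors representing the traces over the two chiralities. -/
def timeVec (B : DiscreteSpinorBundle G n X S) (v : V) (T : Module.End ℂ (S v)) : X v :=
  B.unitVec v (B.chiralTrace v 1 T) + B.unitVec v (B.chiralTrace v (-1) T)

theorem timeVec_future (hn : Even n) (hn2 : 2 < n)
    {T : Module.End ℂ (S v)} (hT : B.IsPositiveOdd v T) :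
    B.IsFutureTimelike (B.timeVec v T) := by
  have h1 := dualVec_future hn hn2 (σ := 1) (by norm_num) hT
  have h2 := dualVec_future hn hn2 (σ := -1) (by norm_num) hT
  have h1' := h1.inv_sqrt_smul
  have h2' := h2.inv_sqrt_smul
  refine ⟨?_, by rw [timeVec, cliff_add]; exact h1'.2.add h2'.2⟩
  -- Pairing with the first vector is a positive multiple of the trace functional, which is positive
  -- on the second.
  have hp : 0 < QuadraticMap.polar (B.Q v) (B.unitVec v (B.chiralTrace v 1 T))
      (B.unitVec v (B.chiralTrace v (-1) T)) := by
    have h := (trace_chiralProj_cliff_pos hn (σ := 1) (by norm_num) hT h2').1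
    rw [← chiralTrace_apply, ← B.polar_dualVec v] at h
    rw [unitVec, QuadraticMap.polar_smul_left]
    exact mul_pos (inv_pos.2 (Real.sqrt_pos.2 h1.1)) h
  rw [IsTimelike, timeVec, QuadraticMap.map_add (B.Q v)]
  exact add_pos (add_pos h1'.1 h2'.1) hp

/-- Operators `T`, `T'` inducing the same adjunction on even operators have the same vector. -/
theorem timeVec_eq (hn : Even n) {T T' : Module.End ℂ (S v)} (hT : B.IsPositiveOdd v T)
    (hT' : B.IsPositiveOdd v T')
    (h : ∀ A, B.χ v * A = A * B.χ v → ∃ A', A' * T = T * A ∧ A' * T' = T' * A) :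
    B.timeVec v T = B.timeVec v T' := by
  obtain ⟨e, he, hpos, -⟩ := B.exists_unit_future v
  have hfut : B.IsFutureTimelike e := ⟨by rw [IsTimelike, he]; exact one_pos, hpos⟩
  set U := B.cliff v e with hU
  have hUU : U * U = 1 := by rw [hU, cliff_mul_self, he]; simp
  have hχU : B.χ v * U = -(U * B.χ v) := B.χ_cliff v hn e
  obtain ⟨t, ht⟩ := hT.posDef.isUnit
  -- C = T⁻¹T' commutes with all even operators, because T and T' conjugate them identically.
  set C := (↑t⁻¹ : Module.End ℂ (S v)) * T' with hC
  have hTC : T' = T * C := by rw [hC, ← ht, ← mul_assoc, Units.mul_inv, one_mul]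
  have hTinj : ∀ {A A' : Module.End ℂ (S v)}, T * A = T * A' → A = A' := fun {A A'} h =>
    t.isUnit.mul_left_cancel (by rwa [ht])
  have hCA : ∀ A, B.χ v * A = A * B.χ v → C * A = A * C := fun A hA => by
    obtain ⟨A', h1, h2⟩ := h A hA
    apply hTinj
    rw [← mul_assoc, ← hTC, ← h2, hTC, ← mul_assoc, h1, mul_assoc]
  suffices hσ : ∀ σ : ℝ, σ * σ = 1 →
      ∃ r : ℝ, 0 < r ∧ B.chiralTrace v σ T' = r • B.chiralTrace v σ T by
    obtain ⟨r, hr, h1⟩ := hσ 1 (by norm_num)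
    obtain ⟨s, hs, h2⟩ := hσ (-1) (by norm_num)
    rw [timeVec, timeVec, h1, h2, unitVec_smul _ _ hr, unitVec_smul _ _ hs]
  intro σ hσ
  have hσ' : -σ * -σ = 1 := by linarith
  set P := B.chiralProj v (-σ) with hP
  have hPP : P * P = P := chiralProj_mul_self hn hσ'
  have hχP : B.χ v * P = P * B.χ v := χ_chiralProj
  have hCP : C * P = P * C := hCA P hχP
  have hUPU : P * (U * P) = 0 := by
    rw [← mul_assoc, chiralProj_mul_odd hχU, mul_assoc, neg_neg, chiralProj_mul_neg hn hσ, mul_zero]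
  -- Symmetrizing C P by U gives an operator commuting with U and with every even product U x, hence
  -- with all vectors. Schur makes it scalar, and restriction to the range of P gives C P = c P.
  obtain ⟨c, hc⟩ := B.exists_eq_smul_one v (C * P + U * (C * P) * U) fun x => by
    have hcomm : ∀ A, B.χ v * A = A * B.χ v → C * P * A = A * (C * P) := fun A hA => by
      rw [mul_assoc, chiralProj_mul_even hA, ← mul_assoc, hCA A hA, mul_assoc]
    have hD : U * (C * P + U * (C * P) * U) = (C * P + U * (C * P) * U) * U := by
      rw [mul_add, add_mul, ← mul_assoc U (U * (C * P)), ← mul_assoc U U, hUU, one_mul,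
        mul_assoc (U * (C * P)), hUU, mul_one, add_comm]
    have heven : ∀ y z, B.χ v * (B.cliff v y * B.cliff v z) =
        B.cliff v y * B.cliff v z * B.χ v := fun y z => by
      rw [← mul_assoc, B.χ_cliff v hn, neg_mul, mul_assoc, B.χ_cliff v hn, mul_neg, neg_neg,
        mul_assoc]
    have h1 : (C * P + U * (C * P) * U) * (U * B.cliff v x) =
        U * B.cliff v x * (C * P + U * (C * P) * U) := by
      rw [add_mul, mul_add, hcomm _ (heven e x)]
      congr 1
      rw [mul_assoc (U * (C * P)), ← mul_assoc U U, hUU, one_mul, mul_assoc U (C * P)]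
      have h2 := hcomm _ (heven x e)
      have h3 : C * P * B.cliff v x = C * P * (B.cliff v x * U) * U := by
        rw [mul_assoc (C * P), mul_assoc (B.cliff v x), hUU, mul_one]
      rw [h3, h2]
      simp only [mul_assoc, ← hU]
    have h4 : B.cliff v x = U * (U * B.cliff v x) := by rw [← mul_assoc, hUU, one_mul]
    rw [h4, ← mul_assoc, ← hD, mul_assoc, h1, ← mul_assoc]
  have hCPc : C * P = c • P := by
    have := congrArg (· * P) hc
    simp only [add_mul, smul_mul_assoc, one_mul] at this
    rw [mul_assoc C P P, hPP, mul_assoc (U * (C * P)), mul_assoc U, mul_assoc C, hUPU, mul_zero,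
      mul_zero, add_zero] at this
    exact this
  have htr : ∀ y, LinearMap.trace ℂ (S v) (B.chiralProj v σ * T' * B.cliff v y) =
      c * LinearMap.trace ℂ (S v) (B.chiralProj v σ * T * B.cliff v y) := fun y => by
    have : B.chiralProj v σ * T' = c • (B.chiralProj v σ * T) := by
      rw [hTC, ← mul_assoc, chiralProj_mul_odd hT.odd, ← hP, mul_assoc, ← hCP, hCPc, mul_smul_comm]
    rw [this, smul_mul_assoc, map_smul, smul_eq_mul]
  -- Comparing the two positive traces on e shows that c is real and positive.
  have h1 := trace_chiralProj_cliff_pos hn hσ hT hfut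
  have h2 := trace_chiralProj_cliff_pos hn hσ hT' hfut
  rw [htr, Complex.mul_re, Complex.mul_im, h1.2, mul_zero, sub_zero, mul_zero, zero_add] at h2
  have hcim : c.im = 0 := (mul_eq_zero.1 h2.2).resolve_right h1.1.ne'
  refine ⟨c.re, (pos_iff_pos_of_mul_pos h2.1).2 h1.1, LinearMap.ext fun y => ?_⟩
  rw [chiralTrace_apply, htr, Complex.mul_re, hcim, zero_mul, sub_zero]
  rfl

/-- Compatibility of `timeVec` with the charge conjugation. -/
theorem timeVec_of_J (hn : Even n) {T T' : Module.End ℂ (S v)}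
    (h : ∀ ψ, T (B.J v ψ) = -B.J v (T' ψ)) : B.timeVec v T = B.timeVec v T' := by
  have hJ : Function.Bijective (B.J v) := by
    have hε : B.ε ≠ 0 := by rcases B.ε_sign with h | h <;> simp [h]
    refine ⟨fun ψ φ hψ => ?_, fun φ => ⟨conj (B.ε⁻¹) • B.J v φ, ?_⟩⟩
    · have := congrArg (B.J v) hψ
      rw [B.J_sq, B.J_sq] at this
      exact smul_right_injective _ hε this
    · rw [LinearMap.map_smulₛₗ, B.J_sq, Complex.conj_conj, smul_smul, inv_mul_cancel₀ hε, one_smul]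
  -- The minus signs from T and from y cancel, and conjugating the trace does not change its real
  -- part. J keeps or exchanges the chiralities according to n/2, and the sum over σ does not see
  -- the difference.
  have htr : ∀ σ : ℝ, B.chiralTrace v σ T = B.chiralTrace v ((-1) ^ (n / 2 + 1) * σ) T' := by
    intro σ
    ext y
    rw [chiralTrace_apply, chiralTrace_apply, trace_eq_conj_of_antilinear (B.J v) hJ
      (C := B.chiralProj v ((-1) ^ (n / 2 + 1) * σ) * T' * B.cliff v y), Complex.conj_re]
    intro ψ
    simp only [Module.End.mul_apply]
    have h1 : B.cliff v y (B.J v ψ) = -B.J v (B.cliff v y ψ) := by rw [J_cliff, neg_neg]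
    rw [J_chiralProj hn, h1, map_neg, h, neg_neg]
  rw [timeVec, timeVec, htr, htr]
  rcases neg_one_pow_eq_or ℝ (n / 2 + 1) with h | h
  · rw [h]; simp
  · rw [h, add_comm]; simp

/-- An isomorphism of spinor fibres intertwining two vectors preserves their norm. -/
theorem Q_eq_of_intertwines {w : V} (h : S v ≃ₗ[ℂ] S w) {x : X v} {y : X w}
    (hxy : ∀ ψ, h (B.cliff v x ψ) = B.cliff w y (h ψ)) : B.Q w y = B.Q v x := by
  have hnt := B.nontrivial v
  obtain ⟨ψ, hψ⟩ := exists_ne (0 : S v)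
  have h1 : B.cliff w y (B.cliff w y (h ψ)) = (B.Q w y : ℂ) • h ψ :=
    LinearMap.congr_fun (B.cliff_mul_self w y) (h ψ)
  have h2 : B.cliff v x (B.cliff v x ψ) = (B.Q v x : ℂ) • ψ :=
    LinearMap.congr_fun (B.cliff_mul_self v x) ψ
  rw [← hxy, ← hxy, h2, map_smul] at h1
  have := smul_left_injective ℂ ((map_ne_zero_iff h h.injective).2 hψ) h1
  exact_mod_cast this.symm

theorem surjective_of_intertwines {w : V} (h : S v ≃ₗ[ℂ] S w) {Λ : X v →ₗ[ℝ] X w}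
    (hΛ : ∀ x ψ, h (B.cliff v x ψ) = B.cliff w (Λ x) (h ψ)) : Function.Surjective Λ := by
  have := B.finiteDimensional_vectors v
  have := B.finiteDimensional_vectors w
  refine (LinearMap.injective_iff_surjective_of_finrank_eq_finrank
    ((B.finrank_eq v).trans (B.finrank_eq w).symm)).1 fun x y hxy => ?_
  refine B.cliff_injective v (LinearMap.ext fun ψ => h.injective ?_)
  rw [hΛ, hΛ, hxy]

/-- Compatibility of `timeVec` with isomorphisms of spinor fibres. -/
theorem timeVec_transport {w : V} (h : S v ≃ₗ[ℂ] S w) (Λ : X v →ₗ[ℝ] X w)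
    (hΛ : ∀ x ψ, h (B.cliff v x ψ) = B.cliff w (Λ x) (h ψ))
    (hχ : ∀ ψ, B.χ w (h ψ) = h (B.χ v ψ)) (T : Module.End ℂ (S v)) :
    B.timeVec w (h.conj T) = Λ (B.timeVec v T) := by
  have hQ : ∀ x, B.Q w (Λ x) = B.Q v x := fun x => Q_eq_of_intertwines h (hΛ x)
  have hpol : ∀ x y, QuadraticMap.polar (B.Q w) (Λ x) (Λ y) = QuadraticMap.polar (B.Q v) x y :=
    fun x y => by simp only [QuadraticMap.polar, ← map_add, hQ]
  have hsurj := surjective_of_intertwines h hΛ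
  -- The trace is invariant under conjugation and Λ is a surjective isometry, so it carries dual
  -- vectors to dual vectors.
  have hunit : ∀ σ, B.unitVec w (B.chiralTrace w σ (h.conj T)) =
      Λ (B.unitVec v (B.chiralTrace v σ T)) := by
    intro σ
    have htr : ∀ y, B.chiralTrace w σ (h.conj T) (Λ y) = B.chiralTrace v σ T y := fun y => by
      rw [chiralTrace_apply, chiralTrace_apply, ← LinearMap.trace_conj' _ h]
      congr 2
      ext ψ
      obtain ⟨φ, rfl⟩ := h.surjective ψ
      simp [LinearEquiv.conj_apply, chiralProj, ← hΛ, hχ, -Complex.coe_smul]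
    have hd : Λ (B.dualVec v (B.chiralTrace v σ T)) =
        B.dualVec w (B.chiralTrace w σ (h.conj T)) := by
      refine B.eq_dualVec w fun y => ?_
      obtain ⟨y, rfl⟩ := hsurj y
      rw [hpol, polar_dualVec, htr]
    rw [unitVec, ← hd, hQ, unitVec, map_smul]
  rw [timeVec, hunit, hunit, timeVec, map_add]

end DiscreteSpinorBundle

/-! ## Even and odd operators -/

namespace DiscreteSpinorBundle

variable {V E : Type*} {G : WeightedOrientedGraph V E} {n : ℕ} {X S : V → Type*}
  [∀ v, AddCommGroup (X v)] [∀ v, Module ℝ (X v)]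
  [∀ v, AddCommGroup (S v)] [∀ v, Module ℂ (S v)] [∀ v, FiniteDimensional ℂ (S v)]
  (B : DiscreteSpinorBundle G n X S) (v : V)

/-- In dimension two, even operators commute. -/
theorem commute_of_eq_two (hn : n = 2) {A A' : Module.End ℂ (S v)}
    (hA : B.χ v * A = A * B.χ v) (hA' : B.χ v * A' = A' * B.χ v) : A * A' = A' * A := by
  have hev : Even n := by rw [hn]; exact even_two
  obtain ⟨a, rfl⟩ := B.exists_even_of_commute_χ v hev hA
  suffices h : ∀ a ∈ CCl.even (B.Q v), B.ρ v a ∈ Algebra.adjoin ℂ {B.χ v} from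
    (Algebra.commute_of_mem_adjoin_singleton_of_commute (h a a.2) hA'.symm).symm
  intro a ha
  have hmul : ∀ x y, B.cliff v x * B.cliff v y ∈ Algebra.adjoin ℂ {B.χ v} := by
    subst hn
    obtain ⟨b, hb, hχ⟩ := B.exists_frame v
    have h01 : B.cliff v (b 0) * B.cliff v (b 1) ∈ Algebra.adjoin ℂ {B.χ v} := by
      -- For n = 2 the prefactor of χ is I² = -1.
      have : B.cliff v (b 0) * B.cliff v (b 1) = -B.χ v := by
        rw [hχ]
        simp [List.finRange_succ]
      rw [this]
      exact neg_mem (Algebra.self_mem_adjoin_singleton ℂ _)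
    have hii : ∀ i, B.cliff v (b i) * B.cliff v (b i) ∈ Algebra.adjoin ℂ {B.χ v} := fun i => by
      rw [cliff_mul_self]
      exact Subalgebra.smul_mem _ (one_mem _) _
    have hbb : ∀ i j, B.cliff v (b i) * B.cliff v (b j) ∈ Algebra.adjoin ℂ {B.χ v} := by
      intro i j
      fin_cases i <;> fin_cases j
      · exact hii 0
      · exact h01
      · have := B.cliff_anticomm v (hb.2 1 0 (by simp))
        change B.cliff v (b 1) * B.cliff v (b 0) ∈ _
        rw [this]
        exact neg_mem h01
      · exact hii 1
    have hrepr : ∀ x, B.cliff v x = ∑ i, (b.repr x i : ℂ) • B.cliff v (b i) := fun x => by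
      conv_lhs => rw [← b.sum_repr x]
      simp only [Fin.sum_univ_two, cliff_add, cliff_smul]
    intro x y
    rw [hrepr x, hrepr y, Finset.sum_mul_sum]
    refine sum_mem fun i _ => sum_mem fun j _ => ?_
    rw [smul_mul_smul_comm]
    exact Subalgebra.smul_mem _ (hbb i j) _
  refine CCl.even_induction (P := fun a => B.ρ v a ∈ Algebra.adjoin ℂ {B.χ v}) ?_
    (fun z a h => ?_) (fun a a' h h' => ?_) (fun x y a h => ?_) ha
  · rw [map_one]; exact one_mem _
  · rw [map_smul]; exact Subalgebra.smul_mem _ h z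
  · rw [map_add]; exact add_mem h h'
  · rw [map_mul, map_mul]; exact mul_mem (hmul x y) h

variable {B v}

theorem χ_mul_chiralProj (hn : Even n) {σ : ℝ} (hσ : σ * σ = 1) :
    B.χ v * B.chiralProj v σ = (σ : ℂ) • B.chiralProj v σ := by
  have h : (σ : ℂ) * σ = 1 := by exact_mod_cast hσ
  rw [chiralProj, mul_smul_comm, mul_add, mul_smul_comm, B.χ_sq v hn, mul_one,
    smul_comm (σ : ℂ) (2⁻¹ : ℂ), smul_add (σ : ℂ), smul_smul (σ : ℂ) σ, h, one_smul, add_comm]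

theorem chiralProj_apply_of_eigen {σ : ℝ} (hσ : σ * σ = 1) {ψ : S v}
    (hψ : B.χ v ψ = (σ : ℂ) • ψ) : B.chiralProj v σ ψ = ψ := by
  have h : (σ : ℂ) * σ = 1 := by exact_mod_cast hσ
  simp only [chiralProj, LinearMap.smul_apply, LinearMap.add_apply, Module.End.one_apply, hψ,
    smul_smul, h]
  module

theorem χ_commute_rankOne (hn : Even n) {σ : ℝ} (hσ : σ * σ = 1) (l : Module.Dual ℂ (S v)) {φ : S v}
    (hφ : B.χ v φ = (σ : ℂ) • φ) :
    B.χ v * ((l.comp (B.chiralProj v σ)).smulRight φ) =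
      ((l.comp (B.chiralProj v σ)).smulRight φ) * B.χ v := by
  ext x
  have h : B.chiralProj v σ (B.χ v x) = (σ : ℂ) • B.chiralProj v σ x := by
    have := LinearMap.congr_fun (χ_mul_chiralProj (B := B) (v := v) hn hσ) x
    rw [χ_chiralProj] at this
    exact this
  simp only [Module.End.mul_apply, LinearMap.smulRight_apply, LinearMap.comp_apply, map_smul, hφ,
    h, smul_eq_mul, smul_smul, mul_comm]

/-- Decompose T P_σ into rank-one pieces. The operator C_i sends x to the i-th coordinate of P_σ x
times ψ, and A_i sends γψ to T P_σ b_i. Both preserve chirality, since γ and T both flip it. -/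
theorem odd_mul_chiralProj_mem_span (hn : Even n) {σ : ℝ} (hσ : σ * σ = 1)
    {γ T : Module.End ℂ (S v)} (hγ : B.χ v * γ = -(γ * B.χ v)) (hT : B.χ v * T = -(T * B.χ v))
    {ψ : S v} (hψ : B.χ v ψ = (σ : ℂ) • ψ) (hγψ : γ ψ ≠ 0) :
    T * B.chiralProj v σ ∈ Submodule.span ℂ {T' | ∃ A C, B.χ v * A = A * B.χ v ∧
      B.χ v * C = C * B.χ v ∧ T' = A * γ * C} := by
  have hσ' : -σ * -σ = 1 := by linarith
  obtain ⟨l, hl⟩ : ∃ l : Module.Dual ℂ (S v), l (γ ψ) ≠ 0 := by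
    by_contra! h
    exact hγψ ((Module.forall_dual_apply_eq_zero_iff ℂ _).1 h)
  let b := Module.finBasis ℂ (S v)
  have hneg : ∀ {T : Module.End ℂ (S v)}, B.χ v * T = -(T * B.χ v) → ∀ φ,
      B.χ v φ = (σ : ℂ) • φ → B.χ v (T φ) = ((-σ : ℝ) : ℂ) • T φ := fun {T} hT φ hφ => by
    have : B.χ v (T φ) = -T (B.χ v φ) := LinearMap.congr_fun hT φ
    rw [this, hφ, map_smul, Complex.ofReal_neg, neg_smul]
  have hPb : ∀ φ, B.χ v (B.chiralProj v σ φ) = (σ : ℂ) • B.chiralProj v σ φ := fun φ =>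
    LinearMap.congr_fun (χ_mul_chiralProj (B := B) (v := v) hn hσ) φ
  have hPγ : B.chiralProj v (-σ) (γ ψ) = γ ψ := chiralProj_apply_of_eigen hσ' (hneg hγ ψ hψ)
  let C := fun i => ((b.coord i).comp (B.chiralProj v σ)).smulRight ψ
  let A := fun i => (((l (γ ψ))⁻¹ • l).comp (B.chiralProj v (-σ))).smulRight
    (T (B.chiralProj v σ (b i)))
  have hsum : T * B.chiralProj v σ = ∑ i, A i * γ * C i := by
    ext x
    have h1 : ∀ i, (A i * γ * C i) x =
        b.repr (B.chiralProj v σ x) i • T (B.chiralProj v σ (b i)) := fun i => by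
      simp only [A, C, Module.End.mul_apply, LinearMap.smulRight_apply, LinearMap.comp_apply,
        map_smul, hPγ, LinearMap.smul_apply, smul_eq_mul, inv_mul_cancel₀ hl, one_smul,
        Module.Basis.coord_apply]
    rw [LinearMap.sum_apply, Finset.sum_congr rfl fun i _ => h1 i]
    simp only [← map_smul, ← map_sum]
    rw [b.sum_repr, ← Module.End.mul_apply (B.chiralProj v σ), chiralProj_mul_self hn hσ]
    rfl
  rw [hsum]
  exact sum_mem fun i _ => Submodule.subset_span ⟨A i, C i,
    χ_commute_rankOne hn hσ' _ (hneg hT _ (hPb _)), χ_commute_rankOne hn hσ _ hψ, rfl⟩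

/-- An odd operator not vanishing on either chirality generates all odd operators under
multiplication by even operators. -/
theorem odd_mem_span (hn : Even n) {γ T : Module.End ℂ (S v)} (hγ : B.χ v * γ = -(γ * B.χ v))
    (hT : B.χ v * T = -(T * B.χ v)) (hl : ∃ ψ, B.χ v ψ = -ψ ∧ γ ψ ≠ 0)
    (hr : ∃ ψ, B.χ v ψ = ψ ∧ γ ψ ≠ 0) :
    T ∈ Submodule.span ℂ {T' | ∃ A C, B.χ v * A = A * B.χ v ∧
      B.χ v * C = C * B.χ v ∧ T' = A * γ * C} := by
  obtain ⟨ψ, hψ, hψ0⟩ := hl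
  obtain ⟨φ, hφ, hφ0⟩ := hr
  have h := chiralProj_add_neg (B := B) (v := v) (σ := 1)
  rw [← mul_one T, ← h, mul_add]
  exact add_mem
    (odd_mul_chiralProj_mem_span hn (by norm_num) hγ hT (by rw [hφ]; simp) hφ0)
    (odd_mul_chiralProj_mem_span hn (by norm_num) hγ hT (by rw [hψ]; simp) hψ0)

end DiscreteSpinorBundle

/-! ## The split Dirac structure as a spectral spacetime -/

namespace DiscreteSpinorBundle

variable {V E : Type*} {G : WeightedOrientedGraph V E} {n : ℕ} {X S : V → Type*}
  [∀ v, AddCommGroup (X v)] [∀ v, Module ℝ (X v)]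
  [∀ v, AddCommGroup (S v)] [∀ v, Module ℂ (S v)] [∀ v, FiniteDimensional ℂ (S v)]
  (B : DiscreteSpinorBundle G n X S)

/-- Transport of the value at one end of each edge to the other end. -/
def swap : Module.End ℂ B.Sections where
  toFun F p := B.hpm p.1 p.2 (F (p.1, !p.2))
  map_add' F F' := by ext p; simp
  map_smul' c F := by ext p; simp

theorem swap_apply (F : B.Sections) (p : E × Bool) :
    B.swap F p = B.hpm p.1 p.2 (F (p.1, !p.2)) := rfl

theorem swap_true (F : B.Sections) (e : E) : B.swap F (e, true) = B.h e (F (e, false)) := rfl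

theorem swap_false (F : B.Sections) (e : E) : B.swap F (e, false) = (B.h e).symm (F (e, true)) :=
  rfl

@[simp]
theorem swap_swap (F : B.Sections) : B.swap (B.swap F) = F := by
  ext ⟨e, b⟩
  cases b
  · rw [swap_false, swap_true]; exact (B.h e).symm_apply_apply _
  · rw [swap_true, swap_false]; exact (B.h e).apply_symm_apply _

/-- The operator `F(e,±) ↦ T_e^± h_e^± F(e,∓)`. -/
def offDiag (T : ∀ p : E × Bool, Module.End ℂ (S (G.endpt p.1 p.2))) :
    Module.End ℂ B.Sections where
  toFun F p := T p (B.swap F p)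
  map_add' F F' := by ext p; simp
  map_smul' c F := by ext p; simp

theorem offDiag_apply (T : ∀ p : E × Bool, Module.End ℂ (S (G.endpt p.1 p.2))) (F : B.Sections)
    (p : E × Bool) : B.offDiag T F p = T p (B.swap F p) := rfl

theorem splitRep_apply (a : B.EvenSections) (F : B.Sections) (p : E × Bool) :
    B.splitRep a F p = B.ρ _ (a (G.endpt p.1 p.2) : CCl (B.Q _)) (F p) := rfl

theorem splitChirality_apply (F : B.Sections) (p : E × Bool) :
    B.splitChirality F p = B.χ _ (F p) := rfl

theorem splitDirac_eq : B.splitDirac =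
    B.offDiag fun p => ((if p.2 then -1 else 1) / (G.weight p.1 : ℂ)) • B.γ p.1 p.2 := rfl

theorem splitKrein_eq [Fintype E] (F F' : B.Sections) :
    B.splitKrein F F' = ∑ p : E × Bool, B.krein _ (F p) (B.swap F' p) := by
  rw [Fintype.sum_prod_type]
  simp only [Fintype.sum_bool]
  rfl

variable {B}

theorem IsMetric.sum_swap [Fintype E] (hB : B.IsMetric) (F F' : B.Sections) :
    ∑ p : E × Bool, B.krein _ (B.swap F p) (B.swap F' p) =
      ∑ p : E × Bool, B.krein _ (F p) (F' p) := by
  simp only [Fintype.sum_prod_type, Fintype.sum_bool]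
  refine Finset.sum_congr rfl fun e _ => ?_
  have h (x y : S (G.tgt e)) : B.krein (G.src e) ((B.h e).symm x) ((B.h e).symm y) =
      B.krein (G.tgt e) x y := by
    rw [← hB e, LinearEquiv.apply_symm_apply, LinearEquiv.apply_symm_apply]
  rw [swap_true, swap_true, swap_false, swap_false]
  exact (congrArg₂ (· + ·) (hB e (F (e, false)) (F' (e, false)))
    (h (F (e, true)) (F' (e, true)))).trans (add_comm _ _)

/-- An isometric involution is self-adjoint; hermiticity of the split product rests on this. -/
theorem IsMetric.sum_swap_left [Fintype E] (hB : B.IsMetric) (F F' : B.Sections) :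
    ∑ p : E × Bool, B.krein _ (B.swap F p) (F' p) =
      ∑ p : E × Bool, B.krein _ (F p) (B.swap F' p) := by
  simpa using hB.sum_swap F (B.swap F')

theorem IsSpectral.χ_hpm (hB : B.IsSpectral) (e : E) (b : Bool) (ψ : S (G.endpt e (!b))) :
    B.χ (G.endpt e b) (B.hpm e b ψ) = B.hpm e b (B.χ (G.endpt e (!b)) ψ) := by
  cases b
  · have h (φ : S (G.tgt e)) : B.χ (G.src e) ((B.h e).symm φ) = (B.h e).symm (B.χ (G.tgt e) φ) := by
      rw [LinearEquiv.eq_symm_apply, ← hB.preservesOrientation, LinearEquiv.apply_symm_apply]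
    exact h ψ
  · exact hB.preservesOrientation e ψ

theorem IsSpectral.J_hpm (hB : B.IsSpectral) (e : E) (b : Bool) (ψ : S (G.endpt e (!b))) :
    B.J (G.endpt e b) (B.hpm e b ψ) = B.hpm e b (B.J (G.endpt e (!b)) ψ) := by
  cases b
  · have h (φ : S (G.tgt e)) : B.J (G.src e) ((B.h e).symm φ) = (B.h e).symm (B.J (G.tgt e) φ) := by
      rw [LinearEquiv.eq_symm_apply, hB.spinPreserving, LinearEquiv.apply_symm_apply]
    exact h ψ
  · exact (hB.spinPreserving e ψ).symm

theorem IsSpectral.splitJ_apply (hB : B.IsSpectral) (F : B.Sections) (p : E × Bool) :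
    B.splitJ F p = B.J _ (B.swap F p) := (hB.J_hpm p.1 p.2 _).symm

theorem swap_splitJ (F : B.Sections) (p : E × Bool) :
    B.swap (B.splitJ F) p = B.J _ (F p) := by
  have h : B.splitJ F = B.swap fun p => B.J _ (F p) := rfl
  rw [h, swap_swap]

theorem isKreinProduct_splitKrein [Fintype E] (hB : B.IsMetric) : IsKreinProduct B.splitKrein where
  hermitian F F' := by
    rw [splitKrein_eq, splitKrein_eq, ← hB.sum_swap_left, map_sum]
    exact Finset.sum_congr rfl fun p _ => (B.isKrein _).hermitian _ _
  nondegenerate F' h := by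
    classical
    rw [← B.swap_swap F']
    have : B.swap F' = 0 := by
      ext p
      refine (B.isKrein _).nondegenerate _ fun ψ => ?_
      have := h (Pi.single p ψ)
      rw [splitKrein_eq, Finset.sum_eq_single p] at this
      · simpa using this
      · intro q _ hq
        rw [Pi.single_eq_of_ne hq]; simp
      · simp
    rw [this, map_zero]

theorem splitKrein_offDiag_left [Fintype E]
    (T : ∀ p : E × Bool, Module.End ℂ (S (G.endpt p.1 p.2))) (F F' : B.Sections) :
    B.splitKrein (B.offDiag T F) F' =
      ∑ p : E × Bool, B.krein _ (T p (B.swap F p)) (B.swap F' p) := B.splitKrein_eq _ _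

theorem splitKrein_offDiag_right [Fintype E] (hB : B.IsMetric)
    (T : ∀ p : E × Bool, Module.End ℂ (S (G.endpt p.1 p.2))) (F F' : B.Sections) :
    B.splitKrein F (B.offDiag T F') =
      ∑ p : E × Bool, B.krein _ (B.swap F p) (T p (B.swap F' p)) := by
  rw [splitKrein_eq, ← hB.sum_swap_left]
  rfl

theorem offDiag_selfAdjoint [Fintype E] (hB : B.IsMetric)
    {T : ∀ p : E × Bool, Module.End ℂ (S (G.endpt p.1 p.2))}
    (hT : ∀ p, IsAdjointFor (fun ψ φ => B.krein _ ψ φ) (T p) (T p)) :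
    IsAdjointFor (fun F F' => B.splitKrein F F') (B.offDiag T) (B.offDiag T) := fun F F' => by
  change B.splitKrein (B.offDiag T F) F' = B.splitKrein F (B.offDiag T F')
  rw [splitKrein_offDiag_left, splitKrein_offDiag_right hB]
  exact Finset.sum_congr rfl fun p _ => hT p _ _

/-- Commutation, up to the sign `s`, of an off-diagonal operator with the charge conjugation. -/
theorem IsSpectral.splitJ_offDiag (hB : B.IsSpectral) {s : ℂ}
    {T : ∀ p : E × Bool, Module.End ℂ (S (G.endpt p.1 p.2))}
    (h₁ : ∀ e ψ, B.J (G.tgt e) (B.h e (T (e, false) ((B.h e).symm ψ))) =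
      s • T (e, true) (B.J (G.tgt e) ψ))
    (h₂ : ∀ e ψ, B.J (G.tgt e) (T (e, true) ψ) =
      s • B.h e (T (e, false) ((B.h e).symm (B.J (G.tgt e) ψ)))) (F : B.Sections) :
    B.splitJ (B.offDiag T F) = s • B.offDiag T (B.splitJ F) := by
  ext ⟨e, b⟩
  rw [hB.splitJ_apply, Pi.smul_apply, offDiag_apply, swap_splitJ]
  cases b
  · have h (T₁ : Module.End ℂ (S (G.tgt e))) (T₀ : Module.End ℂ (S (G.src e))) (ψ : S (G.src e))
        (hT : ∀ ψ, B.J (G.tgt e) (T₁ ψ) =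
          s • B.h e (T₀ ((B.h e).symm (B.J (G.tgt e) ψ)))) :
        B.J (G.src e) ((B.h e).symm (T₁ (B.h e ψ))) = s • T₀ (B.J (G.src e) ψ) := by
      apply (B.h e).injective
      rw [hB.spinPreserving, LinearEquiv.apply_symm_apply, hT, map_smul, ← hB.spinPreserving,
        LinearEquiv.symm_apply_apply]
    exact h (T (e, true)) (T (e, false)) (F (e, false)) (h₂ e)
  · exact h₁ e (F (e, true))

/-- Moves J to the other side of an intertwining relation, using that J² is a nonzero real scalar.
-/
theorem J_conj_real {v : V} {T T' : Module.End ℂ (S v)} {s : ℂ}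
    (h : ∀ ψ, T (B.J v ψ) = s • B.J v (T' ψ)) (ψ : S v) : B.J v (T ψ) = conj s • T' (B.J v ψ) := by
  have hε : B.ε ≠ 0 := by rcases B.ε_sign with h | h <;> simp [h]
  have hε' : conj B.ε = B.ε := by rcases B.ε_sign with h | h <;> simp [h]
  have h1 := congrArg (B.J v) (h (B.J v ψ))
  rw [B.J_sq, map_smul, LinearMap.map_smulₛₗ, LinearMap.map_smulₛₗ, hε', B.J_sq, smul_comm] at h1
  exact smul_right_injective _ hε h1

/-! ### The Krein adjoint of the split charge conjugation. -/

section Spacetime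

/-- Fibrewise, J J^× = -1 and J² = ε = ±1 force J^× = -ε J, and the same formula works for the split
operator. -/
theorem splitKrein_splitJ [Fintype E] (hB : B.IsSpectral) :
    ∃ J' : B.Sections →ₗ⋆[ℂ] B.Sections,
      (∀ F F', B.splitKrein (B.splitJ F) F' = conj (B.splitKrein F (J' F'))) ∧
        ∀ F, J' (B.splitJ F) = (-1 : ℂ) • F := by
  have hε' : B.ε * B.ε = 1 := by rcases B.ε_sign with h | h <;> simp [h]
  refine ⟨(-B.ε) • B.splitJ, fun F F' => ?_, fun F => ?_⟩
  · rw [splitKrein_eq, splitKrein_eq, map_sum]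
    have hJ : ∀ v ψ φ, B.krein v (B.J v ψ) φ = conj (B.krein v ψ ((-B.ε) • B.J v φ)) := by
      intro v ψ φ
      obtain ⟨J', h1, h2⟩ := B.J_adjoint v
      rw [h1]
      congr 2
      have h3 := congrArg (B.J v) (h2 φ)
      rw [B.J_sq, map_neg] at h3
      have h4 := congrArg (B.ε • ·) h3
      simp only [smul_smul, hε', one_smul] at h4
      rw [h4, smul_neg, neg_smul]
    have hs : ∀ p, B.swap (((-B.ε) • B.splitJ) F') p = (-B.ε) • B.J _ (F' p) := fun p => by
      rw [LinearMap.smul_apply, map_smul, Pi.smul_apply, swap_splitJ]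
    simp only [hs, ← hJ]
    exact hB.metric.sum_swap (fun p => B.J _ (F p)) F'
  · ext p
    rw [LinearMap.smul_apply, Pi.smul_apply, hB.splitJ_apply, swap_splitJ, B.J_sq, smul_smul,
      neg_mul, hε']
    rfl

end Spacetime

end DiscreteSpinorBundle

namespace DiscreteSpinorBundle

variable {V E : Type*} {G : WeightedOrientedGraph V E} {n : ℕ} {X S : V → Type*}
  [∀ v, AddCommGroup (X v)] [∀ v, Module ℝ (X v)]
  [∀ v, AddCommGroup (S v)] [∀ v, Module ℂ (S v)] [∀ v, FiniteDimensional ℂ (S v)]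
  {B : DiscreteSpinorBundle G n X S}

/-! ### One-forms -/

/-- The commutator compares b at the end of a half-edge with its transport from the opposite end, as
a discrete derivative. -/
theorem splitRep_mul_commutator (a b : B.EvenSections) :
    B.splitRep a * (B.splitDirac * B.splitRep b - B.splitRep b * B.splitDirac) =
      B.offDiag fun p => ((if p.2 then -1 else 1) / (G.weight p.1 : ℂ)) •
        (B.ρ _ (a (G.endpt p.1 p.2) : CCl (B.Q _)) *
          (B.γ p.1 p.2 * (B.hpm p.1 p.2).conj (B.ρ _ (b (G.endpt p.1 (!p.2)) : CCl (B.Q _))) -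
            B.ρ _ (b (G.endpt p.1 p.2) : CCl (B.Q _)) * B.γ p.1 p.2)) := by
  refine LinearMap.ext fun F => funext fun p => ?_
  have h : (B.hpm p.1 p.2).conj (B.ρ _ (b (G.endpt p.1 (!p.2)) : CCl (B.Q _))) (B.swap F p) =
      B.swap (B.splitRep b F) p := by
    rw [swap_apply, LinearEquiv.conj_apply_apply, LinearEquiv.symm_apply_apply]
    rfl
  change B.ρ _ (a (G.endpt p.1 p.2) : CCl (B.Q _)) 
      (B.splitDirac (B.splitRep b F) p - B.splitRep b (B.splitDirac F) p) =
    ((if p.2 then -1 else 1) / (G.weight p.1 : ℂ)) •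
      B.ρ _ (a (G.endpt p.1 p.2) : CCl (B.Q _)) (B.γ p.1 p.2
      ((B.hpm p.1 p.2).conj (B.ρ _ (b (G.endpt p.1 (!p.2)) : CCl (B.Q _))) (B.swap F p)) -
        B.ρ _ (b (G.endpt p.1 p.2) : CCl (B.Q _)) (B.γ p.1 p.2 (B.swap F p)))
  rw [h, splitRep_apply B b, splitDirac_eq, offDiag_apply, offDiag_apply, LinearMap.smul_apply,
    LinearMap.smul_apply, map_smul, ← smul_sub, map_smul]

/-- Each component is a combination of products of one odd γ with even operators; transported ones
stay even because h commutes with χ. -/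
theorem exists_offDiag_of_mem_oneForms [Fintype E] (hn : Even n) (hB : B.IsSpectral)
    {β : Module.End ℂ B.Sections} (hβ : β ∈ B.splitDiracStructure.oneForms) :
    ∃ T : ∀ p : E × Bool, Module.End ℂ (S (G.endpt p.1 p.2)),
      (∀ p, B.χ _ * T p = -(T p * B.χ _)) ∧ β = B.offDiag T := by
  unfold SpectralData.oneForms at hβ
  induction hβ using Submodule.span_induction with
  | mem β h =>
    obtain ⟨a, b, rfl⟩ := h
    refine ⟨_, fun p => ?_, splitRep_mul_commutator a b⟩
    have hconj : B.χ _ * (B.hpm p.1 p.2).conj (B.ρ _ (b (G.endpt p.1 (!p.2)) : CCl (B.Q _))) =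
        (B.hpm p.1 p.2).conj (B.ρ _ (b (G.endpt p.1 (!p.2)) : CCl (B.Q _))) * B.χ _ := by
      ext ψ
      obtain ⟨φ, rfl⟩ := (B.hpm p.1 p.2).surjective ψ
      rw [Module.End.mul_apply, Module.End.mul_apply, hB.χ_hpm, LinearEquiv.conj_apply_apply,
        LinearEquiv.conj_apply_apply, LinearEquiv.symm_apply_apply, LinearEquiv.symm_apply_apply,
        hB.χ_hpm]
      exact congrArg _ (LinearMap.congr_fun (B.χ_ρ_of_mem_even _ hn (b (G.endpt p.1 (!p.2))).2) φ)
    have ha := B.χ_ρ_of_mem_even _ hn (a (G.endpt p.1 p.2)).2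
    have hb := B.χ_ρ_of_mem_even _ hn (b (G.endpt p.1 p.2)).2
    have hγ := hB.γ_odd p.1 p.2
    rw [mul_smul_comm, smul_mul_assoc, ← smul_neg]
    congr 1
    rw [← mul_assoc, ha, mul_assoc, mul_sub, ← mul_assoc (B.χ _), hγ, neg_mul, mul_assoc, hconj,
      ← mul_assoc (B.χ _), hb, mul_assoc _ (B.χ _), hγ]
    simp only [mul_assoc, sub_mul, mul_sub, mul_neg]
    abel
  | zero => exact ⟨0, fun p => by simp, by ext F p; rfl⟩
  | add β β' _ _ h h' =>
    obtain ⟨T, hT, rfl⟩ := h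
    obtain ⟨T', hT', rfl⟩ := h'
    exact ⟨T + T', fun p => by rw [Pi.add_apply, mul_add, hT, hT', add_mul, neg_add], rfl⟩
  | smul c β _ h =>
    obtain ⟨T, hT, rfl⟩ := h
    exact ⟨c • T, fun p => by rw [Pi.smul_apply, mul_smul_comm, hT, smul_mul_assoc, smul_neg], rfl⟩

theorem endpt_ne (e : E) (b : Bool) : G.endpt e b ≠ G.endpt e (!b) := by
  cases b
  · exact G.loopless e
  · exact (G.loopless e).symm

/-- Simplicity and looplessness of the graph enter here, allowing sections over vertices to isolate
one half-edge. -/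
theorem eq_of_endpt_eq {p q : E × Bool} (h₁ : G.endpt p.1 p.2 = G.endpt q.1 q.2)
    (h₂ : G.endpt p.1 (!p.2) = G.endpt q.1 (!q.2)) : p = q := by
  have key : ∀ p : E × Bool, s(G.src p.1, G.tgt p.1) = s(G.endpt p.1 p.2, G.endpt p.1 (!p.2)) := by
    rintro ⟨e, _ | _⟩
    · rfl
    · exact Sym2.eq_swap
  have he : p.1 = q.1 := G.simple (by
    change s(G.src p.1, G.tgt p.1) = s(G.src q.1, G.tgt q.1)
    rw [key p, key q, h₁, h₂])
  obtain ⟨e, b⟩ := p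
  obtain ⟨e', b'⟩ := q
  obtain rfl : e = e' := he
  refine Prod.ext rfl ?_
  by_contra hb
  have : b' = !b := by revert hb; cases b <;> cases b' <;> simp
  subst this
  exact endpt_ne e b h₁

theorem offDiag_mem_oneForms [Fintype E] (hn : Even n) (hB : B.IsSpectral)
    {T : ∀ p : E × Bool, Module.End ℂ (S (G.endpt p.1 p.2))}
    (hT : ∀ p, B.χ _ * T p = -(T p * B.χ _)) :
    B.offDiag T ∈ B.splitDiracStructure.oneForms := by
  classical
  have hsum : B.offDiag T = ∑ p, B.offDiag (Pi.single p (T p)) := by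
    refine LinearMap.ext fun F => funext fun q => ?_
    rw [LinearMap.sum_apply, Finset.sum_apply, Finset.sum_eq_single q]
    · rw [offDiag_apply, offDiag_apply, Pi.single_eq_same]
    · intro p _ hpq
      rw [offDiag_apply, Pi.single_eq_of_ne (Ne.symm hpq)]; rfl
    · simp
  rw [hsum]
  refine sum_mem fun p _ => ?_
  have hspan := odd_mem_span hn (hB.γ_odd p.1 p.2) (hT p) (hB.γ_left p.1 p.2) (hB.γ_right p.1 p.2)
  generalize T p = T₀ at hspan ⊢
  induction hspan using Submodule.span_induction with
  | zero =>
    rw [Pi.single_zero]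
    have : B.offDiag 0 = 0 := by ext F q; rfl
    rw [this]; exact zero_mem _
  | add T₁ T₂ _ _ h₁ h₂ =>
    rw [Pi.single_add]
    exact add_mem h₁ h₂
  | smul c T₁ _ h₁ =>
    rw [Pi.single_smul]
    exact Submodule.smul_mem _ c h₁
  | mem T₁ h₁ =>
    obtain ⟨A, C, hA, hC, rfl⟩ := h₁
    set z : ℂ := (if p.2 then -1 else 1) / (G.weight p.1 : ℂ) with hz
    have hz0 : z ≠ 0 := by
      have : (G.weight p.1 : ℂ) ≠ 0 := by exact_mod_cast (G.weight_pos p.1).ne'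
      refine div_ne_zero ?_ this
      split_ifs <;> simp
    have hC' : B.χ _ * (B.hpm p.1 p.2).symm.conj C = (B.hpm p.1 p.2).symm.conj C * B.χ _ := by
      ext ψ
      apply (B.hpm p.1 p.2).injective
      rw [Module.End.mul_apply, Module.End.mul_apply, LinearEquiv.conj_apply_apply,
        LinearEquiv.conj_apply_apply, ← hB.χ_hpm, LinearEquiv.apply_symm_apply,
        LinearEquiv.apply_symm_apply, LinearEquiv.symm_symm, ← hB.χ_hpm]
      exact LinearMap.congr_fun hC _
    obtain ⟨a, rfl⟩ := B.exists_even_of_commute_χ _ hn hA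
    obtain ⟨b, hb⟩ := B.exists_even_of_commute_χ _ hn hC'
    -- With a supported at the end of p and b at its opposite end, the one-form is z a γ h b h⁻¹ at
    -- p. It vanishes at any other half-edge ending where p does, since that one starts elsewhere,
    -- and a kills all the rest.
    refine (Submodule.smul_mem_iff _ hz0).1 (Submodule.subset_span
      ⟨Pi.single (G.endpt p.1 p.2) a, Pi.single (G.endpt p.1 (!p.2)) b, ?_⟩)
    refine Eq.trans ?_ (splitRep_mul_commutator _ _).symm
    refine LinearMap.ext fun F => funext fun q => ?_
    rw [LinearMap.smul_apply, Pi.smul_apply, offDiag_apply, offDiag_apply]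
    by_cases hqp : q = p
    · subst hqp
      rw [Pi.single_eq_same, Pi.single_eq_same, Pi.single_eq_same, hb,
        Pi.single_eq_of_ne (endpt_ne q.1 q.2)]
      have : (B.hpm q.1 q.2).conj ((B.hpm q.1 q.2).symm.conj C) = C := by
        ext ψ; simp [LinearEquiv.conj_apply]
      rw [this]
      simp [hz, mul_assoc]
    · rw [Pi.single_eq_of_ne hqp]
      by_cases h₁ : G.endpt q.1 q.2 = G.endpt p.1 p.2
      · have h₂ : G.endpt q.1 (!q.2) ≠ G.endpt p.1 (!p.2) := fun h₂ => hqp (eq_of_endpt_eq h₁ h₂)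
        have h₃ : G.endpt q.1 q.2 ≠ G.endpt p.1 (!p.2) := h₁ ▸ endpt_ne p.1 p.2
        rw [Pi.single_eq_of_ne h₂, Pi.single_eq_of_ne h₃]
        simp
      · rw [Pi.single_eq_of_ne h₁]
        simp

end DiscreteSpinorBundle

/-! ### The axioms of an antilorentzian spectral spacetime. -/

namespace DiscreteSpinorBundle

variable {V E : Type*} {G : WeightedOrientedGraph V E} {n : ℕ} {X S : V → Type*}
  [∀ v, AddCommGroup (X v)] [∀ v, Module ℝ (X v)]
  [∀ v, AddCommGroup (S v)] [∀ v, Module ℂ (S v)] [∀ v, FiniteDimensional ℂ (S v)]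
  {B : DiscreteSpinorBundle G n X S}

/-- The minus sign in the reality condition on γ is compensated by the opposite signs of D at the
two ends of e, so that D commutes with J. -/
theorem IsSpectral.J_γ (hB : B.IsSpectral) (e : E) (c : ℝ) :
    (∀ ψ : S (G.tgt e), B.J (G.tgt e) (B.h e (((1 / c : ℂ) • B.γ e false) ((B.h e).symm ψ))) =
      (1 : ℂ) • ((-1 / c : ℂ) • B.γ e true) (B.J (G.tgt e) ψ)) ∧
    (∀ ψ : S (G.tgt e), B.J (G.tgt e) (((-1 / c : ℂ) • B.γ e true) ψ) =
      (1 : ℂ) • B.h e (((1 / c : ℂ) • B.γ e false) ((B.h e).symm (B.J (G.tgt e) ψ)))) := by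
  have key (γ₁ : Module.End ℂ (S (G.tgt e))) (γ₀ : Module.End ℂ (S (G.src e)))
      (h : ∀ ψ, B.J (G.tgt e) (γ₁ ψ) = -(B.h e (γ₀ ((B.h e).symm (B.J (G.tgt e) ψ))))) :
      (∀ ψ, B.J (G.tgt e) (B.h e (((1 / c : ℂ) • γ₀) ((B.h e).symm ψ))) =
        (1 : ℂ) • ((-1 / c : ℂ) • γ₁) (B.J (G.tgt e) ψ)) ∧
      (∀ ψ, B.J (G.tgt e) (((-1 / c : ℂ) • γ₁) ψ) =
        (1 : ℂ) • B.h e (((1 / c : ℂ) • γ₀) ((B.h e).symm (B.J (G.tgt e) ψ)))) := by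
    have h' : ∀ ψ, B.J (G.tgt e) ((B.h e).conj γ₀ ψ) = conj (-1 : ℂ) • γ₁ (B.J (G.tgt e) ψ) :=
      J_conj_real fun ψ => by
        rw [LinearEquiv.conj_apply_apply, h, neg_one_smul, neg_neg]
    have hc : ∀ z : ℂ, conj (z / (c : ℂ)) = conj z / c := fun z => by
      rw [map_div₀, Complex.conj_ofReal]
    refine ⟨fun ψ => ?_, fun ψ => ?_⟩
    · have := h' ψ
      rw [LinearEquiv.conj_apply_apply] at this
      rw [LinearMap.smul_apply, map_smul, LinearMap.map_smulₛₗ, this, hc, one_smul,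
        LinearMap.smul_apply, smul_smul, map_one, map_neg, map_one]
      congr 1
      ring
    · rw [LinearMap.smul_apply, LinearMap.map_smulₛₗ, h, hc, one_smul, LinearMap.smul_apply,
        map_smul, map_neg, map_one, neg_div, neg_smul, smul_neg, neg_neg]
  exact key (B.γ e true) (B.γ e false) (hB.γ_real e)

theorem IsSpectral.exists_isAntilorentzianSpacetime [Fintype E] (hn : Even n) (hB : B.IsSpectral)
    (hβ : ∃ β, B.splitDiracStructure.IsPositiveTimeOrientation β) :
    ∃ k, B.splitDiracStructure.IsAntilorentzianSpacetime k := by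
  -- The KO dimension is read off from ε and the parity of n/2.
  obtain ⟨k, hk⟩ : ∃ k, IsAntilorentzianKOSigns k B.ε ((-1) ^ (n / 2 + 1)) (-1) := by
    rcases B.ε_sign with h | h <;> rcases neg_one_pow_eq_or ℂ (n / 2 + 1) with h' | h' <;>
      rw [h, h']
    · exact ⟨0, Or.inr (Or.inl ⟨rfl, rfl, rfl, rfl⟩)⟩
    · exact ⟨6, Or.inr (Or.inr (Or.inl ⟨rfl, rfl, rfl, rfl⟩))⟩
    · exact ⟨4, Or.inr (Or.inr (Or.inr ⟨rfl, rfl, rfl, rfl⟩))⟩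
    · exact ⟨2, Or.inl ⟨rfl, rfl, rfl, rfl⟩⟩
  refine ⟨k, ?_⟩
  have hχs : ∀ F p, B.swap (B.splitChirality F) p = B.χ _ (B.swap F p) := fun F p =>
    (hB.χ_hpm p.1 p.2 _).symm
  exact
    { krein := isKreinProduct_splitKrein hB.metric
      D_selfAdjoint := by
        change IsAdjointFor (fun F G => B.splitKrein F G) B.splitDirac B.splitDirac
        rw [splitDirac_eq]
        refine offDiag_selfAdjoint hB.metric fun p ψ φ => ?_
        have h : B.krein _ (B.γ p.1 p.2 ψ) φ = B.krein _ ψ (B.γ p.1 p.2 φ) :=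
          hB.γ_selfAdjoint p.1 p.2 ψ φ
        have hc : conj ((if p.2 then -1 else 1) / (G.weight p.1 : ℂ)) =
            (if p.2 then -1 else 1) / (G.weight p.1 : ℂ) := by
          rw [map_div₀, Complex.conj_ofReal]
          split_ifs <;> simp
        simp only [LinearMap.smul_apply, LinearMap.map_smulₛₗ, hc, h, map_smul]
      χ_sq := LinearMap.ext fun F => funext fun p => LinearMap.congr_fun (B.χ_sq _ hn) (F p)
      χ_comm := fun a => LinearMap.ext fun F => funext fun p =>
        (LinearMap.congr_fun (B.χ_ρ_of_mem_even _ hn (a (G.endpt p.1 p.2)).2) (F p)).symm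
      χ_D := by
        change B.splitChirality * B.splitDirac = -(B.splitDirac * B.splitChirality)
        refine LinearMap.ext fun F => funext fun p => ?_
        rw [splitDirac_eq, LinearMap.neg_apply, Pi.neg_apply, Module.End.mul_apply,
          Module.End.mul_apply, splitChirality_apply, offDiag_apply, offDiag_apply, hχs,
          LinearMap.smul_apply, LinearMap.smul_apply, map_smul, ← smul_neg]
        exact congrArg _ (LinearMap.congr_fun (hB.γ_odd p.1 p.2) (B.swap F p))
      χ_adjoint := fun F F' => by
        change B.splitKrein (B.splitChirality F) F' = B.splitKrein F ((-B.splitChirality) F')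
        rw [splitKrein_eq, splitKrein_eq]
        refine Finset.sum_congr rfl fun p _ => ?_
        rw [LinearMap.neg_apply, map_neg, Pi.neg_apply, hχs]
        exact B.χ_adjoint _ hn (F p) (B.swap F' p)
      J_spec := by
        refine ⟨B.ε, (-1) ^ (n / 2 + 1), -1, hk, fun F => funext fun p => ?_, fun F => ?_,
          fun F => funext fun p => ?_, splitKrein_splitJ hB⟩
        · change B.splitJ (B.splitJ F) p = B.ε • F p
          rw [hB.splitJ_apply, swap_splitJ, B.J_sq]
        · change B.splitJ (B.splitDirac F) = B.splitDirac (B.splitJ F)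
          rw [splitDirac_eq, hB.splitJ_offDiag (s := 1), one_smul]
          · exact fun e => (hB.J_γ e (G.weight e)).1
          · exact fun e => (hB.J_γ e (G.weight e)).2
        · change B.splitJ (B.splitChirality F) p = (-1 : ℂ) ^ (n / 2 + 1) • B.χ _ (B.splitJ F p)
          rw [hB.splitJ_apply, hχs, hB.splitJ_apply, B.J_χ _ hn]
      exists_orientation := hβ }

/-! ### Positive time-orientation forms -/

theorem exists_orientation_of_family [Fintype E] (hn : Even n) (hB : B.IsSpectral)
    {T : ∀ p : E × Bool, Module.End ℂ (S (G.endpt p.1 p.2))} (hT : ∀ p, B.IsPositiveOdd _ (T p))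
    (hJ : ∀ e (ψ : S (G.tgt e)), T (e, true) (B.J (G.tgt e) ψ) =
      -B.J (G.tgt e) (B.h e (T (e, false) ((B.h e).symm ψ)))) :
    ∃ β : (Module.End ℂ B.Sections)ˣ, (β : Module.End ℂ B.Sections) = B.offDiag T ∧
      B.splitDiracStructure.IsPositiveTimeOrientation β := by
  have hinj : Function.Injective (B.offDiag T) := by
    rw [injective_iff_map_eq_zero]
    intro F hF
    have h0 : B.swap F = 0 := funext fun p => by
      have h1 : T p (B.swap F p) = T p 0 := by rw [map_zero]; exact congrFun hF p
      exact (hT p).posDef.injective h1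
    rw [← B.swap_swap F, h0, map_zero]
  obtain ⟨β, hβ⟩ : IsUnit (B.offDiag T) :=
    (LinearMap.isUnit_iff_ker_eq_bot _).2 (LinearMap.ker_eq_bot.2 hinj)
  refine ⟨β, hβ, ?_, ?_, ?_, ?_⟩
  · rw [hβ]; exact offDiag_mem_oneForms hn hB fun p => (hT p).odd
  · rw [hβ]; exact offDiag_selfAdjoint hB.metric fun p => (hT p).selfAdjoint
  · intro F
    rw [hβ]
    change B.splitJ (B.offDiag T F) = -B.offDiag T (B.splitJ F)
    rw [hB.splitJ_offDiag (s := -1), neg_one_smul]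
    · intro e ψ
      exact (((neg_one_smul ℂ _).trans (congrArg Neg.neg (hJ e ψ))).trans (neg_neg _)).symm
    · intro e ψ
      have key (T₁ : Module.End ℂ (S (G.tgt e))) (T₀ : Module.End ℂ (S (G.src e)))
          (h : ∀ ψ, T₁ (B.J (G.tgt e) ψ) = -B.J (G.tgt e) (B.h e (T₀ ((B.h e).symm ψ))))
          (ψ : S (G.tgt e)) : B.J (G.tgt e) (T₁ ψ) =
            (-1 : ℂ) • B.h e (T₀ ((B.h e).symm (B.J (G.tgt e) ψ))) := by
        have := J_conj_real (B := B) (T := T₁) (T' := (B.h e).conj T₀) (s := -1)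
          (fun ψ => by rw [h, LinearEquiv.conj_apply_apply, neg_one_smul]) ψ
        rw [this, LinearEquiv.conj_apply_apply, map_neg, map_one]
      exact key (T (e, true)) (T (e, false)) (hJ e) ψ
  · intro F hF
    set H := (↑β⁻¹ : Module.End ℂ B.Sections) F with hH
    have hFH : F = B.offDiag T H := by
      rw [hH, ← hβ, ← Module.End.mul_apply, Units.mul_inv]; rfl
    -- With F = βH, the form (F, β⁻¹F) is the sum of the fibrewise positive forms evaluated on `swap
    -- H`.
    have hval : B.splitKrein F H = ∑ p, B.krein _ (B.swap H p) (T p (B.swap H p)) := by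
      rw [hFH, splitKrein_offDiag_left]
      exact Finset.sum_congr rfl fun p _ => (hT p).selfAdjoint _ _
    have hnn : ∀ p, 0 ≤ (B.krein _ (B.swap H p) (T p (B.swap H p))).re ∧
        (B.krein _ (B.swap H p) (T p (B.swap H p))).im = 0 := fun p => by
      by_cases h : B.swap H p = 0
      · simp [h]
      · exact ⟨((hT p).posDef _ h).1.le, ((hT p).posDef _ h).2⟩
    change 0 < (B.splitKrein F H).re ∧ (B.splitKrein F H).im = 0
    rw [hval, Complex.re_sum, Complex.im_sum]
    refine ⟨?_, Finset.sum_eq_zero fun p _ => (hnn p).2⟩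
    obtain ⟨p, hp⟩ : ∃ p, B.swap H p ≠ 0 := by
      by_contra! h
      have h0 : B.swap H = 0 := funext h
      have hH0 : H = 0 := by rw [← B.swap_swap H, h0, map_zero]
      exact hF (by rw [hFH, hH0, map_zero])
    exact Finset.sum_pos' (fun p _ => (hnn p).1) ⟨p, Finset.mem_univ p, ((hT p).posDef _ hp).1⟩

/-- The properties of β are tested on sections concentrated at one half-edge, which isolates each
component T p. -/
theorem exists_family_of_orientation [Fintype E] (hn : Even n) (hB : B.IsSpectral)
    {β : (Module.End ℂ B.Sections)ˣ} (hβ : B.splitDiracStructure.IsPositiveTimeOrientation β) :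
    ∃ T : ∀ p : E × Bool, Module.End ℂ (S (G.endpt p.1 p.2)),
      (β : Module.End ℂ B.Sections) = B.offDiag T ∧ (∀ p, B.IsPositiveOdd _ (T p)) ∧
      ∀ e (ψ : S (G.tgt e)), T (e, true) (B.J (G.tgt e) ψ) =
        -B.J (G.tgt e) (B.h e (T (e, false) ((B.h e).symm ψ))) := by
  classical
  obtain ⟨T, hodd, hT⟩ := exists_offDiag_of_mem_oneForms hn hB hβ.oneForm
  have hsum : ∀ p (ψ φ : S (G.endpt p.1 p.2)),
      B.splitKrein (B.offDiag T (B.swap (Pi.single p ψ))) (B.swap (Pi.single p φ)) =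
        B.krein _ (T p ψ) φ := fun p ψ φ => by
    rw [splitKrein_offDiag_left, Finset.sum_eq_single p]
    · simp
    · intro q _ hq
      rw [swap_swap, swap_swap, Pi.single_eq_of_ne hq, Pi.single_eq_of_ne hq]
      simp
    · simp
  have hsum' : ∀ p (ψ φ : S (G.endpt p.1 p.2)),
      B.splitKrein (B.swap (Pi.single p ψ)) (B.offDiag T (B.swap (Pi.single p φ))) =
        B.krein _ ψ (T p φ) := fun p ψ φ => by
    rw [splitKrein_offDiag_right hB.metric, Finset.sum_eq_single p]
    · simp
    · intro q _ hq
      rw [swap_swap, swap_swap, Pi.single_eq_of_ne hq, Pi.single_eq_of_ne hq]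
      simp
    · simp
  have hsa : ∀ p, IsAdjointFor (fun ψ φ => B.krein _ ψ φ) (T p) (T p) := fun p ψ φ => by
    change B.krein _ (T p ψ) φ = B.krein _ ψ (T p φ)
    rw [← hsum, ← hsum', ← hT]
    exact hβ.selfAdjoint _ _
  refine ⟨T, hT, fun p => ⟨hodd p, hsa p, fun ψ hψ => ?_⟩, fun e ψ => ?_⟩
  · set F := B.swap (Pi.single p ψ) with hF
    have hinv : (↑β⁻¹ : Module.End ℂ B.Sections) (B.offDiag T F) = F := by
      rw [← hT, ← Module.End.mul_apply, Units.inv_mul]; rfl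
    have hF0 : B.offDiag T F ≠ 0 := fun h0 => by
      rw [h0, map_zero] at hinv
      have h1 : B.swap F = 0 := by rw [← hinv, map_zero]
      rw [hF, swap_swap] at h1
      exact hψ (by simpa using congrFun h1 p)
    have h := hβ.posDef _ hF0
    rw [hinv] at h
    have h2 : B.splitKrein (B.offDiag T F) F = B.krein _ ψ (T p ψ) :=
      (hsum p ψ ψ).trans (hsa p ψ ψ)
    change 0 < (B.splitKrein (B.offDiag T F) F).re ∧ (B.splitKrein (B.offDiag T F) F).im = 0 at h
    rwa [h2] at h
  · let F : B.Sections := Pi.single (M := fun p : E × Bool => S (G.endpt p.1 p.2)) (e, true) ψ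
    have hFe : F (e, true) = ψ :=
      Pi.single_eq_same (M := fun p : E × Bool => S (G.endpt p.1 p.2)) (e, true) ψ
    have h := congrFun (hβ.imaginary F) (e, true)
    rw [hT] at h
    have h1 : B.splitJ (B.offDiag T F) (e, true) =
        B.J (G.tgt e) (B.h e (T (e, false) ((B.h e).symm (F (e, true))))) := by
      rw [hB.splitJ_apply]; rfl
    have h2 : B.offDiag T (B.splitJ F) (e, true) = T (e, true) (B.J (G.tgt e) (F (e, true))) := by
      rw [offDiag_apply, swap_splitJ]; rfl
    have h3 := h1.symm.trans (h.trans (congrArg Neg.neg h2))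
    rw [hFe] at h3
    exact (neg_eq_iff_eq_neg.2 h3).symm

/-! ### Reconstructibility -/

/-- Because χ^× = -χ, the Krein adjoint preserves the commutant of χ, which is the image of the even
part. -/
theorem exists_even_adjoint (hn : Even n) (a : B.EvenSections) :
    ∃ a' : B.EvenSections, ∀ v, IsAdjointFor (fun ψ φ => B.krein v ψ φ) (B.ρ v (a v : CCl (B.Q v)))
      (B.ρ v (a' v : CCl (B.Q v))) := by
  have h : ∀ v, ∃ a' : CCl.even (B.Q v), IsAdjointFor (fun ψ φ => B.krein v ψ φ)
      (B.ρ v (a v : CCl (B.Q v))) (B.ρ v (a' : CCl (B.Q v))) := fun v => by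
    obtain ⟨A, hA⟩ := (B.isKrein v).exists_adjoint (B.ρ v (a v : CCl (B.Q v)))
    have hχ := B.χ_adjoint v hn
    have h1 := hA.mul hχ
    rw [← B.χ_ρ_of_mem_even v hn (a v).2] at h1
    have h2 := IsAdjointFor.unique (B.isKrein v) h1 (hχ.mul hA)
    rw [neg_mul, mul_neg, neg_inj] at h2
    obtain ⟨a', rfl⟩ := B.exists_even_of_commute_χ v hn h2
    exact ⟨a', hA⟩
  choose a' ha' using h
  exact ⟨a', ha'⟩

theorem splitRep_adjoint [Fintype E] {a a' : B.EvenSections}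
    (h : ∀ v, IsAdjointFor (fun ψ φ => B.krein v ψ φ) (B.ρ v (a v : CCl (B.Q v)))
      (B.ρ v (a' v : CCl (B.Q v)))) (β : (Module.End ℂ B.Sections)ˣ) :
    IsAdjointFor (B.splitDiracStructure.innerWith β) (B.splitRep a)
      (β * (B.swap * B.splitRep a' * B.swap) * (↑β⁻¹ : Module.End ℂ B.Sections)) := by
  intro F F'
  set H := (↑β⁻¹ : Module.End ℂ B.Sections) F' with hH
  have h1 : (↑β⁻¹ : Module.End ℂ B.Sections) ((β * (B.swap * B.splitRep a' * B.swap) *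
      (↑β⁻¹ : Module.End ℂ B.Sections)) F') = B.swap (B.splitRep a' (B.swap H)) := by
    rw [← Module.End.mul_apply, ← mul_assoc, ← mul_assoc, Units.inv_mul, one_mul]
    rfl
  change B.splitKrein (B.splitRep a F) H = B.splitKrein F _
  rw [h1, splitKrein_eq, splitKrein_eq, swap_swap]
  exact Finset.sum_congr rfl fun p _ => h _ _ _

/-- Makes the stability of π(A⁰) local: a'(v) has to work for all the half-edges ending at v
simultaneously. -/
theorem splitRep_mul_offDiag_iff (T : ∀ p : E × Bool, Module.End ℂ (S (G.endpt p.1 p.2)))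
    (a a' : B.EvenSections) :
    B.splitRep a' * B.offDiag T = B.offDiag T * (B.swap * B.splitRep a * B.swap) ↔
      ∀ p, B.ρ _ (a' (G.endpt p.1 p.2) : CCl (B.Q _)) * T p =
        T p * B.ρ _ (a (G.endpt p.1 p.2) : CCl (B.Q _)) := by
  classical
  have h2 : ∀ F p, (B.offDiag T * (B.swap * B.splitRep a * B.swap)) F p =
      T p (B.ρ _ (a (G.endpt p.1 p.2) : CCl (B.Q _)) (B.swap F p)) := fun F p => by
    change T p (B.swap (B.swap (B.splitRep a (B.swap F))) p) = _
    rw [swap_swap]; rfl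
  constructor
  · intro h p
    ext ψ
    have h1 := congrFun (LinearMap.congr_fun h (B.swap (Pi.single p ψ))) p
    rw [h2, swap_swap, Pi.single_eq_same] at h1
    have h3 : (B.splitRep a' * B.offDiag T) (B.swap (Pi.single p ψ)) p =
        B.ρ _ (a' (G.endpt p.1 p.2) : CCl (B.Q _)) (T p (B.swap (B.swap (Pi.single p ψ)) p)) := rfl
    rw [h3, swap_swap, Pi.single_eq_same] at h1
    exact h1
  · intro h
    refine LinearMap.ext fun F => funext fun p => ?_
    rw [h2]
    exact LinearMap.congr_fun (h p) (B.swap F p)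

/-- A path from the source of some edge to v is either trivial or ends with an edge at v. Without
this, elements supported at an isolated vertex would be invisible to π. -/
theorem exists_endpt_eq [Nonempty E] (hG : G.Connected) (v : V) :
    ∃ p : E × Bool, G.endpt p.1 p.2 = v := by
  obtain ⟨e⟩ := ‹Nonempty E›
  obtain ⟨w⟩ := hG (G.src e) v
  cases w with
  | nil => exact ⟨(e, false), rfl⟩
  | fwd e' _ => exact ⟨(e', true), rfl⟩
  | bwd e' _ => exact ⟨(e', false), rfl⟩

theorem splitRep_injective [Nonempty E] (hG : G.Connected) (hn : Even n) :
    Function.Injective B.splitRep := by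
  classical
  rw [injective_iff_map_eq_zero]
  intro a ha
  funext v
  obtain ⟨p, rfl⟩ := exists_endpt_eq hG v
  apply Subtype.ext
  apply B.ρ_injective _ hn
  ext ψ
  have h := congrFun (LinearMap.congr_fun ha (Pi.single p ψ)) p
  rw [splitRep_apply, Pi.single_eq_same] at h
  simpa using h

/-- A sufficient condition for reconstructibility. -/
theorem isReconstructible_of_family [Fintype E] [Nonempty E] (hG : G.Connected) (hn : Even n)
    (hB : B.IsSpectral) {T : ∀ p : E × Bool, Module.End ℂ (S (G.endpt p.1 p.2))}
    (hT : ∀ p, B.IsPositiveOdd _ (T p))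
    (hJ : ∀ e (ψ : S (G.tgt e)), T (e, true) (B.J (G.tgt e) ψ) =
      -B.J (G.tgt e) (B.h e (T (e, false) ((B.h e).symm ψ))))
    (U : ∀ v, Module.End ℂ (S v)) (hU : ∀ v, B.IsPositiveOdd v (U v))
    (hTU : ∀ p A A', B.χ _ * A = A * B.χ _ → A' * U _ = U _ * A → A' * T p = T p * A) :
    B.splitDiracStructure.IsReconstructible := by
  obtain ⟨β, hβT, hβ⟩ := exists_orientation_of_family hn hB hT hJ
  refine ⟨hB.exists_isAntilorentzianSpacetime hn ⟨β, hβ⟩, splitRep_injective hG hn, β, hβ, ?_⟩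
  have hK := isKreinProduct_splitKrein hB.metric
  have huniq : ∀ {A T T' : Module.End ℂ B.Sections},
      IsAdjointFor (B.splitDiracStructure.innerWith β) A T →
      IsAdjointFor (B.splitDiracStructure.innerWith β) A T' → T = T' := by
    intro A T T' h h'
    refine LinearMap.ext fun F' => ?_
    have h1 : (↑β⁻¹ : Module.End ℂ B.Sections) (T F') = (↑β⁻¹ : Module.End ℂ B.Sections) (T' F') :=
      hK.eq_of_forall fun F => (h F F').symm.trans (h' F F')
    have h2 := congrArg (β : Module.End ℂ B.Sections) h1
    have h3 : ∀ F, (β : Module.End ℂ B.Sections) ((↑β⁻¹ : Module.End ℂ B.Sections) F) = F :=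
      fun F => LinearMap.congr_fun (Units.mul_inv β) F
    rwa [h3, h3] at h2
  have hconj : ∀ a a' : B.EvenSections, (∀ p : E × Bool,
      B.ρ _ (a' (G.endpt p.1 p.2) : CCl (B.Q _)) * T p =
        T p * B.ρ _ (a (G.endpt p.1 p.2) : CCl (B.Q _))) →
      β * (B.swap * B.splitRep a * B.swap) * (↑β⁻¹ : Module.End ℂ B.Sections) = B.splitRep a' :=
    fun a a' h => by
      rw [Units.mul_inv_eq_iff_eq_mul, hβT]
      exact ((splitRep_mul_offDiag_iff T a a').2 h).symm
  have hunit : ∀ v, IsUnit (U v) := fun v => (hU v).posDef.isUnit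
  -- Conjugation by the odd invertible U v preserves evenness.
  have hodd2 : ∀ v {A A' : Module.End ℂ (S v)}, A' * U v = U v * A →
      B.χ v * A = A * B.χ v → B.χ v * A' = A' * B.χ v := fun v {A A'} h hA => by
    apply (hunit v).mul_right_cancel
    have hodd := (hU v).odd
    have hodd' : B.χ v * U v = -(U v * B.χ v) := hodd
    rw [mul_assoc, h, ← mul_assoc, hodd, neg_mul, mul_assoc, hA, mul_assoc, hodd', mul_neg,
      ← mul_assoc A', h, mul_assoc]
  have hodd3 : ∀ v {A A' : Module.End ℂ (S v)}, A' * U v = U v * A →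
      B.χ v * A' = A' * B.χ v → B.χ v * A = A * B.χ v := fun v {A A'} h hA => by
    apply (hunit v).mul_left_cancel
    have hodd : U v * B.χ v = -(B.χ v * U v) := by rw [(hU v).odd, neg_neg]
    rw [← mul_assoc, hodd, neg_mul, mul_assoc, ← h, ← mul_assoc, hA, mul_assoc, (hU v).odd, mul_neg,
      neg_neg, ← mul_assoc, ← mul_assoc, h]
  ext R
  constructor
  · rintro ⟨a, ha⟩
    obtain ⟨ax, hax⟩ := exists_even_adjoint hn a
    have h : ∀ v, ∃ a' : CCl.even (B.Q v), B.ρ v (a' : CCl (B.Q v)) * U v =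
        U v * B.ρ v (ax v : CCl (B.Q v)) := fun v => by
      obtain ⟨u, hu⟩ := hunit v
      have hA : (U v * B.ρ v (ax v : CCl (B.Q v)) * (↑u⁻¹ : Module.End ℂ (S v))) * U v =
          U v * B.ρ v (ax v : CCl (B.Q v)) := by
        rw [mul_assoc, ← hu, Units.inv_mul, mul_one]
      obtain ⟨a', ha'⟩ := B.exists_even_of_commute_χ v hn
        (hodd2 v hA (B.χ_ρ_of_mem_even v hn (ax v).2))
      exact ⟨a', by rw [ha', hA]⟩
    choose a' ha' using h
    refine ⟨a', ?_⟩
    have h1 := splitRep_adjoint hax β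
    rw [hconj ax a' fun p => hTU p _ _ (B.χ_ρ_of_mem_even _ hn (ax _).2) (ha' _)] at h1
    exact huniq h1 ha
  -- Take a = U⁻¹ a' U at each vertex; the element whose β-adjoint is π(a') is then the Krein
  -- adjoint of a.
  · rintro ⟨a', rfl⟩
    have h : ∀ v, ∃ a : CCl.even (B.Q v), B.ρ v (a' v : CCl (B.Q v)) * U v =
        U v * B.ρ v (a : CCl (B.Q v)) := fun v => by
      obtain ⟨u, hu⟩ := hunit v
      have hA : B.ρ v (a' v : CCl (B.Q v)) * U v =
          U v * ((↑u⁻¹ : Module.End ℂ (S v)) * (B.ρ v (a' v : CCl (B.Q v)) * U v)) := by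
        rw [← mul_assoc (U v), ← hu, Units.mul_inv, one_mul]
      obtain ⟨a, ha⟩ := B.exists_even_of_commute_χ v hn
        (hodd3 v hA (B.χ_ρ_of_mem_even v hn (a' v).2))
      exact ⟨a, by rw [ha, ← hA]⟩
    choose a ha using h
    obtain ⟨ax, hax⟩ := exists_even_adjoint hn a
    refine ⟨ax, ?_⟩
    have h1 := splitRep_adjoint (fun v => (hax v).symm (B.isKrein v)) β
    rwa [hconj a a' fun p => hTU p _ _ (B.χ_ρ_of_mem_even _ hn (a _).2) (ha _)] at h1

/-- The family of operators provided by reconstructibility. -/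
theorem exists_family_of_isReconstructible [Fintype E] (hn : Even n)
    (hB : B.IsSpectral) (hR : B.splitDiracStructure.IsReconstructible) :
    ∃ T : ∀ p : E × Bool, Module.End ℂ (S (G.endpt p.1 p.2)), (∀ p, B.IsPositiveOdd _ (T p)) ∧
      (∀ e (ψ : S (G.tgt e)), T (e, true) (B.J (G.tgt e) ψ) =
        -B.J (G.tgt e) (B.h e (T (e, false) ((B.h e).symm ψ)))) ∧
      ∀ a : B.EvenSections, ∃ a' : B.EvenSections, ∀ p,
        B.ρ _ (a' (G.endpt p.1 p.2) : CCl (B.Q _)) * T p =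
          T p * B.ρ _ (a (G.endpt p.1 p.2) : CCl (B.Q _)) := by
  obtain ⟨-, -, β, hβ, hset⟩ := hR
  obtain ⟨T, hβT, hT, hJ⟩ := exists_family_of_orientation hn hB hβ
  refine ⟨T, hT, hJ, fun a => ?_⟩
  obtain ⟨ax, hax⟩ := exists_even_adjoint hn a
  -- Stability is applied to the Krein adjoint of a, so that a itself appears in the conjugated
  -- operator.
  have h1 := splitRep_adjoint (fun v => (hax v).symm (B.isKrein v)) β
  obtain ⟨a', ha'⟩ := hset.subset ⟨ax, h1⟩
  refine ⟨a', (splitRep_mul_offDiag_iff T a a').1 ?_⟩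
  have h2 : B.splitRep a' = β * (B.swap * B.splitRep a * B.swap) *
      (↑β⁻¹ : Module.End ℂ B.Sections) := ha'
  rw [h2, ← hβT, mul_assoc, Units.inv_mul, mul_one]

end DiscreteSpinorBundle

namespace DiscreteSpinorBundle

variable {V E : Type*} {G : WeightedOrientedGraph V E} {n : ℕ} {X S : V → Type*}
  [∀ v, AddCommGroup (X v)] [∀ v, Module ℝ (X v)]
  [∀ v, AddCommGroup (S v)] [∀ v, Module ℂ (S v)] [∀ v, FiniteDimensional ℂ (S v)]
  {B : DiscreteSpinorBundle G n X S}

/-! ### Dimension two -/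

theorem IsPositiveOdd.conj {v w : V} (h : S v ≃ₗ[ℂ] S w)
    (hχ : ∀ ψ, B.χ w (h ψ) = h (B.χ v ψ))
    (hK : ∀ ψ φ, B.krein w (h ψ) (h φ) = B.krein v ψ φ) {T : Module.End ℂ (S v)}
    (hT : B.IsPositiveOdd v T) : B.IsPositiveOdd w (h.conj T) where
  odd := by
    ext ψ
    obtain ⟨φ, rfl⟩ := h.surjective ψ
    have h1 : B.χ v (T φ) = -T (B.χ v φ) := LinearMap.congr_fun hT.odd φ
    simp [LinearEquiv.conj_apply, hχ, h1]
  selfAdjoint ψ φ := by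
    obtain ⟨ψ, rfl⟩ := h.surjective ψ
    obtain ⟨φ, rfl⟩ := h.surjective φ
    have h1 : B.krein v (T ψ) φ = B.krein v ψ (T φ) := hT.selfAdjoint ψ φ
    simp [LinearEquiv.conj_apply, hK, h1]
  posDef ψ hψ := by
    obtain ⟨ψ, rfl⟩ := h.surjective ψ
    simpa [LinearEquiv.conj_apply, hK] using hT.posDef ψ fun h0 => hψ (by rw [h0, map_zero])

/-- The family equal to `U` at the sources of the edges and transported to their targets. -/
def sourceFamily (B : DiscreteSpinorBundle G n X S) (U : ∀ v, Module.End ℂ (S v)) :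
    ∀ p : E × Bool, Module.End ℂ (S (G.endpt p.1 p.2))
  | (e, false) => U (G.src e)
  | (e, true) => (B.h e).conj (U (G.src e))

/-- The transported operators at the targets need not be vectors: being odd and positive suffices,
as even operators commute. -/
theorem isReconstructible_of_eq_two [Fintype E] [Nonempty E] (hG : G.Connected) (hn : n = 2)
    (hB : B.IsSpectral) : B.splitDiracStructure.IsReconstructible := by
  have hev : Even n := by rw [hn]; exact even_two
  have hu : ∀ v, ∃ u : X v, B.Q v u = 1 ∧ B.IsFutureTimelike u := fun v => by
    obtain ⟨u, h1, h2, -⟩ := B.exists_unit_future v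
    exact ⟨u, h1, by rw [IsTimelike, h1]; exact one_pos, h2⟩
  choose u hu1 hu2 using hu
  have hpos : ∀ v, B.IsPositiveOdd v (B.cliff v (u v)) := fun v => (hu2 v).isPositiveOdd hev
  have hT : ∀ p, B.IsPositiveOdd _ (B.sourceFamily (fun v => B.cliff v (u v)) p) := by
    rintro ⟨e, _ | _⟩
    · exact hpos (G.src e)
    · exact (hpos (G.src e)).conj (B.h e) (hB.preservesOrientation e) (hB.metric e)
  refine isReconstructible_of_family hG hev hB hT (fun e ψ => ?_)
    (fun v => B.cliff v (u v)) hpos fun p A A' hA hAA' => ?_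
  · change (B.h e).conj (B.cliff (G.src e) (u (G.src e))) (B.J (G.tgt e) ψ) =
      -B.J (G.tgt e) (B.h e (B.cliff (G.src e) (u (G.src e)) ((B.h e).symm ψ)))
    obtain ⟨φ, rfl⟩ := (B.h e).surjective ψ
    rw [← hB.spinPreserving, LinearEquiv.conj_apply_apply, LinearEquiv.symm_apply_apply,
      LinearEquiv.symm_apply_apply, ← hB.spinPreserving, J_cliff, map_neg, neg_neg]
  · set T := B.sourceFamily (fun v => B.cliff v (u v)) p with hTdef
    set U := B.cliff _ (u (G.endpt p.1 p.2)) with hU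
    have hUU : U * U = 1 := by rw [hU, cliff_mul_self, hu1]; simp
    -- U T is even and so commutes with A; hence T = U (U T) intertwines A and A' whenever U does.
    have hC : B.χ _ * (U * T) = U * T * B.χ _ := by
      rw [← mul_assoc, (hpos _).odd, neg_mul, mul_assoc, (hT p).odd, mul_neg, neg_neg, mul_assoc]
    have hcomm := B.commute_of_eq_two _ hn hA hC
    have hTU : T = U * (U * T) := by rw [← mul_assoc, hUU, one_mul]
    rw [hTU, ← mul_assoc A', hAA', mul_assoc U A, hcomm, mul_assoc U (U * T)]

/-! ### Parallel vector fields -/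

theorem adTransport_apply_eq_iff {v w : V} (p : G.Walk v w) (T : Module.End ℂ (S v))
    (T' : Module.End ℂ (S w)) :
    T' = B.adTransport p T ↔ ∀ ψ, B.transport p (T ψ) = T' (B.transport p ψ) := by
  have h : ∀ ψ, B.adTransport p T (B.transport p ψ) = B.transport p (T ψ) := fun ψ => by
    change B.transport p (T ((B.transport p).symm (B.transport p ψ))) = _
    rw [LinearEquiv.symm_apply_apply]
  constructor
  · rintro rfl ψ
    exact (h ψ).symm
  · intro hT
    ext ψ
    obtain ⟨φ, rfl⟩ := (B.transport p).surjective ψ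
    rw [h, hT]

theorem isParallel_of_edges {u : ∀ v, X v} (hu : ∀ e ψ, B.h e (B.cliff (G.src e) (u (G.src e)) ψ) =
    B.cliff (G.tgt e) (u (G.tgt e)) (B.h e ψ)) : B.IsParallel u := by
  intro v w p
  rw [adTransport_apply_eq_iff]
  induction p with
  | nil => exact fun _ => rfl
  | fwd e p ih =>
    intro ψ
    change B.h e (B.transport p _) = B.cliff _ _ (B.h e (B.transport p ψ))
    rw [ih, hu]
  | bwd e p ih =>
    intro ψ
    change (B.h e).symm (B.transport p _) = B.cliff _ _ ((B.h e).symm (B.transport p ψ))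
    rw [ih, LinearEquiv.symm_apply_eq, hu, LinearEquiv.apply_symm_apply]

theorem IsParallel.edge {u : ∀ v, X v} (hu : B.IsParallel u) (e : E) (ψ : S (G.src e)) :
    B.h e (B.cliff (G.src e) (u (G.src e)) ψ) = B.cliff (G.tgt e) (u (G.tgt e)) (B.h e ψ) :=
  (adTransport_apply_eq_iff _ _ _).1 (hu _ _ (.fwd e .nil)) ψ

theorem isReconstructible_of_isParallel [Fintype E] [Nonempty E] (hG : G.Connected) (hn : Even n)
    (hB : B.IsSpectral) {u : ∀ v, X v} (hu : B.IsParallel u)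
    (hu' : ∀ v, B.IsFutureTimelike (u v)) : B.splitDiracStructure.IsReconstructible := by
  refine isReconstructible_of_family hG hn hB (T := fun p => B.cliff _ (u (G.endpt p.1 p.2)))
    (fun p => (hu' _).isPositiveOdd hn) (fun e ψ => ?_) (fun v => B.cliff v (u v))
    (fun v => (hu' v).isPositiveOdd hn) fun p A A' _ h => h
  change B.cliff (G.tgt e) (u (G.tgt e)) (B.J (G.tgt e) ψ) =
    -B.J (G.tgt e) (B.h e (B.cliff (G.src e) (u (G.src e)) ((B.h e).symm ψ)))
  rw [hu.edge, LinearEquiv.apply_symm_apply, J_cliff, neg_neg]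

theorem exists_isParallel_of_isReconstructible [Fintype E] [Nonempty E] (hG : G.Connected)
    (hn : Even n) (hn2 : 2 < n) (hB : B.IsSpectral) (hC : B.IsCliffordConnection)
    (hR : B.splitDiracStructure.IsReconstructible) :
    ∃ u : ∀ v, X v, B.IsParallel u ∧ ∀ v, B.IsFutureTimelike (u v) := by
  classical
  obtain ⟨T, hT, hJ, hstar⟩ := exists_family_of_isReconstructible hn hB hR
  -- All half-edges ending at v give the same vector, because stability makes their operators
  -- conjugate even elements at v identically.
  have hvertex : ∀ v, ∃ x : X v, B.IsFutureTimelike x ∧ ∀ (p : E × Bool)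
      (hp : G.endpt p.1 p.2 = v), B.timeVec v (hp ▸ T p) = x := fun v => by
    obtain ⟨p₀, rfl⟩ := exists_endpt_eq hG v
    refine ⟨B.timeVec _ (T p₀), timeVec_future hn hn2 (hT p₀), fun p hp => ?_⟩
    have hpos : ∀ w (hp : G.endpt p.1 p.2 = w), B.IsPositiveOdd w (hp ▸ T p) := by
      rintro _ rfl; exact hT p
    refine timeVec_eq hn (hpos _ hp) (hT p₀) fun A hA => ?_
    obtain ⟨a, rfl⟩ := B.exists_even_of_commute_χ _ hn hA
    obtain ⟨a', ha'⟩ := hstar (Pi.single (G.endpt p₀.1 p₀.2) a)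
    have htr : ∀ w (hp : G.endpt p.1 p.2 = w), B.ρ w (a' w : CCl (B.Q w)) * (hp ▸ T p) =
        (hp ▸ T p) *
          B.ρ w ((Pi.single (G.endpt p₀.1 p₀.2) a : B.EvenSections) w : CCl (B.Q w)) := by
      rintro _ rfl; exact ha' p
    have h1 := htr _ hp
    have h2 := ha' p₀
    rw [Pi.single_eq_same] at h1 h2
    exact ⟨_, h1, h2⟩
  choose u hu1 hu2 using hvertex
  refine ⟨u, isParallel_of_edges fun e ψ => ?_, hu1⟩
  obtain ⟨Λ, hΛ⟩ := hC e
  have h1 : B.timeVec (G.tgt e) (T (e, true)) = u (G.tgt e) := hu2 _ (e, true) rfl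
  have h0 : B.timeVec (G.src e) (T (e, false)) = u (G.src e) := hu2 _ (e, false) rfl
  -- The J-relation links the operators at the two ends of e, and the Clifford property then carries
  -- the source vector to the target one.
  have h2 : B.timeVec (G.tgt e) (T (e, true)) =
      B.timeVec (G.tgt e) ((B.h e).conj (T (e, false))) :=
    timeVec_of_J hn (hJ e)
  have h3 : B.timeVec (G.tgt e) ((B.h e).conj (T (e, false))) =
      Λ (B.timeVec (G.src e) (T (e, false))) :=
    timeVec_transport (B.h e) Λ hΛ (hB.preservesOrientation e) (T (e, false))
  have h4 : u (G.tgt e) = Λ (u (G.src e)) :=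
    h1.symm.trans (h2.trans (h3.trans (congrArg Λ h0)))
  rw [h4, hΛ]

/-! ### Holonomy -/

theorem IsCliffordConnection.exists_transport (hC : B.IsCliffordConnection) {v w : V}
    (p : G.Walk v w) (x : X v) :
    ∃ y : X w, ∀ ψ, B.transport p (B.cliff v x ψ) = B.cliff w y (B.transport p ψ) := by
  induction p with
  | nil => exact ⟨x, fun _ => rfl⟩
  | fwd e p ih =>
    obtain ⟨y, hy⟩ := ih
    obtain ⟨Λ, hΛ⟩ := hC e
    refine ⟨Λ y, fun ψ => ?_⟩
    change B.h e (B.transport p _) = B.cliff _ _ (B.h e (B.transport p ψ))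
    rw [hy, hΛ]
  | bwd e p ih =>
    obtain ⟨y, hy⟩ := ih
    obtain ⟨Λ, hΛ⟩ := hC e
    -- The map Λ goes from source to target only, so a backward step needs its surjectivity.
    obtain ⟨z, rfl⟩ := surjective_of_intertwines (B.h e) hΛ y
    refine ⟨z, fun ψ => ?_⟩
    change (B.h e).symm (B.transport p _) = B.cliff _ _ ((B.h e).symm (B.transport p ψ))
    rw [hy, LinearEquiv.symm_apply_eq, hΛ, LinearEquiv.apply_symm_apply]

theorem IsMetric.krein_transport (hB : B.IsMetric) {v w : V} (p : G.Walk v w) (ψ φ : S v) :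
    B.krein w (B.transport p ψ) (B.transport p φ) = B.krein v ψ φ := by
  induction p with
  | nil => rfl
  | fwd e p ih => exact (hB e _ _).trans ih
  | bwd e p ih =>
    change B.krein _ ((B.h e).symm (B.transport p ψ)) ((B.h e).symm (B.transport p φ)) = _
    rw [← hB e, LinearEquiv.apply_symm_apply, LinearEquiv.apply_symm_apply, ih]

theorem IsFutureTimelike.transport (hB : B.IsMetric) {v w : V} (p : G.Walk v w) {x : X v}
    (hx : B.IsFutureTimelike x) {y : X w}
    (hy : ∀ ψ, B.transport p (B.cliff v x ψ) = B.cliff w y (B.transport p ψ)) :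
    B.IsFutureTimelike y := by
  refine ⟨?_, fun ψ hψ => ?_⟩
  · rw [IsTimelike, Q_eq_of_intertwines (B.transport p) hy]
    exact hx.1
  · obtain ⟨φ, rfl⟩ := (B.transport p).surjective ψ
    rw [← hy, hB.krein_transport]
    exact hx.2 φ fun h0 => hψ (by rw [h0, map_zero])

theorem IsParallel.isHolonomyFixed {u : ∀ v, X v} (hu : B.IsParallel u) (v : V) :
    B.IsHolonomyFixed (u v) := by
  rintro _ ⟨p, rfl⟩
  exact (hu v v p).symm

theorem exists_isParallel_of_isHolonomyFixed (hG : G.Connected) (hB : B.IsMetric)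
    (hC : B.IsCliffordConnection) {v : V} {x : X v} (hx : B.IsTimelike x)
    (hfix : B.IsHolonomyFixed x) :
    ∃ u : ∀ v, X v, B.IsParallel u ∧ ∀ v, B.IsFutureTimelike (u v) := by
  obtain ⟨x, hx, hfix⟩ : ∃ x : X v, B.IsFutureTimelike x ∧ B.IsHolonomyFixed x := by
    rcases B.future_or_past v hx with h | h
    · exact ⟨x, h, hfix⟩
    · exact ⟨-x, h, fun g hg => by rw [cliff_neg, map_neg, hfix g hg]⟩
  -- Transport x along an arbitrarily chosen path to each vertex; the invariance of x under loops
  -- removes the choice.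
  have P : ∀ w, G.Walk v w := fun w => (hG v w).some
  choose u hu using fun w => hC.exists_transport (P w) x
  refine ⟨u, fun a b q => ?_, fun w => hx.transport hB (P w) (hu w)⟩
  rw [adTransport_apply_eq_iff]
  intro ψ
  obtain ⟨φ, rfl⟩ := (B.transport (P a)).surjective ψ
  rw [← hu a]
  -- Closing q up through the chosen paths to its ends gives a loop at v.
  have hloop := hfix _ ⟨((P a).append q).append (P b).reverse, rfl⟩
  have h := (adTransport_apply_eq_iff _ _ _).1 hloop.symm φ
  simp only [transport_append, transport_reverse, LinearEquiv.trans_apply] at h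
  rw [LinearEquiv.symm_apply_eq, hu b, LinearEquiv.apply_symm_apply] at h
  exact h

end DiscreteSpinorBundle

/-! ### The reconstruction theorem. -/

theorem mainTheorem1 {V E : Type*} [Fintype V] [Fintype E] [Nonempty E]
    {X S : V → Type*} [∀ v, AddCommGroup (X v)] [∀ v, Module ℝ (X v)]
    [∀ v, AddCommGroup (S v)] [∀ v, Module ℂ (S v)] [∀ v, FiniteDimensional ℂ (S v)]
    (G : WeightedOrientedGraph V E) (hG : G.Connected) (n : ℕ) (hn : Even n)
    (B : DiscreteSpinorBundle G n X S) (hB : B.IsSpectral) :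
    (n = 2 → B.splitDiracStructure.IsReconstructible) ∧
    (2 < n → B.IsCliffordConnection →
      (B.splitDiracStructure.IsReconstructible ↔
        ∃ u : ∀ v, X v, B.IsParallel u ∧ ∀ v, B.IsFutureTimelike (u v)) ∧
      ∀ v, (B.splitDiracStructure.IsReconstructible ↔
        ∃ x : X v, B.IsTimelike x ∧ B.IsHolonomyFixed x)) := by
  refine ⟨fun h2 => B.isReconstructible_of_eq_two hG h2 hB, fun hn2 hC => ?_⟩
  have h : B.splitDiracStructure.IsReconstructible ↔
      ∃ u : ∀ v, X v, B.IsParallel u ∧ ∀ v, B.IsFutureTimelike (u v) :=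
    ⟨B.exists_isParallel_of_isReconstructible hG hn hn2 hB hC,
      fun ⟨_, hu, hu'⟩ => B.isReconstructible_of_isParallel hG hn hB hu hu'⟩
  refine ⟨h, fun v => h.trans ⟨fun ⟨u, hu, hu'⟩ => ⟨u v, (hu' v).1, hu.isHolonomyFixed v⟩,
    fun ⟨x, hx, hfix⟩ => B.exists_isParallel_of_isHolonomyFixed hG hB.metric hC hx hfix⟩⟩

end
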